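/- **Setting.** Let $r\ge 1$, $d_i\ge 2$ and $D_i=\{1,\dots,d_i\}$ for $i\in\{1,\dots,r\}$, and $n=\sum_i d_i$. Let $$f(x_1,\dots,x_r)=\sum_{i}c_i(x_i)+\sum_{i<j}c_{ij}(x_i,x_j)\qquad (x_i\in D_i),$$ with $c_i:D_i\to[0,\infty)$ and $c_{ij}:D_i\times D_j\to[0,+\infty]$, $c_{ij}(a,b)=c_{ji}(b,a)$. The function $f$, given by these terms, is *Z-free* if $c_{ij}(a,b)\ge\min\{c_{jk}(b,c),c_{ik}(a,c)\}$ for all distinct $i,j,k$ and all $a\in D_i,b\in D_j,c\in D_k$ (joint winner property), and if for all $i\ne j$, $a\neq b$ in $D_i$ and $c\ne d$ in $D_j$ the minimum of $c_{ij}(a,c),c_{ij}(a,d),c_{ij}(b,c),c_{ij}(b,d)$ is attained at least twice. Let $U=\{(i,a): 1\le i\le r,\ a\in D_i\}$, so $|U|=n$, and identify $\{0,1\}$-vectors with subsets of $U$. An assignment $x$ corresponds to $\hat x=\{(i,x_i): 1\le i\le r\}$; let $B$ be the set of all these $\hat x$. A function $g:\{0,1\}^U\to\mathbb R\cup\{+\infty\}$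 is *M$^\natural$-convex* if for all $X,Y$ and $u\in X\setminus Y$ either $g(X-u)+g(Y+u)\le g(X)+g(Y)$ or $g(X-u+v)+g(Y+u-v)\le g(X)+g(Y)$ for some $v\in Y\setminus X$. **The algorithm.** *Step 1 (completion).* Choose a symmetric $\tilde h$ with values in $\mathbb R\cup\{+\infty\}$ on pairs of elements of $U$ with $\tilde h_{(i,a),(j,b)}=c_{ij}(a,b)$ for $i\ne j$ such that $\bar f(X)=\sum_{(i,a)\in X}c_i(a)+\sum_{\{u,v\}\subseteq X,\,u\neq v}\tilde h_{u,v}$ is M$^\natural$-convex. Let $\bar f|_r(X)=\bar f(X)$ if $|X|=r$ and $+\infty$ otherwise. *Step 2 (greedy).* Start with $X=\emptyset$; $r$ times, add to $X$ an element $u\notin X$ that minimizes $\bar f(X+u)$. *Step 3 (successive shortest paths).* Let $p=0$ on $V=\{s,t\}\cup U$ and take any $Y\in B$. Repeat the following until $X=Y$, or $\bar f|_r(X)=+\infty$, or $t$ cannot be reached from $s$ in the auxiliary graph. The auxiliary graph on $V$ has the arcs $(s,u)$ for $u\in X\setminus Y$; $(v,t)$ for $v\in Y\setminus X$; arcs $(u,v)\in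 E_X$ for $u\in X$, $v\notin X$ with $\bar f|_r(X-u+v)<+\infty$, of length $\ell=\bar f|_r(X-u+v)-\bar f|_r(X)$; and arcs $(u,v)\in E_Y$ for $u\notin Y$, $v\in Y$ with $Y+u-v\in B$. All arcs outside $E_X$ have length $\ell=0$, and an arc of $E_X$ and an arc of $E_Y$ with the same ends are different, parallel arcs. Put $\ell_p(u,v)=\ell(u,v)+p(u)-p(v)$. For each $v$ reachable from $s$ let $\Delta p(v)$ be the length of a shortest $s$–$v$ path with respect to $\ell_p$, and let $P$ be a shortest $s$–$t$ path with respect to $\ell_p$ that has the smallest number of arcs. Replace $X$ by $X-u+v$ simultaneously for all $(u,v)\in P\cap E_X$, replace $Y$ by $Y+u-v$ simultaneously for all $(u,v)\in P\cap E_Y$, and add $\Delta p(v)$ to $p(v)$ for each $v$ reachable from $s$ (the other potentials stay unchanged). The output is the assignment that corresponds to the final $Y$. **Theorem.** Let $f$ be Z-free. 1. *Correctness.* Whatever admissible choices are made in Steps 1–3, each iteration of Step 3 can be carried out unless a stopping criterion holds, at most $r$ iterations take place, and when Step 3 stops, $Y=\hat x$ for a minimizer $x$ of $f$; moreover $X=\hat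 x$ as well unless $f\equiv+\infty$. 2. *Running time.* The algorithm can be implemented so that it runs in $$O(nr^3+nr\log n+n^2)$$ time. That is, there are one program, for a random access machine with unit-cost additions, subtractions and comparisons of natural numbers and of elements of $\mathbb R\cup\{+\infty\}$, unit-cost access to arrays, and no multiplication, and one constant $C$, such that for every Z-free $f$, given by $r$, the $d_i$ and the tables of the $c_i$ and $c_{ij}$, the program halts after at most $C(nr^3+nr\log n+n^2)$ steps, and at that time its memory holds a record of a complete run of the algorithm (the completion $\tilde h$, the elements chosen in Step 2 in order, the number of iterations of Step 3, and $X$, $Y$, $p$ before the first and after each iteration), together with the assignment $x$ with $\hat x=Y$ for the final $Y$, which is a minimizer of $f$. -/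

import Mathlib

/-! ## Binary valued constraint satisfaction problems and Z-freeness -/

/-- An explicitly given function
`f(x₁, …, x_r) = ∑ i, c_i(x_i) + ∑ i < j, c_ij(x_i, x_j)` on `D₁ × ⋯ × D_r` with `|D_i| = d_i ≥ 2`,
finite nonnegative unary terms and binary terms in `[0, +∞]`, where `c_ij(a, b) = c_ji(b, a)`.
`WithTop ℝ` is `ℝ ∪ {+∞}`. The values `bin i i` carry no information and are never used. -/
structure BinaryVCSP where
  r : ℕ
  r_pos : 1 ≤ r
  d : Fin r → ℕ
  two_le_d : ∀ i, 2 ≤ d i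
  un : (i : Fin r) → Fin (d i) → ℝ
  un_nonneg : ∀ i a, 0 ≤ un i a
  bin : (i j : Fin r) → Fin (d i) → Fin (d j) → WithTop ℝ
  bin_nonneg : ∀ i j, i ≠ j → ∀ a b, 0 ≤ bin i j a b
  bin_symm : ∀ i j, i ≠ j → ∀ a b, bin i j a b = bin j i b a

namespace BinaryVCSP

/-- Points of `D₁ × ⋯ × D_r`. -/
abbrev Assignment (I : BinaryVCSP) : Type := (i : Fin I.r) → Fin (I.d i)

/-- The set `U` of all pairs (variable, value). -/
abbrev U (I : BinaryVCSP) : Type := (i : Fin I.r) × Fin (I.d i)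

/-- `n = |U| = ∑ i, d_i`. -/
def n (I : BinaryVCSP) : ℕ := ∑ i, I.d i

/-- The lexicographic numbering `(1,1), …, (1,d₁), (2,1), …, (r,d_r)` of `U` (from `0`). -/
def pos (I : BinaryVCSP) : I.U ≃ Fin I.n := finSigmaFinEquiv

/-- The function to be minimized. -/
noncomputable def f (I : BinaryVCSP) (x : I.Assignment) : WithTop ℝ :=
  ∑ i, ((I.un i (x i) : ℝ) : WithTop ℝ) + ∑ i, ∑ j ∈ Finset.Ioi i, I.bin i j (x i) (x j)

def IsMinimizer (I : BinaryVCSP) (x : I.Assignment) : Prop := ∀ y, I.f x ≤ I.f y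

/-- The joint winner property. -/
def JWP (I : BinaryVCSP) : Prop :=
  ∀ i j k : Fin I.r, i ≠ j → j ≠ k → i ≠ k → ∀ a b c,
    min (I.bin j k b c) (I.bin i k a c) ≤ I.bin i j a b

open Classical in
/-- Z-freeness: the joint winner property, and the minimum over each
`{a, b} × {c, d} ⊆ D_i × D_j` (`i ≠ j`, `a ≠ b`, `c ≠ d`) is attained at least twice. -/
def ZFree (I : BinaryVCSP) : Prop :=
  I.JWP ∧ ∀ i j : Fin I.r, i ≠ j → ∀ a b : Fin (I.d i), a ≠ b → ∀ c d : Fin (I.d j), c ≠ d →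
    2 ≤ ((({a, b} : Finset (Fin (I.d i))) ×ˢ ({c, d} : Finset (Fin (I.d j)))).filter
      fun e => ∀ e' ∈ ({a, b} : Finset (Fin (I.d i))) ×ˢ ({c, d} : Finset (Fin (I.d j))),
        I.bin i j e.1 e.2 ≤ I.bin i j e'.1 e'.2).card

end BinaryVCSP

/-! ## M♮-convexity and completion

A vector of `{0,1}^U` is written as the finite set of its nonzero coordinates. -/

/-- M♮-convexity of a function on `{0,1}^α`; the first alternative is the choice `j = 0`. -/
def MNatConvex {α : Type} [DecidableEq α] (f : Finset α → WithTop ℝ) : Prop :=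
  ∀ X Y : Finset α, ∀ i ∈ X \ Y,
    f (X.erase i) + f (insert i Y) ≤ f X + f Y ∨
    ∃ j ∈ Y \ X, f (insert j (X.erase i)) + f ((insert i Y).erase j) ≤ f X + f Y

namespace BinaryVCSP

/-- The vector of `{0,1}^U` that corresponds to the assignment `x`. -/
def vec (I : BinaryVCSP) (x : I.Assignment) : Finset I.U :=
  Finset.univ.image fun i => (⟨i, x i⟩ : I.U)

/-- `Y ∈ dom δ_U`: `Y` is the vector of an assignment. -/
def IsFeasible (I : BinaryVCSP) (Y : Finset I.U) : Prop := ∃ x, Y = I.vec x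

/-- The quadratic function on `{0,1}^U` with linear coefficients `c_i(a)` and quadratic
coefficients `h`; every unordered pair of distinct elements is counted once. -/
noncomputable def fbar (I : BinaryVCSP) (h : I.U → I.U → WithTop ℝ) (X : Finset I.U) : WithTop ℝ :=
  ∑ u ∈ X, ((I.un u.1 u.2 : ℝ) : WithTop ℝ) +
    ∑ u ∈ X, ∑ v ∈ X with I.pos u < I.pos v, h u v

/-- `h` is an M♮-convex completion of the partially defined coefficients
`h_{(i,a),(j,b)} = c_ij(a,b)` for `i ≠ j`, undefined for `i = j`. -/
def IsCompletion (I : BinaryVCSP) (h : I.U → I.U → WithTop ℝ) : Prop :=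
  (∀ u v, h u v = h v u) ∧
  (∀ u v : I.U, u.1 ≠ v.1 → h u v = I.bin u.1 v.1 u.2 v.2) ∧
  MNatConvex (I.fbar h)

/-- The restriction of `fbar` to the vectors with component sum `r`. -/
noncomputable def fbarR (I : BinaryVCSP) (h : I.U → I.U → WithTop ℝ) (X : Finset I.U) :
    WithTop ℝ :=
  if X.card = I.r then I.fbar h X else ⊤

/-! ## The algorithm -/

/-- The first `k` elements chosen in Step 2. -/
def greedyPrefix (I : BinaryVCSP) (g : Fin I.r → I.U) (k : Fin I.r) : Finset I.U :=
  (Finset.Iio k).image g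

/-- Step 2: starting from the zero vector, `g k` is the element added in the `k`-th round. -/
def IsGreedy (I : BinaryVCSP) (h : I.U → I.U → WithTop ℝ) (g : Fin I.r → I.U) : Prop :=
  ∀ k, g k ∉ I.greedyPrefix g k ∧
    ∀ v, v ∉ I.greedyPrefix g k →
      I.fbar h (insert (g k) (I.greedyPrefix g k)) ≤ I.fbar h (insert v (I.greedyPrefix g k))

/-- The vertices `{s, t} ∪ U` of the auxiliary graph. -/
inductive Vertex (I : BinaryVCSP) : Type
  | s : Vertex I
  | t : Vertex I
  | el (u : I.U) : Vertex I

/-- The possible arcs of the auxiliary graph: `(s, u)`, `(v, t)`, and `(u, v)` once as an exchange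
arc for `X` and once as an exchange arc for `Y` (these two are different, parallel arcs). -/
inductive Arc (I : BinaryVCSP) : Type
  | src (u : I.U) : Arc I
  | snk (v : I.U) : Arc I
  | exX (u v : I.U) : Arc I
  | exY (u v : I.U) : Arc I

def Arc.tail {I : BinaryVCSP} : Arc I → Vertex I
  | .src _ => .s
  | .snk v => .el v
  | .exX u _ => .el u
  | .exY u _ => .el u

def Arc.head {I : BinaryVCSP} : Arc I → Vertex I
  | .src u => .el u
  | .snk _ => .t
  | .exX _ v => .el v
  | .exY _ v => .el v

/-- The state of Step 3: the vectors `X`, `Y` and the potential `p`. -/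
structure State (I : BinaryVCSP) where
  X : Finset I.U
  Y : Finset I.U
  p : Vertex I → ℝ

/-- The arcs that are present for given `X`, `Y`: the sets `E⁺`, `E⁻`, `E_X` and `E_Y`.
Loops are left out; they lie on no path. -/
def HasArc (I : BinaryVCSP) (h : I.U → I.U → WithTop ℝ) (S : State I) : Arc I → Prop
  | .src u => u ∈ S.X \ S.Y
  | .snk v => v ∈ S.Y \ S.X
  | .exX u v => u ∈ S.X ∧ v ∉ S.X ∧ I.fbarR h (insert v (S.X.erase u)) ≠ ⊤
  | .exY u v => u ∉ S.Y ∧ v ∈ S.Y ∧ I.IsFeasible (insert u (S.Y.erase v))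

/-- The arc length `ℓ`. It is used for `X` in the effective domain only, and for arcs that are
present, so that both values are finite. -/
noncomputable def arcLength (I : BinaryVCSP) (h : I.U → I.U → WithTop ℝ) (S : State I) :
    Arc I → ℝ
  | .exX u v => (I.fbarR h (insert v (S.X.erase u))).untopD 0 - (I.fbarR h S.X).untopD 0
  | _ => 0

/-- The modified arc length `ℓ_p(u, v) = ℓ(u, v) + p(u) - p(v)`. -/
noncomputable def modLength (I : BinaryVCSP) (h : I.U → I.U → WithTop ℝ) (S : State I)
    (e : Arc I) : ℝ :=
  I.arcLength h S e + S.p e.tail - S.p e.head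

/-- The list `P` of arcs is a walk from `v` to `w` in the auxiliary graph. -/
def IsWalk (I : BinaryVCSP) (h : I.U → I.U → WithTop ℝ) (S : State I) :
    Vertex I → Vertex I → List (Arc I) → Prop
  | v, w, [] => v = w
  | v, w, e :: P => I.HasArc h S e ∧ e.tail = v ∧ IsWalk I h S e.head w P

/-- A path: a walk without repeated vertices. -/
def IsPath (I : BinaryVCSP) (h : I.U → I.U → WithTop ℝ) (S : State I) (v w : Vertex I)
    (P : List (Arc I)) : Prop :=
  I.IsWalk h S v w P ∧ (v :: P.map Arc.head).Nodup

/-- The length of `P` with respect to the modified arc length. -/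
noncomputable def pathLength (I : BinaryVCSP) (h : I.U → I.U → WithTop ℝ) (S : State I)
    (P : List (Arc I)) : ℝ :=
  (P.map (I.modLength h S)).sum

/-- A shortest path with respect to the modified arc length. -/
def IsShortestPath (I : BinaryVCSP) (h : I.U → I.U → WithTop ℝ) (S : State I) (v w : Vertex I)
    (P : List (Arc I)) : Prop :=
  I.IsPath h S v w P ∧ ∀ Q, I.IsPath h S v w Q → I.pathLength h S P ≤ I.pathLength h S Q

open Classical in
/-- The update of `X` along `P`: the tails of the arcs in `P ∩ E_X` leave, their heads enter. -/
noncomputable def augmentX (I : BinaryVCSP) (X : Finset I.U) (P : List (Arc I)) : Finset I.U :=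
  Finset.univ.filter fun w => (w ∈ X ∧ ¬ ∃ v, Arc.exX w v ∈ P) ∨ ∃ u, Arc.exX u w ∈ P

open Classical in
/-- The update of `Y` along `P`: the tails of the arcs in `P ∩ E_Y` enter, their heads leave. -/
noncomputable def augmentY (I : BinaryVCSP) (Y : Finset I.U) (P : List (Arc I)) : Finset I.U :=
  Finset.univ.filter fun w => (w ∈ Y ∧ ¬ ∃ u, Arc.exY u w ∈ P) ∨ ∃ v, Arc.exY w v ∈ P

/-- Step 3 stops: `X = Y`, or `X` is outside the effective domain, or `t` cannot be reached. -/
def Stops (I : BinaryVCSP) (h : I.U → I.U → WithTop ℝ) (S : State I) : Prop :=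
  S.X = S.Y ∨ I.fbarR h S.X = ⊤ ∨ ¬ ∃ P, I.IsPath h S .s .t P

/-- One iteration of Step 3. For each `v` that is reachable from `s`, `dp v` is the length of a
shortest path from `s` to `v`, and the potential of `v` grows by `dp v`; it is left unchanged for
the other `v`. `P` is a shortest path from `s` to `t` with the smallest number of arcs. -/
def Iteration (I : BinaryVCSP) (h : I.U → I.U → WithTop ℝ) (S S' : State I) : Prop :=
  ¬ I.Stops h S ∧ ∃ (dp : Vertex I → ℝ) (P : List (Arc I)),
    (∀ v Q, I.IsShortestPath h S .s v Q → dp v = I.pathLength h S Q) ∧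
    (∀ v, (¬ ∃ Q, I.IsPath h S .s v Q) → dp v = 0) ∧
    I.IsShortestPath h S .s .t P ∧
    (∀ Q, I.IsShortestPath h S .s .t Q → P.length ≤ Q.length) ∧
    S'.X = I.augmentX S.X P ∧
    S'.Y = I.augmentY S.Y P ∧
    ∀ v, S'.p v = S.p v + dp v

/-- A run of the algorithm through Step 1, Step 2 and the first `K` iterations of Step 3, with any
admissible choice of the completion, of the greedy elements, of the first `Y` and of the paths. -/
structure Run (I : BinaryVCSP) where
  h : I.U → I.U → WithTop ℝ
  completion : I.IsCompletion h
  g : Fin I.r → I.U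
  greedy : I.IsGreedy h g
  K : ℕ
  st : ℕ → State I
  init_X : (st 0).X = Finset.univ.image g
  init_Y : I.IsFeasible (st 0).Y
  init_p : ∀ v, (st 0).p v = 0
  iteration : ∀ k, k < K → I.Iteration h (st k) (st (k + 1))

/-- The run is finished: Step 3 stops after the `K` iterations. -/
def Run.Finished {I : BinaryVCSP} (R : Run I) : Prop := I.Stops R.h (R.st R.K)

end BinaryVCSP

/-! ## Machine model: a random access machine with a step count

The memory consists of arrays of natural numbers and arrays of data in `ℝ ∪ {+∞}`; a program names
finitely many of them. Integers and data can be added, subtracted and compared; there is no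
multiplication. Each operation, each memory access and each test costs one step. -/

namespace RAM

/-- `N a i` and `D a i` are the cells with index `i` of the arrays with name `a`. -/
structure Mem where
  N : ℕ → ℕ → ℕ
  D : ℕ → ℕ → WithTop ℝ

/-- Subtraction of data (the value for an infinite subtrahend is immaterial). -/
noncomputable def dsub : WithTop ℝ → WithTop ℝ → WithTop ℝ
  | a, some y => a + ((-y : ℝ) : WithTop ℝ)
  | _, none => 0

/-- Integer expressions. -/
inductive NExp : Type
  | lit (k : ℕ) : NExp
  | get (a : ℕ) (i : NExp) : NExp
  | add (e e' : NExp) : NExp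
  | sub (e e' : NExp) : NExp

/-- Data expressions. -/
inductive DExp : Type
  | zero : DExp
  | top : DExp
  | get (a : ℕ) (i : NExp) : DExp
  | add (e e' : DExp) : DExp
  | sub (e e' : DExp) : DExp

/-- Tests. -/
inductive BExp : Type
  | nle (e e' : NExp) : BExp
  | dle (e e' : DExp) : BExp
  | not (b : BExp) : BExp
  | and (b b' : BExp) : BExp

/-- Programs. -/
inductive Prog : Type
  | skip : Prog
  | setN (a : ℕ) (i e : NExp) : Prog
  | setD (a : ℕ) (i : NExp) (e : DExp) : Prog
  | seq (P Q : Prog) : Prog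
  | ite (b : BExp) (P Q : Prog) : Prog
  | loop (b : BExp) (P : Prog) : Prog

def NExp.eval (m : Mem) : NExp → ℕ
  | .lit k => k
  | .get a i => m.N a (i.eval m)
  | .add e e' => e.eval m + e'.eval m
  | .sub e e' => e.eval m - e'.eval m

noncomputable def DExp.eval (m : Mem) : DExp → WithTop ℝ
  | .zero => 0
  | .top => ⊤
  | .get a i => m.D a (i.eval m)
  | .add e e' => e.eval m + e'.eval m
  | .sub e e' => dsub (e.eval m) (e'.eval m)

def BExp.eval (m : Mem) : BExp → Prop
  | .nle e e' => e.eval m ≤ e'.eval m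
  | .dle e e' => e.eval m ≤ e'.eval m
  | .not b => ¬ b.eval m
  | .and b b' => b.eval m ∧ b'.eval m

/-- The number of steps for the evaluation of an expression: one for each operation. -/
def NExp.cost : NExp → ℕ
  | .lit _ => 1
  | .get _ i => i.cost + 1
  | .add e e' => e.cost + e'.cost + 1
  | .sub e e' => e.cost + e'.cost + 1

def DExp.cost : DExp → ℕ
  | .zero => 1
  | .top => 1
  | .get _ i => i.cost + 1
  | .add e e' => e.cost + e'.cost + 1
  | .sub e e' => e.cost + e'.cost + 1

def BExp.cost : BExp → ℕ
  | .nle e e' => e.cost + e'.cost + 1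
  | .dle e e' => e.cost + e'.cost + 1
  | .not b => b.cost + 1
  | .and b b' => b.cost + b'.cost + 1

/-- Write `k` into cell `i` of the integer array `a`. -/
def Mem.setN (m : Mem) (a i k : ℕ) : Mem :=
  { m with N := Function.update m.N a (Function.update (m.N a) i k) }

/-- Write `y` into cell `i` of the data array `a`. -/
noncomputable def Mem.setD (m : Mem) (a i : ℕ) (y : WithTop ℝ) : Mem :=
  { m with D := Function.update m.D a (Function.update (m.D a) i y) }

/-- `Exec P m t m'`: program `P`, started with memory `m`, halts after exactly `t` steps with
memory `m'`. -/
inductive Exec : Prog → Mem → ℕ → Mem → Prop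
  | skip (m : Mem) : Exec .skip m 1 m
  | setN (a : ℕ) (i e : NExp) (m : Mem) :
      Exec (.setN a i e) m (i.cost + e.cost + 1) (m.setN a (i.eval m) (e.eval m))
  | setD (a : ℕ) (i : NExp) (e : DExp) (m : Mem) :
      Exec (.setD a i e) m (i.cost + e.cost + 1) (m.setD a (i.eval m) (e.eval m))
  | seq {P Q : Prog} {m m' m'' : Mem} {t t' : ℕ} :
      Exec P m t m' → Exec Q m' t' m'' → Exec (.seq P Q) m (t + t') m''
  | ite_true {b : BExp} {P Q : Prog} {m m' : Mem} {t : ℕ} :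
      b.eval m → Exec P m t m' → Exec (.ite b P Q) m (b.cost + 1 + t) m'
  | ite_false {b : BExp} {P Q : Prog} {m m' : Mem} {t : ℕ} :
      ¬ b.eval m → Exec Q m t m' → Exec (.ite b P Q) m (b.cost + 1 + t) m'
  | loop_false {b : BExp} {P : Prog} {m : Mem} :
      ¬ b.eval m → Exec (.loop b P) m (b.cost + 1) m
  | loop_true {b : BExp} {P : Prog} {m m' m'' : Mem} {t t' : ℕ} :
      b.eval m → Exec P m t m' → Exec (.loop b P) m' t' m'' →
      Exec (.loop b P) m (b.cost + 1 + t + t') m''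

end RAM

namespace BinaryVCSP

/-- The memory `m` holds the instance: the number `r`, the sizes `d_i`, the table of the unary
values and the `n × n` table of the binary values, row by row (its entries for two values of the
same variable are arbitrary, like all other cells of the memory). -/
def Encoded (I : BinaryVCSP) (m : RAM.Mem) : Prop :=
  m.N 0 0 = I.r ∧
  (∀ i : Fin I.r, m.N 1 i = I.d i) ∧
  (∀ u : I.U, m.D 0 (I.pos u) = ((I.un u.1 u.2 : ℝ) : WithTop ℝ)) ∧
  (∀ u v : I.U, u.1 ≠ v.1 → m.D 1 (I.pos u * I.n + I.pos v) = I.bin u.1 v.1 u.2 v.2)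

/-- The number of a vertex of the auxiliary graph. -/
def Vertex.pos {I : BinaryVCSP} : Vertex I → ℕ
  | .el u => I.pos u
  | .s => I.n
  | .t => I.n + 1

open Classical in
/-- The memory `m` holds a full record of the run `R`: the completion, the greedy elements in
order, the number of iterations, and `X`, `Y`, `p` before the first and after each iteration. -/
def Run.Recorded {I : BinaryVCSP} (R : Run I) (m : RAM.Mem) : Prop :=
  (∀ u v : I.U, m.D 2 (I.pos u * I.n + I.pos v) = R.h u v) ∧
  (∀ k : Fin I.r, m.N 2 k = I.pos (R.g k)) ∧
  m.N 3 0 = R.K ∧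
  (∀ k ≤ R.K, ∀ u : I.U, m.N 4 (k * I.n + I.pos u) = if u ∈ (R.st k).X then 1 else 0) ∧
  (∀ k ≤ R.K, ∀ u : I.U, m.N 5 (k * I.n + I.pos u) = if u ∈ (R.st k).Y then 1 else 0) ∧
  (∀ k ≤ R.K, ∀ v : Vertex I,
    m.D 3 (k * (I.n + 2) + v.pos) = (((R.st k).p v : ℝ) : WithTop ℝ))

/-- The output array of `m` holds the assignment `x`. -/
def Output (I : BinaryVCSP) (m : RAM.Mem) (x : I.Assignment) : Prop :=
  ∀ i : Fin I.r, m.N 6 i = x i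

end BinaryVCSP

/-! ## Quadratic M♮-convex functions -/

/-- Nonnegative symmetric weights that satisfy the ultrametric inequality with reversed order. -/
structure IsUltra {α : Type} (h : α → α → WithTop ℝ) : Prop where
  symm : ∀ u v, h u v = h v u
  nonneg : ∀ u v, u ≠ v → 0 ≤ h u v
  tri : ∀ u v w, u ≠ v → u ≠ w → v ≠ w → min (h u w) (h w v) ≤ h u v

section Exchange

variable {α : Type} [DecidableEq α]

theorem sum_erase_split {P : Finset α} {x u : α} (hx : x ∈ P) (hxu : x ≠ u)
    (φ : α → WithTop ℝ) :
    ∑ w ∈ P.erase u, φ w = φ x + ∑ w ∈ (P.erase x).erase u, φ w := by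
  rw [Finset.erase_right_comm, Finset.add_sum_erase _ _ (Finset.mem_erase.2 ⟨hxu, hx⟩)]

/-- Exchange inequality for the cross terms of disjoint sets `P`, `Q` and an element `u` of `P`. -/
theorem IsUltra.exchange {h : α → α → WithTop ℝ} (H : IsUltra h) {u : α} :
    ∀ (k : ℕ) (P Q : Finset α), P.card = k → Disjoint P Q → u ∈ P →
      (Q.card < P.card ∧ ∑ w ∈ Q, h u w ≤ ∑ w ∈ P.erase u, h u w) ∨
      ∃ v ∈ Q, ∑ w ∈ P.erase u, h v w + ∑ w ∈ Q.erase v, h u w ≤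
        ∑ w ∈ P.erase u, h u w + ∑ w ∈ Q.erase v, h v w := by
  intro k
  induction k with
  | zero =>
    intro P Q hk _ hu
    rw [Finset.card_eq_zero] at hk
    simp [hk] at hu
  | succ k ih =>
    intro P Q hk hPQ hu
    rcases Q.eq_empty_or_nonempty with rfl | hQ
    · left
      refine ⟨by simp [hk], ?_⟩
      rw [Finset.sum_empty]
      exact Finset.sum_nonneg fun w hw => H.nonneg _ _ (Finset.ne_of_mem_erase hw).symm
    -- The induction removes a heaviest cross pair. In a triangle that contains this pair and
    -- another cross pair, the minimum in the ultrametric inequality is the other cross weight,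
    -- which therefore bounds the third side from below.
    obtain ⟨⟨x, y⟩, hxy, hmax⟩ := (P ×ˢ Q).exists_max_image (fun e => h e.1 e.2)
      (Finset.Nonempty.product ⟨u, hu⟩ hQ)
    have hx := (Finset.mem_product.1 hxy).1
    have hy := (Finset.mem_product.1 hxy).2
    simp only at hx hy
    have hm : ∀ a ∈ P, ∀ b ∈ Q, h a b ≤ h x y := fun a ha b hb =>
      hmax (a, b) (Finset.mem_product.2 ⟨ha, hb⟩)
    have hne : ∀ a ∈ P, ∀ b ∈ Q, a ≠ b := fun a ha b hb hab =>
      Finset.disjoint_left.1 hPQ ha (hab ▸ hb)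
    -- If `x = u`, then `v = y` works termwise: in each triangle on `u`, `y`, `w` the cross weight
    -- other than `h u y` is at most the weight inside `P` or inside `Q`.
    by_cases hxu : x = u
    · subst hxu
      right
      refine ⟨y, hy, add_le_add (Finset.sum_le_sum fun w hw => ?_)
        (Finset.sum_le_sum fun w hw => ?_)⟩
      · have hw' := Finset.mem_of_mem_erase hw
        have := H.tri x w y (Finset.ne_of_mem_erase hw).symm
          (hne x hx y hy) (hne w hw' y hy)
        rw [H.symm y w, H.symm x y] at this
        rw [H.symm y w]
        rwa [min_eq_right] at this
        rw [H.symm y x]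
        exact hm w hw' y hy
      · have hw' := Finset.mem_of_mem_erase hw
        have := H.tri y w x (Finset.ne_of_mem_erase hw).symm
          (hne x hx y hy).symm (hne x hx w hw').symm
        rwa [min_eq_right] at this
        rw [H.symm y x]
        exact hm x hx w hw'
    · have hP' : (P.erase x).card = k := by rw [Finset.card_erase_of_mem hx, hk]; rfl
      have hD : Disjoint (P.erase x) (Q.erase y) :=
        Finset.disjoint_of_subset_left (Finset.erase_subset _ _)
          (Finset.disjoint_of_subset_right (Finset.erase_subset _ _) hPQ)
      -- The terms that `x` and `y` contribute are compared separately, so the inequality for `P -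
      -- x` and `Q - y` extends to `P` and `Q`.
      have key : h u y ≤ h u x := by
        have := H.tri u x y (Ne.symm hxu) (hne u hu y hy) (hne x hx y hy)
        rwa [min_eq_left] at this
        rw [H.symm y x]
        exact hm u hu y hy
      rcases ih (P.erase x) (Q.erase y) hP' hD (Finset.mem_erase.2 ⟨Ne.symm hxu, hu⟩) with
        ⟨hc, hs⟩ | ⟨v, hv, hs⟩
      · left
        refine ⟨?_, ?_⟩
        · rw [Finset.card_erase_of_mem hx, Finset.card_erase_of_mem hy] at hc
          omega
        · rw [sum_erase_split hx hxu, ← Finset.add_sum_erase _ _ hy]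
          exact add_le_add key hs
      · right
        have hvQ := Finset.mem_of_mem_erase hv
        have hvy := Finset.ne_of_mem_erase hv
        refine ⟨v, hvQ, ?_⟩
        have key2 : h v x ≤ h v y := by
          have := H.tri v y x hvy (hne x hx v hvQ).symm (hne x hx y hy).symm
          rwa [min_eq_left] at this
          rw [H.symm v x]
          exact hm x hx v hvQ
        rw [sum_erase_split hx hxu, sum_erase_split hx hxu, sum_erase_split hy hvy.symm,
          sum_erase_split hy hvy.symm]
        calc _ = (h v x + h u y) + (∑ w ∈ (P.erase x).erase u, h v w +
              ∑ w ∈ (Q.erase y).erase v, h u w) := by abel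
          _ ≤ (h v y + h u x) + (∑ w ∈ (P.erase x).erase u, h u w +
              ∑ w ∈ (Q.erase y).erase v, h v w) := add_le_add (add_le_add key2 key) hs
          _ = _ := by abel

end Exchange

/-! ### Ultrametric coefficients, M♮-convexity and the greedy algorithm -/

namespace BinaryVCSP

variable {I : BinaryVCSP}

/-- The increase of `fbar` when `u` is added to `A`. -/
noncomputable def marginal (I : BinaryVCSP) (h : I.U → I.U → WithTop ℝ) (u : I.U)
    (A : Finset I.U) : WithTop ℝ :=
  ((I.un u.1 u.2 : ℝ) : WithTop ℝ) + ∑ w ∈ A, h u w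

theorem fbar_insert {h : I.U → I.U → WithTop ℝ} (hs : ∀ u v, h u v = h v u) {u : I.U}
    {A : Finset I.U} (hu : u ∉ A) :
    I.fbar h (insert u A) = I.fbar h A + I.marginal h u A := by
  have h1 : ∑ a ∈ insert u A, ∑ v ∈ insert u A with I.pos a < I.pos v, h a v =
      ∑ a ∈ A, ∑ v ∈ A with I.pos a < I.pos v, h a v + ∑ w ∈ A, h u w := by
    simp only [Finset.sum_filter]
    rw [Finset.sum_insert hu]
    simp only [Finset.sum_insert hu]
    rw [Finset.sum_add_distrib, ← add_assoc, add_comm]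
    congr 1
    rw [if_neg (lt_irrefl _), zero_add, ← Finset.sum_add_distrib]
    refine Finset.sum_congr rfl fun w hw => ?_
    have hne : I.pos u ≠ I.pos w := fun e => hu (I.pos.injective e ▸ hw)
    rcases lt_or_gt_of_ne hne with hl | hl
    · rw [if_pos hl, if_neg (not_lt.2 hl.le), add_zero]
    · rw [if_pos hl, if_neg (not_lt.2 hl.le), zero_add, hs]
  unfold fbar marginal
  rw [h1, Finset.sum_insert hu]
  abel

theorem fbar_erase_add {h : I.U → I.U → WithTop ℝ} (hs : ∀ u v, h u v = h v u) {u : I.U}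
    {A : Finset I.U} (hu : u ∈ A) :
    I.fbar h A = I.fbar h (A.erase u) + I.marginal h u (A.erase u) := by
  rw [← fbar_insert hs (Finset.notMem_erase u A), Finset.insert_erase hu]

@[simp] theorem fbar_empty (h : I.U → I.U → WithTop ℝ) : I.fbar h ∅ = 0 := by simp [fbar]

theorem fbar_singleton (h : I.U → I.U → WithTop ℝ) (u : I.U) :
    I.fbar h {u} = ((I.un u.1 u.2 : ℝ) : WithTop ℝ) := by
  simp [fbar, Finset.sum_filter]

theorem fbar_pair {h : I.U → I.U → WithTop ℝ} (hs : ∀ u v, h u v = h v u) {u v : I.U}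
    (huv : u ≠ v) : I.fbar h {u, v} =
      ((I.un u.1 u.2 : ℝ) : WithTop ℝ) + ((I.un v.1 v.2 : ℝ) : WithTop ℝ) + h u v := by
  rw [fbar_insert hs (by simpa using huv), fbar_singleton, marginal, Finset.sum_singleton]
  abel

/-- The quadratic coefficients of an M♮-convex function are ultrametric. -/
theorem IsCompletion.isUltra {h : I.U → I.U → WithTop ℝ} (H : I.IsCompletion h) :
    IsUltra h := by
  obtain ⟨hs, -, hM⟩ := H
  have cancel : ∀ {a b : ℝ} {x y : WithTop ℝ}, (a : WithTop ℝ) + (b : WithTop ℝ) + x ≤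
      (a : WithTop ℝ) + (b : WithTop ℝ) + y → x ≤ y := by
    intro a b x y hxy
    rw [← WithTop.coe_add] at hxy
    exact (WithTop.add_le_add_iff_left WithTop.coe_ne_top).1 hxy
  refine ⟨hs, fun u v huv => ?_, fun u v w huv huw hvw => ?_⟩
  -- The empty set offers nothing in return, so the first alternative holds; cancelling the finite
  -- unary terms leaves `0 ≤ h u v`.
  · rcases hM {u, v} ∅ u (by simp) with h1 | ⟨j, hj, -⟩
    · have e1 : ({u, v} : Finset I.U).erase u = {v} := by
        rw [Finset.erase_insert]; simpa using huv
      rw [e1, insert_empty_eq, fbar_pair hs huv, fbar_singleton, fbar_singleton, fbar_empty,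
        add_zero, add_comm ((I.un v.1 v.2 : ℝ) : WithTop ℝ)] at h1
      refine cancel (x := 0) (a := I.un u.1 u.2) (b := I.un v.1 v.2) ?_
      rwa [add_zero]
    · simp at hj
  · have e1 : ({u, v} : Finset I.U).erase u = {v} := by
      rw [Finset.erase_insert]; simpa using huv
    have e2 : ({u, w} : Finset I.U).erase w = {u} := by
      rw [Finset.pair_comm, Finset.erase_insert]; simpa using huw.symm
    -- After cancellation of unary terms the two alternatives say `h u w ≤ h u v` and `h w v ≤ h u
    -- v`, one for each branch of the minimum.
    rcases hM {u, v} {w} u (by simp [huw]) with h1 | ⟨j, hj, h1⟩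
    · refine min_le_of_left_le ?_
      rw [e1, fbar_pair hs huw, fbar_pair hs huv, fbar_singleton, fbar_singleton] at h1
      generalize h u v = x at *
      generalize h u w = y at *
      have : ((I.un u.1 u.2 + I.un v.1 v.2 : ℝ) : WithTop ℝ) + ((I.un w.1 w.2 : ℝ)
          : WithTop ℝ) + y ≤ ((I.un u.1 u.2 + I.un v.1 v.2 : ℝ) : WithTop ℝ) +
          ((I.un w.1 w.2 : ℝ) : WithTop ℝ) + x := by
        push_cast
        convert h1 using 1 <;> abel
      exact cancel this
    · refine min_le_of_right_le ?_
      obtain rfl : j = w := by simpa using (Finset.mem_sdiff.1 hj).1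
      rw [e1, e2, fbar_pair hs hvw.symm, fbar_pair hs huv,
        fbar_singleton, fbar_singleton] at h1
      generalize h u v = x at *
      generalize h j v = y at *
      have : ((I.un u.1 u.2 + I.un v.1 v.2 : ℝ) : WithTop ℝ) + ((I.un j.1 j.2 : ℝ)
          : WithTop ℝ) + y ≤ ((I.un u.1 u.2 + I.un v.1 v.2 : ℝ) : WithTop ℝ) +
          ((I.un j.1 j.2 : ℝ) : WithTop ℝ) + x := by
        push_cast
        convert h1 using 1 <;> abel
      exact cancel this

/-- Exchange for `fbar`; the first alternative only occurs if `Y` has fewer elements. -/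
theorem fbar_exchange {h : I.U → I.U → WithTop ℝ} (H : IsUltra h) (X Y : Finset I.U) (u : I.U)
    (hu : u ∈ X \ Y) :
    (Y.card < X.card ∧ I.fbar h (X.erase u) + I.fbar h (insert u Y) ≤ I.fbar h X + I.fbar h Y) ∨
    ∃ v ∈ Y \ X, I.fbar h (insert v (X.erase u)) + I.fbar h ((insert u Y).erase v) ≤
      I.fbar h X + I.fbar h Y := by
  have huX := (Finset.mem_sdiff.1 hu).1
  have huY := (Finset.mem_sdiff.1 hu).2
  have hcX : (X \ Y).card + (X ∩ Y).card = X.card := Finset.card_sdiff_add_card_inter X Y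
  have hcY : (Y \ X).card + (X ∩ Y).card = Y.card := by
    rw [Finset.inter_comm]; exact Finset.card_sdiff_add_card_inter Y X
  have splitY : ∀ φ : I.U → WithTop ℝ, ∑ w ∈ Y, φ w = ∑ w ∈ Y \ X, φ w + ∑ w ∈ X ∩ Y, φ w := by
    intro φ
    rw [Finset.inter_comm, ← Finset.sum_union (Finset.disjoint_sdiff_inter Y X),
      Finset.sdiff_union_inter]
  have splitX : ∀ φ : I.U → WithTop ℝ, ∑ w ∈ X.erase u, φ w =
      ∑ w ∈ (X \ Y).erase u, φ w + ∑ w ∈ X ∩ Y, φ w := by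
    intro φ
    have : X.erase u = (X \ Y).erase u ∪ (X ∩ Y) := by
      ext w; by_cases hw : w = u <;> by_cases w ∈ X <;> by_cases w ∈ Y <;> simp_all
    rw [this, Finset.sum_union]
    rw [Finset.disjoint_left]; intro w; simp; tauto
  -- The weights between exchanged elements and `X ∩ Y` contribute equally to both sides, so only `X
  -- \ Y` and `Y \ X` matter.
  rcases H.exchange _ (X \ Y) (Y \ X) rfl disjoint_sdiff_sdiff hu with ⟨hc, hs⟩ | ⟨v, hv, hs⟩
  · left
    refine ⟨by omega, ?_⟩
    rw [fbar_insert H.symm huY, fbar_erase_add H.symm huX, marginal, marginal, splitY, splitX]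
    calc _ = (∑ w ∈ Y \ X, h u w) + (I.fbar h (X.erase u) + I.fbar h Y +
          ((I.un u.1 u.2 : ℝ) : WithTop ℝ) + ∑ w ∈ X ∩ Y, h u w) := by abel
      _ ≤ (∑ w ∈ (X \ Y).erase u, h u w) + (I.fbar h (X.erase u) + I.fbar h Y +
          ((I.un u.1 u.2 : ℝ) : WithTop ℝ) + ∑ w ∈ X ∩ Y, h u w) := add_le_add hs le_rfl
      _ = _ := by abel
  · right
    refine ⟨v, hv, ?_⟩
    have hvY := (Finset.mem_sdiff.1 hv).1
    have hvX := (Finset.mem_sdiff.1 hv).2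
    have huv : u ≠ v := fun e => hvX (e ▸ huX)
    have splitYv : ∀ φ : I.U → WithTop ℝ, ∑ w ∈ Y.erase v, φ w =
        ∑ w ∈ (Y \ X).erase v, φ w + ∑ w ∈ X ∩ Y, φ w := by
      intro φ
      have : Y.erase v = (Y \ X).erase v ∪ (X ∩ Y) := by
        ext w; by_cases hw : w = v <;> by_cases w ∈ X <;> by_cases w ∈ Y <;> simp_all
      rw [this, Finset.sum_union]
      rw [Finset.disjoint_left]; intro w; simp; tauto
    rw [Finset.erase_insert_of_ne huv, fbar_insert H.symm (show v ∉ X.erase u by simp [hvX]),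
      fbar_insert H.symm (show u ∉ Y.erase v by simp [huY]), fbar_erase_add H.symm huX,
      fbar_erase_add H.symm hvY, marginal, marginal, marginal, marginal, splitX, splitX, splitYv,
      splitYv]
    generalize ∑ w ∈ X ∩ Y, h u w = p
    generalize ∑ w ∈ X ∩ Y, h v w = q
    calc _ = (∑ w ∈ (X \ Y).erase u, h v w + ∑ w ∈ (Y \ X).erase v, h u w) +
          (I.fbar h (X.erase u) + I.fbar h (Y.erase v) + ((I.un u.1 u.2 : ℝ) : WithTop ℝ) +
            ((I.un v.1 v.2 : ℝ) : WithTop ℝ) + p + q) := by abel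
      _ ≤ (∑ w ∈ (X \ Y).erase u, h u w + ∑ w ∈ (Y \ X).erase v, h v w) +
          (I.fbar h (X.erase u) + I.fbar h (Y.erase v) + ((I.un u.1 u.2 : ℝ) : WithTop ℝ) +
            ((I.un v.1 v.2 : ℝ) : WithTop ℝ) + p + q) := add_le_add hs le_rfl
      _ = _ := by abel

/-- Converse of `IsCompletion.isUltra`. The correctness of a run needs only the other direction;
this one certifies that the completion computed by the program is admissible. -/
theorem mNatConvex_fbar {h : I.U → I.U → WithTop ℝ} (H : IsUltra h) : MNatConvex (I.fbar h) := by
  intro X Y u hu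
  rcases fbar_exchange H X Y u hu with ⟨-, h1⟩ | h1
  exacts [Or.inl h1, Or.inr h1]

theorem fbar_mono {h : I.U → I.U → WithTop ℝ} (H : IsUltra h) {X Y : Finset I.U} (hXY : X ⊆ Y) :
    I.fbar h X ≤ I.fbar h Y := by
  unfold fbar
  refine add_le_add (Finset.sum_le_sum_of_subset_of_nonneg hXY fun u _ _ => ?_) ?_
  · exact_mod_cast I.un_nonneg _ _
  · have hnn : ∀ u, ∀ v ∈ Y.filter (fun v => I.pos u < I.pos v), 0 ≤ h u v := by
      intro u v hv
      refine H.nonneg _ _ ?_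
      rintro rfl
      exact lt_irrefl _ (Finset.mem_filter.1 hv).2
    refine (Finset.sum_le_sum fun u _ => ?_).trans
      (Finset.sum_le_sum_of_subset_of_nonneg hXY fun u _ _ => Finset.sum_nonneg (hnn u))
    exact Finset.sum_le_sum_of_subset_of_nonneg (Finset.filter_subset_filter _ hXY)
      fun v hv _ => hnn u v hv

/-- A minimizer among the sets of size `k` can be enlarged to one among the sets of size `k + 1`. -/
theorem exists_minimizer_superset {h : I.U → I.U → WithTop ℝ} (H : IsUltra h) {X : Finset I.U}
    (hX : ∀ Z : Finset I.U, Z.card = X.card → I.fbar h X ≤ I.fbar h Z) :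
    ∀ (k : ℕ) (Z : Finset I.U), Z.card = X.card + 1 → (X \ Z).card = k → I.fbar h Z ≠ ⊤ →
      ∃ v, v ∉ X ∧ I.fbar h (insert v X) ≤ I.fbar h Z := by
  intro k
  induction k with
  | zero =>
    intro Z hZ hk _
    have hsub : X ⊆ Z := by rwa [Finset.card_eq_zero, Finset.sdiff_eq_empty_iff_subset] at hk
    obtain ⟨v, hv, hXv⟩ := Finset.exists_eq_insert_iff.2 ⟨hsub, hZ.symm⟩
    exact ⟨v, hv, hXv ▸ le_rfl⟩
  | succ k ih =>
    intro Z hZ hk hfin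
    obtain ⟨u, hu⟩ : (X \ Z).Nonempty := by rw [← Finset.card_pos]; omega
    have huX := (Finset.mem_sdiff.1 hu).1
    have huZ := (Finset.mem_sdiff.1 hu).2
    -- The first alternative is excluded by the sizes. In the second, optimality of `X` among sets
    -- of its size forces the new set on the side of `Z` to be no worse than `Z`, and it is one
    -- element closer to `X`.
    rcases fbar_exchange H X Z u hu with ⟨hc, -⟩ | ⟨v, hv, h1⟩
    · omega
    have hvZ := (Finset.mem_sdiff.1 hv).1
    have hvX := (Finset.mem_sdiff.1 hv).2
    have huv : u ≠ v := fun e => hvX (e ▸ huX)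
    have hXv : (insert v (X.erase u)).card = X.card := by
      rw [Finset.card_insert_of_notMem (by simp [hvX]), Finset.card_erase_add_one huX]
    -- Cancelling the value at `X` requires finiteness: `X` is at most as expensive as a subset of
    -- `Z` of the same size, which by monotonicity is at most as expensive as `Z`.
    have hXtop : I.fbar h X ≠ ⊤ := by
      obtain ⟨Z', hZ', hc'⟩ := Finset.exists_subset_card_eq (show X.card ≤ Z.card by omega)
      exact ne_top_of_le_ne_top hfin ((hX Z' hc').trans (fbar_mono H hZ'))
    have h2 : I.fbar h ((insert u Z).erase v) ≤ I.fbar h Z := by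
      have := (add_le_add (hX _ hXv) le_rfl).trans h1
      exact (WithTop.add_le_add_iff_left hXtop).1 this
    have hcard : ((insert u Z).erase v).card = X.card + 1 := by
      rw [Finset.card_erase_of_mem (Finset.mem_insert_of_mem hvZ), Finset.card_insert_of_notMem huZ]
      omega
    have hsd : X \ ((insert u Z).erase v) = (X \ Z).erase u := by
      ext w
      by_cases hwu : w = u
      · subst hwu; simp [huv]
      · by_cases hwv : w = v
        · subst hwv; simp [hvX]
        · simp [hwu, hwv]
    obtain ⟨w, hw, hwle⟩ := ih _ hcard (by rw [hsd, Finset.card_erase_of_mem hu, hk]; rfl)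
      (ne_top_of_le_ne_top hfin h2)
    exact ⟨w, hw, hwle.trans h2⟩

theorem greedyPrefix_succ (g : Fin I.r → I.U) (k : Fin I.r) (k' : Fin I.r)
    (hk : (k' : ℕ) = k + 1) :
    I.greedyPrefix g k' = insert (g k) (I.greedyPrefix g k) := by
  unfold greedyPrefix
  rw [← Finset.image_insert]
  congr 1
  ext x
  simp only [Finset.mem_Iio, Finset.mem_insert, Fin.lt_def, Fin.ext_iff]
  omega

/-- An arbitrary finite competitor `Z` is beaten by some one-element enlargement of the prefix, by
`exists_minimizer_superset`, and the greedy choice beats every such enlargement. -/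
theorem IsGreedy.step {h : I.U → I.U → WithTop ℝ} (H : IsUltra h) {g : Fin I.r → I.U}
    (hg : I.IsGreedy h g) (k : Fin I.r) (hc : (I.greedyPrefix g k).card = k)
    (hm : ∀ Z : Finset I.U, Z.card = k → I.fbar h (I.greedyPrefix g k) ≤ I.fbar h Z) :
    (insert (g k) (I.greedyPrefix g k)).card = k + 1 ∧
    ∀ Z : Finset I.U, Z.card = k + 1 →
      I.fbar h (insert (g k) (I.greedyPrefix g k)) ≤ I.fbar h Z := by
  refine ⟨by rw [Finset.card_insert_of_notMem (hg k).1, hc], fun Z hZ => ?_⟩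
  by_cases htop : I.fbar h Z = ⊤
  · rw [htop]; exact le_top
  obtain ⟨v, hv, hle⟩ := exists_minimizer_superset H (X := I.greedyPrefix g k)
    (by rw [hc]; exact hm) _ Z (by rw [hc, hZ]) rfl htop
  exact ((hg k).2 v hv).trans hle

theorem IsGreedy.prefix_min {h : I.U → I.U → WithTop ℝ} (H : IsUltra h) {g : Fin I.r → I.U}
    (hg : I.IsGreedy h g) : ∀ (n : ℕ) (k : Fin I.r), (k : ℕ) = n →
      (I.greedyPrefix g k).card = k ∧
      ∀ Z : Finset I.U, Z.card = k → I.fbar h (I.greedyPrefix g k) ≤ I.fbar h Z := by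
  intro n
  induction n with
  | zero =>
    intro k hk
    have : I.greedyPrefix g k = ∅ := by
      unfold greedyPrefix
      rw [Finset.image_eq_empty]
      ext x; simp only [Finset.mem_Iio, Fin.lt_def]; simp; omega
    rw [this, hk]
    refine ⟨rfl, fun Z hZ => ?_⟩
    rw [Finset.card_eq_zero] at hZ
    rw [hZ]
  | succ n ih =>
    intro k hk
    obtain ⟨hc, hm⟩ := ih ⟨n, by omega⟩ rfl
    have := IsGreedy.step H hg ⟨n, by omega⟩ hc hm
    rw [greedyPrefix_succ g ⟨n, by omega⟩ k hk, hk]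
    exact this

/-- The greedy set minimizes `fbar` over the sets of size `r`. -/
theorem IsGreedy.minimizer {h : I.U → I.U → WithTop ℝ} (H : IsUltra h) {g : Fin I.r → I.U}
    (hg : I.IsGreedy h g) : (Finset.univ.image g).card = I.r ∧
      ∀ Z : Finset I.U, Z.card = I.r → I.fbar h (Finset.univ.image g) ≤ I.fbar h Z := by
  have hr := I.r_pos
  have hlt : I.r - 1 < I.r := by omega
  obtain ⟨hc, hm⟩ := IsGreedy.prefix_min H hg (I.r - 1) ⟨I.r - 1, hlt⟩ rfl
  have := IsGreedy.step H hg ⟨I.r - 1, hlt⟩ hc hm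
  have e : Finset.univ.image g =
      insert (g ⟨I.r - 1, hlt⟩) (I.greedyPrefix g ⟨I.r - 1, hlt⟩) := by
    unfold greedyPrefix
    rw [← Finset.image_insert]
    congr 1
    ext x
    have := x.2
    simp only [Finset.mem_univ, Finset.mem_Iio, Finset.mem_insert, Fin.lt_def, Fin.ext_iff,
      true_iff]
    omega
  rw [e]
  simpa [Nat.sub_add_cancel hr] using this

end BinaryVCSP

/-! ## Functions with the valuated exchange property -/

section ExchangeFun

variable {α : Type}

/-- The exchange property of M-convex set functions. -/
def ExchangeFun [DecidableEq α] (g : Finset α → WithTop ℝ) : Prop :=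
  ∀ X Y : Finset α, g X ≠ ⊤ → g Y ≠ ⊤ → ∀ u ∈ X \ Y, ∃ v ∈ Y \ X,
    g (insert v (X.erase u)) + g ((insert u Y).erase v) ≤ g X + g Y

/-- Addition of the linear function with coefficients `-q`. -/
noncomputable def tilt (g : Finset α → WithTop ℝ) (q : α → ℝ) (X : Finset α) : WithTop ℝ :=
  g X + ((-∑ u ∈ X, q u : ℝ) : WithTop ℝ)

theorem tilt_ne_top {g : Finset α → WithTop ℝ} {q : α → ℝ} {X : Finset α} :
    tilt g q X ≠ ⊤ ↔ g X ≠ ⊤ := by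
  simp [tilt]

variable [DecidableEq α]

theorem sum_swap {q : α → ℝ} {X : Finset α} {u v : α} (hu : u ∈ X) (hv : v ∉ X) :
    ∑ w ∈ insert v (X.erase u), q w = ∑ w ∈ X, q w - q u + q v := by
  rw [Finset.sum_insert (by simp [hv]), ← Finset.add_sum_erase _ _ hu]
  ring

theorem erase_insert_swap {X : Finset α} {u v : α} (hu : u ∉ X) (hv : v ∈ X) :
    (insert u X).erase v = insert u (X.erase v) :=
  Finset.erase_insert_of_ne fun e => hu (e ▸ hv)

/-- What one set gains under an exchange the other loses, so the linear terms cancel in the sum. -/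
theorem ExchangeFun.tilt {g : Finset α → WithTop ℝ} (hg : ExchangeFun g) (q : α → ℝ) :
    ExchangeFun (tilt g q) := by
  intro X Y hX hY u hu
  obtain ⟨v, hv, h1⟩ := hg X Y (tilt_ne_top.1 hX) (tilt_ne_top.1 hY) u hu
  refine ⟨v, hv, ?_⟩
  have hu' := Finset.mem_sdiff.1 hu
  have hv' := Finset.mem_sdiff.1 hv
  rw [erase_insert_swap hu'.2 hv'.1] at h1 ⊢
  unfold _root_.tilt
  rw [sum_swap hu'.1 hv'.2, sum_swap hv'.1 hu'.2, add_add_add_comm, add_add_add_comm (g X)]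
  refine add_le_add h1 (le_of_eq ?_)
  rw [← WithTop.coe_add, ← WithTop.coe_add]
  congr 1
  ring

/-- Local optimality with respect to exchanges implies global optimality. -/
theorem ExchangeFun.le_of_local {g : Finset α → WithTop ℝ} (hg : ExchangeFun g) {X : Finset α}
    (hX : g X ≠ ⊤) (hc : ∀ Z, g Z ≠ ⊤ → Z.card = X.card)
    (hloc : ∀ u ∈ X, ∀ v, v ∉ X → g X ≤ g (insert v (X.erase u))) (Z : Finset α) : g X ≤ g Z := by
  have key : ∀ (k : ℕ) (Z : Finset α), (X \ Z).card = k → g Z ≠ ⊤ → g X ≤ g Z := by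
    intro k
    induction k with
    | zero =>
      intro Z hk hZ
      rw [Finset.card_eq_zero, Finset.sdiff_eq_empty_iff_subset] at hk
      rw [Finset.eq_of_subset_of_card_le hk (hc Z hZ).le]
    | succ k ih =>
      intro Z hk hZ
      obtain ⟨u, hu⟩ : (X \ Z).Nonempty := by rw [← Finset.card_pos]; omega
      obtain ⟨v, hv, h1⟩ := hg X Z hX hZ u hu
      have hu' := Finset.mem_sdiff.1 hu
      have hv' := Finset.mem_sdiff.1 hv
      have h2 : g ((insert u Z).erase v) ≤ g Z :=
        (WithTop.add_le_add_iff_left hX).1 ((add_le_add (hloc u hu'.1 v hv'.2) le_rfl).trans h1)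
      refine (ih _ ?_ (ne_top_of_le_ne_top hZ h2)).trans h2
      have hsd : X \ ((insert u Z).erase v) = (X \ Z).erase u := by
        have huv : u ≠ v := fun e => hv'.2 (e ▸ hu'.1)
        ext w
        by_cases hwu : w = u
        · subst hwu; simp [huv]
        · by_cases hwv : w = v
          · subst hwv; simp [hv'.2]
          · simp [hwu, hwv]
      rw [hsd, Finset.card_erase_of_mem hu, hk]
      rfl
  by_cases hZ : g Z = ⊤
  · rw [hZ]; exact le_top
  · exact key _ Z rfl hZ

/-- Finite minimizers. -/
def IsMinOf (g : Finset α → WithTop ℝ) (X : Finset α) : Prop := g X ≠ ⊤ ∧ ∀ Z, g X ≤ g Z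

/-- The exchange property of the bases of a matroid. -/
def ExchangeFamily (F : Finset α → Prop) : Prop :=
  ∀ X Y : Finset α, F X → F Y → ∀ u ∈ X \ Y, ∃ v ∈ Y \ X, F (insert v (X.erase u))

/-- The exchanged sets have together at most twice the minimum, and each has at least the minimum.
-/
theorem ExchangeFun.isMinOf {g : Finset α → WithTop ℝ} (hg : ExchangeFun g) :
    ExchangeFamily (IsMinOf g) := by
  intro X Y hX hY u hu
  obtain ⟨v, hv, h1⟩ := hg X Y hX.1 hY.1 u hu
  have h2 : g (insert v (X.erase u)) ≤ g X :=
    (WithTop.add_le_add_iff_right hY.1).1 ((add_le_add le_rfl (hY.2 _)).trans h1)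
  exact ⟨v, hv, ne_top_of_le_ne_top hX.1 h2, fun Z => h2.trans (hX.2 Z)⟩

theorem swap_comm {X : Finset α} {u u' v v' : α} (h1 : v ≠ u') (h2 : u ≠ v') :
    insert v' ((insert v (X.erase u)).erase u') = insert v ((insert v' (X.erase u')).erase u) := by
  ext w
  simp only [Finset.mem_insert, Finset.mem_erase]
  grind

theorem swap_back {X : Finset α} {u u' v : α} (hu : u ∈ X) (h1 : u ≠ u') (h2 : v ≠ u') :
    insert u ((insert v (X.erase u)).erase u') = insert v (X.erase u') := by
  ext w
  simp only [Finset.mem_insert, Finset.mem_erase]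
  grind

theorem swap_swap_left {X : Finset α} {u u' v v' : α} (hu : u' ∈ X) (hv : v' ∉ X) (h1 : u' ≠ u)
    (h2 : v ≠ v') :
    insert u' ((insert v ((insert v' (X.erase u')).erase u)).erase v') = insert v (X.erase u) := by
  ext w
  simp only [Finset.mem_insert, Finset.mem_erase]
  grind

theorem swap_swap_right {X : Finset α} {u u' v v' : α} (hu : u ∈ X) (hv : v' ∉ X) (h1 : u ≠ u')
    (h2 : v ≠ v') :
    insert u ((insert v ((insert v' (X.erase u')).erase u)).erase v') = insert v (X.erase u') := by
  ext w
  simp only [Finset.mem_insert, Finset.mem_erase]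
  grind

/-- Simultaneous exchange of pairs that are triangular in the exchange relation. -/
theorem ExchangeFamily.foldl {F : Finset α → Prop} (hF : ExchangeFamily F) :
    ∀ (L : List (α × α)) (X : Finset α), F X →
      (∀ e ∈ L, e.1 ∈ X ∧ e.2 ∉ X ∧ F (insert e.2 (X.erase e.1))) →
      L.Pairwise (fun e e' => e.1 ≠ e'.1 ∧ e.2 ≠ e'.2 ∧ ¬ F (insert e'.2 (X.erase e.1))) →
      F (L.foldl (fun X e => insert e.2 (X.erase e.1)) X) := by
  intro L
  induction L with
  | nil => intro X hX _ _; exact hX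
  | cons e L ih =>
    intro X hX hmem hpw
    rw [List.pairwise_cons] at hpw
    obtain ⟨hpw1, hpw2⟩ := hpw
    obtain ⟨h1X, h1n, h1F⟩ := hmem e List.mem_cons_self
    rw [List.foldl_cons]
    -- The first exchange leaves the relation between the remaining pairs unchanged, so
    -- triangularity is inherited. Here `e.1` is removed from the first set by exchange with the
    -- second; the replacement is `e.2`, as desired, or `a.1`, which would give the forbidden set
    -- with `b.2` in place of `e.1`.
    have pos : ∀ a ∈ L, ∀ b ∈ L, F (insert b.2 (X.erase a.1)) →
        F (insert b.2 ((insert e.2 (X.erase e.1)).erase a.1)) := by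
      intro a ha b hb hab
      obtain ⟨haX, han, -⟩ := hmem a (List.mem_cons_of_mem _ ha)
      obtain ⟨hbX, hbn, -⟩ := hmem b (List.mem_cons_of_mem _ hb)
      obtain ⟨hea, hea2, hea3⟩ := hpw1 a ha
      obtain ⟨heb, heb2, heb3⟩ := hpw1 b hb
      have hb1 : b.2 ≠ e.1 := fun h => hbn (h ▸ h1X)
      have ha2 : a.1 ≠ e.2 := fun h => h1n (h ▸ haX)
      obtain ⟨y, hy, hyF⟩ := hF _ _ hab h1F e.1 (by
        simp only [Finset.mem_sdiff, Finset.mem_insert, Finset.mem_erase]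
        exact ⟨Or.inr ⟨hea, h1X⟩, by rintro (h | h); exacts [h1n (h ▸ h1X), h.1 rfl]⟩)
      have hy' : y = e.2 ∨ y = a.1 := by
        simp only [Finset.mem_sdiff, Finset.mem_insert, Finset.mem_erase] at hy
        tauto
      rcases hy' with rfl | rfl
      · rwa [swap_comm hb1 ha2] at hyF
      · exact absurd (swap_back haX hea.symm hb1 ▸ hyF) heb3
    -- The reverse implication, needed to transfer the negative condition: `e.2` is exchanged back
    -- against `X`, and the replacement `a.1` again leads to the forbidden set.
    have neg : ∀ a ∈ L, ∀ b ∈ L, F (insert b.2 ((insert e.2 (X.erase e.1)).erase a.1)) →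
        F (insert b.2 (X.erase a.1)) := by
      intro a ha b hb hab
      obtain ⟨haX, han, -⟩ := hmem a (List.mem_cons_of_mem _ ha)
      obtain ⟨hbX, hbn, -⟩ := hmem b (List.mem_cons_of_mem _ hb)
      obtain ⟨hea, hea2, hea3⟩ := hpw1 a ha
      obtain ⟨heb, heb2, heb3⟩ := hpw1 b hb
      have hb1 : b.2 ≠ e.1 := fun h => hbn (h ▸ h1X)
      have ha2 : a.1 ≠ e.2 := fun h => h1n (h ▸ haX)
      have he : e.2 ≠ e.1 := fun h => h1n (h ▸ h1X)
      obtain ⟨y, hy, hyF⟩ := hF _ _ hab hX e.2 (by simp [h1n, ha2.symm])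
      have hy' : y = e.1 ∨ y = a.1 := by
        simp only [Finset.mem_sdiff, Finset.mem_insert, Finset.mem_erase] at hy
        tauto
      rcases hy' with rfl | rfl
      · rwa [swap_swap_left h1X h1n hea heb2.symm] at hyF
      · exact absurd (swap_swap_right haX h1n hea.symm heb2.symm ▸ hyF) heb3
    refine ih _ h1F (fun a ha => ?_) (hpw2.imp_of_mem fun {a b} ha hb hab => ?_)
    · obtain ⟨haX, han, haF⟩ := hmem a (List.mem_cons_of_mem _ ha)
      obtain ⟨hea, hea2, -⟩ := hpw1 a ha
      exact ⟨by simp [haX, hea.symm], by simp [han, hea2.symm], pos a ha a ha haF⟩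
    · exact ⟨hab.1, hab.2.1, fun h => hab.2.2 (neg a ha b hb h)⟩

/-- Leaving elements lie in `X` and entering ones do not, so no exchange undoes another and the
successive exchanges amount to the simultaneous update of the algorithm. -/
theorem mem_foldl_swap (w : α) : ∀ (L : List (α × α)) (X : Finset α),
    (∀ e ∈ L, e.1 ∈ X ∧ e.2 ∉ X) →
    (w ∈ L.foldl (fun X e => insert e.2 (X.erase e.1)) X ↔
      (w ∈ X ∧ ∀ e ∈ L, e.1 ≠ w) ∨ ∃ e ∈ L, e.2 = w) := by
  intro L X hL
  -- The induction keeps only the disjointness of leaving and entering elements, because that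
  -- condition does not mention the changing set.
  have gen : ∀ (L' : List (α × α)) (X' : Finset α), (∀ e ∈ L', ∀ e' ∈ L', e.1 ≠ e'.2) →
      (w ∈ L'.foldl (fun X e => insert e.2 (X.erase e.1)) X' ↔
        (w ∈ X' ∧ ∀ e ∈ L', e.1 ≠ w) ∨ ∃ e ∈ L', e.2 = w) := by
    intro L'
    induction L' with
    | nil => intro X' _; simp
    | cons a L' ih =>
      intro X' h
      rw [List.foldl_cons, ih _ fun e he e' he' =>
        h e (List.mem_cons_of_mem _ he) e' (List.mem_cons_of_mem _ he')]
      have h1 : ∀ e ∈ L', e.1 ≠ a.2 := fun e he =>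
        h e (List.mem_cons_of_mem _ he) a List.mem_cons_self
      simp only [Finset.mem_insert, Finset.mem_erase, List.mem_cons, forall_eq_or_imp,
        exists_eq_or_imp]
      constructor
      · rintro (⟨rfl | ⟨h2, h3⟩, h4⟩ | h2)
        · exact Or.inr (Or.inl rfl)
        · exact Or.inl ⟨h3, Ne.symm h2, h4⟩
        · exact Or.inr (Or.inr h2)
      · rintro (⟨h2, h3, h4⟩ | rfl | h2)
        · exact Or.inl ⟨Or.inr ⟨Ne.symm h3, h2⟩, h4⟩
        · exact Or.inl ⟨Or.inl rfl, h1⟩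
        · exact Or.inr h2
  exact gen L X fun e he e' he' heq => (hL e' he').2 (heq ▸ (hL e he).1)

end ExchangeFun

/-! ### The two valuated matroids: `fbarR` and the indicator of the assignments -/

namespace BinaryVCSP

variable {I : BinaryVCSP}

theorem fbarR_ne_top {h : I.U → I.U → WithTop ℝ} {X : Finset I.U} (hX : I.fbarR h X ≠ ⊤) :
    X.card = I.r := by
  by_contra hc
  exact hX (if_neg hc)

theorem card_swap {α : Type} [DecidableEq α] {X : Finset α} {u v : α} (hu : u ∈ X) (hv : v ∉ X) :
    (insert v (X.erase u)).card = X.card := by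
  rw [Finset.card_insert_of_notMem (by simp [hv]), Finset.card_erase_add_one hu]

/-- Both sets have size `r`, so the alternative without compensation, which needs a strictly smaller
second set, cannot occur. -/
theorem exchangeFun_fbarR {h : I.U → I.U → WithTop ℝ} (H : IsUltra h) :
    ExchangeFun (I.fbarR h) := by
  intro X Y hX hY u hu
  have cX := fbarR_ne_top hX
  have cY := fbarR_ne_top hY
  rcases fbar_exchange H X Y u hu with ⟨hc, -⟩ | ⟨v, hv, h1⟩
  · omega
  have hu' := Finset.mem_sdiff.1 hu
  have hv' := Finset.mem_sdiff.1 hv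
  refine ⟨v, hv, ?_⟩
  unfold fbarR
  rw [if_pos cX, if_pos cY, if_pos (by rw [card_swap hu'.1 hv'.2, cX]), if_pos]
  · exact h1
  · rw [erase_insert_swap hu'.2 hv'.1, card_swap hv'.1 hu'.2, cY]

open Classical in
/-- The indicator function of the vectors of assignments. -/
noncomputable def deltaB (I : BinaryVCSP) (Y : Finset I.U) : WithTop ℝ :=
  if I.IsFeasible Y then 0 else ⊤

theorem deltaB_ne_top {Y : Finset I.U} : I.deltaB Y ≠ ⊤ ↔ I.IsFeasible Y := by
  unfold deltaB; split_ifs <;> simp_all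

theorem mem_vec {x : I.Assignment} {u : I.U} : u ∈ I.vec x ↔ x u.1 = u.2 := by
  unfold vec
  rw [Finset.mem_image]
  constructor
  · rintro ⟨i, -, rfl⟩; rfl
  · intro hu; exact ⟨u.1, Finset.mem_univ _, by rw [hu]⟩

theorem card_vec (x : I.Assignment) : (I.vec x).card = I.r := by
  unfold vec
  rw [Finset.card_image_of_injective _ fun i j hij => congrArg Sigma.fst hij]
  simp

theorem IsFeasible.card {Y : Finset I.U} (hY : I.IsFeasible Y) : Y.card = I.r := by
  obtain ⟨x, rfl⟩ := hY
  exact card_vec x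

theorem insert_erase_vec (x : I.Assignment) (u v : I.U) (hv : v ∈ I.vec x) (huv : u.1 = v.1) :
    insert u ((I.vec x).erase v) = I.vec (Function.update x u.1 u.2) := by
  ext w
  rw [mem_vec] at hv
  simp only [Finset.mem_insert, Finset.mem_erase, mem_vec]
  obtain ⟨ui, ua⟩ := u
  obtain ⟨vi, va⟩ := v
  obtain ⟨wi, wa⟩ := w
  dsimp only at huv hv ⊢
  subst huv
  by_cases hw : wi = ui
  · subst hw
    simp only [Function.update_self]
    constructor
    · rintro (h1 | ⟨h1, h2⟩)
      · cases h1; rfl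
      · exact absurd (by rw [← hv, ← h2]) h1
    · rintro rfl; exact Or.inl rfl
  · rw [Function.update_of_ne hw]
    constructor
    · rintro (h1 | ⟨h1, h2⟩)
      · cases h1; exact absurd rfl hw
      · exact h2
    · intro h1
      exact Or.inr ⟨fun h2 => hw (by cases h2; rfl), h1⟩

/-- Exchanges between vectors of assignments take place within one variable. -/
theorem isFeasible_swap {x : I.Assignment} {u v : I.U} (_hu : u ∉ I.vec x) (hv : v ∈ I.vec x) :
    I.IsFeasible (insert u ((I.vec x).erase v)) ↔ u.1 = v.1 := by
  constructor
  · rintro ⟨y, hy⟩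
    by_contra hne
    have h1 : y u.1 = u.2 := by rw [← mem_vec, ← hy]; simp
    have h2 : (⟨v.1, y v.1⟩ : I.U) ∈ I.vec y := mem_vec.2 rfl
    rw [← hy, Finset.mem_insert, Finset.mem_erase] at h2
    rcases h2 with h2 | ⟨h2, h3⟩
    · exact hne (congrArg Sigma.fst h2).symm
    · rw [mem_vec] at h3 hv
      apply h2
      have h4 : x v.1 = y v.1 := h3
      rw [← h4, hv]
  · intro h1
    exact ⟨_, insert_erase_vec x u v hv h1⟩

/-- Base exchange in a partition matroid: `u` is traded for the value that the other assignment
gives to the same variable, and both results are assignments. -/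
theorem exchangeFun_deltaB : ExchangeFun I.deltaB := by
  intro X Y hX hY u hu
  obtain ⟨x, rfl⟩ := deltaB_ne_top.1 hX
  obtain ⟨y, rfl⟩ := deltaB_ne_top.1 hY
  have hu' := Finset.mem_sdiff.1 hu
  have hv : (⟨u.1, y u.1⟩ : I.U) ∈ I.vec y := mem_vec.2 rfl
  have hvX : (⟨u.1, y u.1⟩ : I.U) ∉ I.vec x := by
    intro h1
    rw [mem_vec] at h1
    have h1 : x u.1 = y u.1 := h1
    apply hu'.2
    rw [mem_vec, ← h1, mem_vec.1 hu'.1]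
  refine ⟨⟨u.1, y u.1⟩, Finset.mem_sdiff.2 ⟨hv, hvX⟩, ?_⟩
  rw [erase_insert_swap hu'.2 hv]
  unfold deltaB
  rw [if_pos ((isFeasible_swap hvX hu'.1).2 rfl), if_pos ((isFeasible_swap hu'.2 hv).2 rfl),
    if_pos ⟨x, rfl⟩, if_pos ⟨y, rfl⟩]

/-- The first number of the block of the variable `i`. -/
def start (I : BinaryVCSP) (i : ℕ) : ℕ :=
  ∑ j ∈ Finset.range i, if hj : j < I.r then I.d ⟨j, hj⟩ else 0

theorem start_zero : I.start 0 = 0 := rfl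

theorem start_succ (i : Fin I.r) : I.start (i + 1) = I.start i + I.d i := by
  simp [start, Finset.sum_range_succ]

theorem start_r : I.start I.r = I.n := by
  unfold start n
  rw [Finset.sum_range]
  simp

theorem pos_val (u : I.U) : (I.pos u : ℕ) = I.start u.1 + u.2 := by
  refine (finSigmaFinEquiv_apply u).trans ?_
  unfold start
  rw [Finset.sum_range]
  congr 1
  refine Finset.sum_congr rfl fun j _ => ?_
  rw [dif_pos (j.2.trans u.1.2)]
  rfl

theorem start_mono : Monotone I.start := fun _ _ hij =>
  Finset.sum_le_sum_of_subset (Finset.range_mono hij)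

/-- On the vectors of assignments, `fbar` agrees with the function to be minimized. -/
theorem fbar_vec {h : I.U → I.U → WithTop ℝ}
    (hb : ∀ u v : I.U, u.1 ≠ v.1 → h u v = I.bin u.1 v.1 u.2 v.2) (x : I.Assignment) :
    I.fbar h (I.vec x) = I.f x := by
  have inj : Function.Injective fun i => (⟨i, x i⟩ : I.U) :=
    fun i j hij => congrArg Sigma.fst hij
  -- The numbering runs block by block, so comparing the numbers of the chosen elements is comparing
  -- their variables; this matches the two ways of counting unordered pairs once.
  have hlt : ∀ i j : Fin I.r, I.pos ⟨i, x i⟩ < I.pos ⟨j, x j⟩ ↔ i < j := by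
    have mono : ∀ i j : Fin I.r, i < j → I.pos ⟨i, x i⟩ < I.pos ⟨j, x j⟩ := by
      intro i j hij
      rw [Fin.lt_def, pos_val, pos_val]
      have h1 : I.start (i + 1) ≤ I.start j := start_mono hij
      rw [start_succ] at h1
      have h2 : (x i : ℕ) < I.d i := (x i).2
      dsimp only
      omega
    intro i j
    refine ⟨fun h1 => ?_, mono i j⟩
    by_contra h2
    rcases (not_lt.1 h2).eq_or_lt with rfl | h3
    · exact lt_irrefl _ h1
    · exact lt_asymm h1 (mono j i h3)
  unfold fbar f vec
  rw [Finset.sum_image fun i _ j _ hij => inj hij, Finset.sum_image fun i _ j _ hij => inj hij]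
  congr 1
  refine Finset.sum_congr rfl fun i _ => ?_
  rw [Finset.sum_filter, Finset.sum_image fun i _ j _ hij => inj hij, ← Finset.sum_filter]
  have : Finset.univ.filter (fun j => I.pos ⟨i, x i⟩ < I.pos ⟨j, x j⟩) = Finset.Ioi i := by
    ext j; simp [hlt]
  rw [this]
  exact Finset.sum_congr rfl fun j hj => hb _ _ (Finset.mem_Ioi.1 hj).ne

end BinaryVCSP

/-! ## Walks and paths in the auxiliary graph -/

/-- This form exposes the parts of a path before, between and after two arcs, so that the middle can
be replaced by a shortcut. -/
theorem List.pairwise_of_split {β : Type} {R : β → β → Prop} : ∀ {L : List β},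
    (∀ A e B e' C, L = A ++ e :: (B ++ e' :: C) → R e e') → L.Pairwise R := by
  intro L
  induction L with
  | nil => intro _; exact List.Pairwise.nil
  | cons a L ih =>
    intro H
    refine List.pairwise_cons.2 ⟨fun b hb => ?_, ih fun A e B e' C hL => ?_⟩
    · obtain ⟨B, C, rfl⟩ := List.append_of_mem hb
      exact H [] a B b C rfl
    · exact H (a :: A) e B e' C (by rw [hL]; rfl)

theorem List.eq_zero_of_sum_nonpos {l : List ℝ} (h0 : ∀ x ∈ l, 0 ≤ x) (hs : l.sum ≤ 0) :
    ∀ x ∈ l, x = 0 := by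
  induction l with
  | nil => simp
  | cons a l ih =>
    have ha := h0 a List.mem_cons_self
    have hl : 0 ≤ l.sum := List.sum_nonneg fun x hx => h0 x (List.mem_cons_of_mem _ hx)
    rw [List.sum_cons] at hs
    intro x hx
    rcases List.mem_cons.1 hx with rfl | hx
    · linarith
    · exact ih (fun x hx => h0 x (List.mem_cons_of_mem _ hx)) (by linarith) x hx

namespace BinaryVCSP

variable {I : BinaryVCSP} {h : I.U → I.U → WithTop ℝ} {S : State I}

instance : Finite (Vertex I) := by
  refine Finite.of_injective
    (fun v : Vertex I => (match v with | .s => none | .t => some none | .el u => some (some u) :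
      Option (Option I.U))) ?_
  rintro (_ | _ | u) (_ | _ | u') h <;> simp_all

instance : Finite (Arc I) := by
  refine Finite.of_injective (fun e : Arc I =>
    (match e with
      | .src u => Sum.inl (Sum.inl u)
      | .snk u => Sum.inl (Sum.inr u)
      | .exX u v => Sum.inr (Sum.inl (u, v))
      | .exY u v => Sum.inr (Sum.inr (u, v)) : (I.U ⊕ I.U) ⊕ ((I.U × I.U) ⊕ (I.U × I.U)))) ?_
  rintro (u | u | ⟨u, v⟩ | ⟨u, v⟩) (u' | u' | ⟨u', v'⟩ | ⟨u', v'⟩) h <;> simp_all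

/-- `v` can be reached from the source. -/
def Reach (h : I.U → I.U → WithTop ℝ) (S : State I) (v : Vertex I) : Prop :=
  ∃ Q, I.IsWalk h S .s v Q

/-- The arc length modified by the potential `q`. -/
noncomputable def potLength (h : I.U → I.U → WithTop ℝ) (S : State I) (q : Vertex I → ℝ)
    (e : Arc I) : ℝ :=
  I.arcLength h S e + q e.tail - q e.head

theorem isWalk_append {v w : Vertex I} {A B : List (Arc I)} :
    I.IsWalk h S v w (A ++ B) ↔ ∃ z, I.IsWalk h S v z A ∧ I.IsWalk h S z w B := by
  induction A generalizing v with
  | nil => simp [IsWalk]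
  | cons a A ih =>
    simp only [List.cons_append, IsWalk, ih]
    constructor
    · rintro ⟨h1, h2, z, h3, h4⟩; exact ⟨z, ⟨h1, h2, h3⟩, h4⟩
    · rintro ⟨z, ⟨h1, h2, h3⟩, h4⟩; exact ⟨h1, h2, z, h3, h4⟩

theorem isWalk_singleton {e : Arc I} (he : I.HasArc h S e) : I.IsWalk h S e.tail e.head [e] :=
  ⟨he, rfl, rfl⟩

theorem Reach.source : Reach h S .s := ⟨[], rfl⟩

theorem Reach.head {e : Arc I} (he : I.HasArc h S e) (hr : Reach h S e.tail) :
    Reach h S e.head := by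
  obtain ⟨Q, hQ⟩ := hr
  exact ⟨Q ++ [e], isWalk_append.2 ⟨_, hQ, isWalk_singleton he⟩⟩

/-- Both sides are the sequence of visited vertices. The equality transfers distinctness from heads
to tails and yields the arcs before and after a given one. -/
theorem IsWalk.map_tail {v w : Vertex I} {P : List (Arc I)} (hP : I.IsWalk h S v w P) :
    P.map Arc.tail ++ [w] = v :: P.map Arc.head := by
  induction P generalizing v with
  | nil => cases hP; rfl
  | cons e P ih =>
    obtain ⟨-, h2, h3⟩ := hP
    rw [List.map_cons, List.cons_append, ih h3, h2]
    rfl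

theorem IsWalk.hasArc {v w : Vertex I} {P : List (Arc I)} (hP : I.IsWalk h S v w P) :
    ∀ e ∈ P, I.HasArc h S e := by
  induction P generalizing v with
  | nil => simp
  | cons e P ih =>
    obtain ⟨h1, h2, h3⟩ := hP
    intro a ha
    rcases List.mem_cons.1 ha with rfl | ha
    exacts [h1, ih h3 a ha]

theorem IsWalk.reach {v w : Vertex I} {P : List (Arc I)} (hP : I.IsWalk h S v w P)
    (hv : Reach h S v) : ∀ e ∈ P, Reach h S e.tail := by
  induction P generalizing v with
  | nil => simp
  | cons e P ih =>
    obtain ⟨h1, h2, h3⟩ := hP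
    intro a ha
    rcases List.mem_cons.1 ha with rfl | ha
    · rwa [h2]
    · exact ih h3 (Reach.head h1 (by rwa [h2])) a ha

theorem IsWalk.head_cases {v w : Vertex I} {P : List (Arc I)} (hP : I.IsWalk h S v w P)
    {e : Arc I} (he : e ∈ P) : e.head = w ∨ ∃ e' ∈ P, e'.tail = e.head := by
  have h1 : e.head ∈ P.map Arc.tail ++ [w] := by
    rw [hP.map_tail]; exact List.mem_cons_of_mem _ (List.mem_map_of_mem he)
  rcases List.mem_append.1 h1 with h1 | h1
  · exact Or.inr (List.mem_map.1 h1)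
  · exact Or.inl (List.mem_singleton.1 h1)

theorem IsWalk.tail_cases {v w : Vertex I} {P : List (Arc I)} (hP : I.IsWalk h S v w P)
    {e : Arc I} (he : e ∈ P) : e.tail = v ∨ ∃ e' ∈ P, e'.head = e.tail := by
  have h1 : e.tail ∈ v :: P.map Arc.head := by
    rw [← hP.map_tail]; exact List.mem_append_left _ (List.mem_map_of_mem he)
  rcases List.mem_cons.1 h1 with h1 | h1
  · exact Or.inl h1
  · exact Or.inr (List.mem_map.1 h1)

theorem IsPath.nodup_head {v w : Vertex I} {P : List (Arc I)} (hP : I.IsPath h S v w P) :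
    (P.map Arc.head).Nodup := (List.nodup_cons.1 hP.2).2

theorem IsPath.nodup_tail {v w : Vertex I} {P : List (Arc I)} (hP : I.IsPath h S v w P) :
    (P.map Arc.tail).Nodup := by
  have h1 := hP.2
  rw [← hP.1.map_tail] at h1
  exact (List.nodup_append.1 h1).1

theorem exists_suffix {v a w : Vertex I} {P : List (Arc I)} (hP : I.IsPath h S a w P)
    (hv : v ∈ a :: P.map Arc.head) : ∃ Q, I.IsPath h S v w Q ∧ Q.Sublist P := by
  induction P generalizing a with
  | nil =>
    obtain rfl : v = a := by simpa using hv
    exact ⟨[], hP, List.Sublist.refl _⟩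
  | cons e P ih =>
    rcases List.mem_cons.1 hv with rfl | hv
    · exact ⟨_, hP, List.Sublist.refl _⟩
    · obtain ⟨Q, hQ, hs⟩ := ih (a := e.head) ⟨hP.1.2.2, (List.nodup_cons.1 hP.2).2⟩ hv
      exact ⟨Q, hQ, hs.cons _⟩

/-- Cutting out closed parts only deletes arcs. The sublist relation records this, so neither the
number of arcs nor, for nonnegative arc lengths, the length increases. -/
theorem IsWalk.exists_path {v w : Vertex I} {P : List (Arc I)} (hP : I.IsWalk h S v w P) :
    ∃ Q, I.IsPath h S v w Q ∧ Q.Sublist P := by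
  induction P generalizing v with
  | nil => exact ⟨[], ⟨hP, by simp⟩, List.Sublist.refl _⟩
  | cons e P ih =>
    obtain ⟨h1, h2, h3⟩ := hP
    obtain ⟨Q, hQ, hs⟩ := ih h3
    by_cases hv : v ∈ e.head :: Q.map Arc.head
    · obtain ⟨Q', hQ', hs'⟩ := exists_suffix hQ hv
      exact ⟨Q', hQ', (hs'.trans hs).cons _⟩
    · exact ⟨e :: Q, ⟨⟨h1, h2, hQ.1⟩, List.nodup_cons.2 ⟨hv, hQ.2⟩⟩, hs.cons_cons _⟩

theorem reach_iff_path {v : Vertex I} : Reach h S v ↔ ∃ Q, I.IsPath h S .s v Q :=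
  ⟨fun ⟨_, hQ⟩ => let ⟨Q', hQ', _⟩ := hQ.exists_path; ⟨Q', hQ'⟩, fun ⟨Q, hQ⟩ => ⟨Q, hQ.1⟩⟩

/-- Arcs of a path have distinct heads, so a path is a duplicate-free list over a finite type.
Shortest paths thus exist whatever the signs of the lengths, and an iteration is possible without
appeal to the invariant. -/
theorem finite_paths (v w : Vertex I) : {P | I.IsPath h S v w P}.Finite := by
  classical
  have := Fintype.ofFinite (Arc I)
  have : Finite {l : List (Arc I) // l.Nodup} := inferInstance
  exact Set.Finite.subset (Set.finite_coe_iff.1 this : {l : List (Arc I) | l.Nodup}.Finite)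
    fun P hP => (IsPath.nodup_head hP).of_map

theorem exists_shortestPath {v : Vertex I} (hv : Reach h S v) :
    ∃ Q, I.IsShortestPath h S .s v Q := by
  obtain ⟨Q, hQ, hmin⟩ := Set.exists_min_image _ (I.pathLength h S) (finite_paths .s v)
    (reach_iff_path.1 hv)
  exact ⟨Q, hQ, hmin⟩

theorem IsShortestPath.length_eq {v : Vertex I} {P Q : List (Arc I)}
    (hP : I.IsShortestPath h S .s v P) (hQ : I.IsShortestPath h S .s v Q) :
    I.pathLength h S P = I.pathLength h S Q := le_antisymm (hP.2 _ hQ.1) (hQ.2 _ hP.1)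

/-- Each iteration can be carried out. -/
theorem exists_iteration (hS : ¬ I.Stops h S) : ∃ S', I.Iteration h S S' := by
  classical
  have hS' := hS
  unfold Stops at hS'
  push Not at hS'
  have ht : Reach h S .t := reach_iff_path.2 hS'.2.2
  have hfin : {P | I.IsShortestPath h S .s .t P}.Finite :=
    (finite_paths .s .t).subset fun P hP => hP.1
  obtain ⟨P, hP, hmin⟩ := Set.exists_min_image _ List.length hfin (exists_shortestPath ht)
  let dp : Vertex I → ℝ := fun v =>
    if hv : ∃ Q, I.IsShortestPath h S .s v Q then I.pathLength h S hv.choose else 0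
  refine ⟨⟨I.augmentX S.X P, I.augmentY S.Y P, fun v => S.p v + dp v⟩, hS, dp, P, ?_, ?_, hP,
    hmin, rfl, rfl, fun _ => rfl⟩
  · intro v Q hQ
    have hv : ∃ Q, I.IsShortestPath h S .s v Q := ⟨Q, hQ⟩
    simp only [dp, dif_pos hv]
    exact hv.choose_spec.length_eq hQ
  · intro v hv
    simp only [dp]
    rw [dif_neg]
    rintro ⟨Q, hQ⟩
    exact hv ⟨Q, hQ.1⟩

/-! ### Effect of an augmenting path on the sets `X` and `Y` -/

section Augment

variable {P : List (Arc I)}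

theorem IsPath.head_inj {v w : Vertex I} (hP : I.IsPath h S v w P) {e e' : Arc I} (he : e ∈ P)
    (he' : e' ∈ P) (heq : e.head = e'.head) : e = e' :=
  List.inj_on_of_nodup_map hP.nodup_head he he' heq

theorem IsPath.tail_inj {v w : Vertex I} (hP : I.IsPath h S v w P) {e e' : Arc I} (he : e ∈ P)
    (he' : e' ∈ P) (heq : e.tail = e'.tail) : e = e' :=
  List.inj_on_of_nodup_map hP.nodup_tail he he' heq

theorem mem_augmentX {X : Finset I.U} {w : I.U} : w ∈ I.augmentX X P ↔
    (w ∈ X ∧ ¬ ∃ v, Arc.exX w v ∈ P) ∨ ∃ u, Arc.exX u w ∈ P := by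
  simp [augmentX]

theorem mem_augmentY {Y : Finset I.U} {w : I.U} : w ∈ I.augmentY Y P ↔
    (w ∈ Y ∧ ¬ ∃ u, Arc.exY u w ∈ P) ∨ ∃ v, Arc.exY w v ∈ P := by
  simp [augmentY]

theorem IsPath.exists_src (hP : I.IsPath h S .s .t P) : ∃ u, Arc.src u ∈ P := by
  cases P with
  | nil => cases hP.1
  | cons e P =>
    have h1 := hP.1.2.1
    cases e with
    | src u => exact ⟨u, List.mem_cons_self⟩
    | _ => cases h1

theorem IsPath.out_arc (hP : I.IsPath h S .s .t P) {e : Arc I} (he : e ∈ P) {w : I.U}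
    (hw : e.head = .el w) : Arc.snk w ∈ P ∨ (∃ v, Arc.exX w v ∈ P) ∨ ∃ v, Arc.exY w v ∈ P := by
  rcases hP.1.head_cases he with h1 | ⟨e', he', h1⟩
  · rw [hw] at h1; cases h1
  · rw [hw] at h1
    cases e' with
    | src u => cases h1
    | snk u => cases h1; exact Or.inl he'
    | exX u v => cases h1; exact Or.inr (Or.inl ⟨v, he'⟩)
    | exY u v => cases h1; exact Or.inr (Or.inr ⟨v, he'⟩)

theorem IsPath.in_arc (hP : I.IsPath h S .s .t P) {e : Arc I} (he : e ∈ P) {w : I.U}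
    (hw : e.tail = .el w) : Arc.src w ∈ P ∨ (∃ u, Arc.exX u w ∈ P) ∨ ∃ u, Arc.exY u w ∈ P := by
  rcases hP.1.tail_cases he with h1 | ⟨e', he', h1⟩
  · rw [hw] at h1; cases h1
  · rw [hw] at h1
    cases e' with
    | src u => cases h1; exact Or.inl he'
    | snk u => cases h1
    | exX u v => cases h1; exact Or.inr (Or.inl ⟨u, he'⟩)
    | exY u v => cases h1; exact Or.inr (Or.inr ⟨u, he'⟩)

/-- After an augmentation, `X \ Y` has lost an element. -/
theorem IsPath.augment_sdiff (hP : I.IsPath h S .s .t P) :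
    I.augmentX S.X P \ I.augmentY S.Y P ⊂ S.X \ S.Y := by
  have arc := hP.1.hasArc
  have main : ∀ w, w ∈ I.augmentX S.X P → w ∉ I.augmentY S.Y P →
      w ∈ S.X \ S.Y ∧ Arc.src w ∉ P := by
    intro w hX hY
    rw [mem_augmentX] at hX
    rw [mem_augmentY, not_or] at hY
    obtain ⟨hY1, hY2⟩ := hY
    -- If `w` stayed in `X`, no arc of the path enters it: the next arc would end at the sink
    -- although `w` was in `X`, remove `w` from `X`, or put it into `Y`. Hence `w` was not in `Y`
    -- and is not the first vertex after the source. If `w` entered `X`, the arc that leaves `w`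
    -- shows that `w` is now in `Y` too.
    rcases hX with ⟨hX1, hX2⟩ | ⟨u, hu⟩
    · have nosnk : Arc.snk w ∉ P := fun hs => (Finset.mem_sdiff.1 (arc _ hs)).2 hX1
      have noin : ∀ e ∈ P, e.head ≠ .el w := by
        intro e he hw
        rcases hP.out_arc he hw with h1 | h1 | h1
        exacts [nosnk h1, hX2 h1, hY2 h1]
      refine ⟨Finset.mem_sdiff.2 ⟨hX1, fun hwY => hY1 ⟨hwY, ?_⟩⟩, fun hs => noin _ hs rfl⟩
      rintro ⟨u, hu⟩
      exact noin _ hu rfl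
    · exfalso
      have hwX : w ∉ S.X := (arc _ hu).2.1
      rcases hP.out_arc hu rfl with h1 | ⟨v, h1⟩ | h1
      · refine hY1 ⟨(Finset.mem_sdiff.1 (arc _ h1)).1, ?_⟩
        rintro ⟨u', hu'⟩
        cases hP.head_inj hu hu' rfl
      · exact hwX (arc _ h1).1
      · exact hY2 h1
  rw [Finset.ssubset_iff_of_subset fun w hw =>
    (main w (Finset.mem_sdiff.1 hw).1 (Finset.mem_sdiff.1 hw).2).1]
  obtain ⟨u, hu⟩ := hP.exists_src
  exact ⟨u, arc _ hu, fun hw => (main u (Finset.mem_sdiff.1 hw).1 (Finset.mem_sdiff.1 hw).2).2 hu⟩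

/-- Counterpart with in-arcs in place of out-arcs. Inclusion is enough here: it shows that every
sink arc of the new graph was already present. -/
theorem IsPath.augment_sdiff' (hP : I.IsPath h S .s .t P) :
    I.augmentY S.Y P \ I.augmentX S.X P ⊆ S.Y \ S.X := by
  have arc := hP.1.hasArc
  intro w hw
  obtain ⟨hY, hX⟩ := Finset.mem_sdiff.1 hw
  rw [mem_augmentX, not_or] at hX
  rw [mem_augmentY] at hY
  obtain ⟨hX1, hX2⟩ := hX
  rcases hY with ⟨hY1, hY2⟩ | ⟨v, hv⟩
  · refine Finset.mem_sdiff.2 ⟨hY1, fun hwX => hX1 ⟨hwX, ?_⟩⟩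
    rintro ⟨v, hv⟩
    rcases hP.in_arc hv rfl with h1 | h1 | h1
    exacts [(Finset.mem_sdiff.1 (arc _ h1)).2 hY1, hX2 h1, hY2 h1]
  · exfalso
    have hwY : w ∉ S.Y := (arc _ hv).1
    rcases hP.in_arc hv rfl with h1 | h1 | ⟨u, h1⟩
    · refine hX1 ⟨(Finset.mem_sdiff.1 (arc _ h1)).1, ?_⟩
      rintro ⟨v', hv'⟩
      cases hP.tail_inj hv hv' rfl
    · exact hX2 h1
    · exact hwY (arc _ h1).2.1

theorem IsPath.pairwise_tail {v w : Vertex I} (hP : I.IsPath h S v w P) :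
    P.Pairwise fun e e' => e.tail ≠ e'.tail := List.pairwise_map.1 hP.nodup_tail

theorem IsPath.pairwise_head {v w : Vertex I} (hP : I.IsPath h S v w P) :
    P.Pairwise fun e e' => e.head ≠ e'.head := List.pairwise_map.1 hP.nodup_head

/-- The pair of elements exchanged in `X` along an arc. -/
def Arc.pairX : Arc I → Option (I.U × I.U)
  | .exX u v => some (u, v)
  | _ => none

/-- The pair of elements exchanged in `Y` along an arc. -/
def Arc.pairY : Arc I → Option (I.U × I.U)
  | .exY u v => some (v, u)
  | _ => none

theorem mem_pairsX {e : I.U × I.U} : e ∈ P.filterMap Arc.pairX ↔ Arc.exX e.1 e.2 ∈ P := by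
  rw [List.mem_filterMap]
  constructor
  · rintro ⟨a, ha, h1⟩
    cases a <;> simp only [Arc.pairX, Option.some.injEq, reduceCtorEq] at h1
    cases h1; exact ha
  · intro ha
    exact ⟨_, ha, rfl⟩

theorem mem_pairsY {e : I.U × I.U} : e ∈ P.filterMap Arc.pairY ↔ Arc.exY e.2 e.1 ∈ P := by
  rw [List.mem_filterMap]
  constructor
  · rintro ⟨a, ha, h1⟩
    cases a <;> simp only [Arc.pairY, Option.some.injEq, reduceCtorEq] at h1
    cases h1; exact ha
  · intro ha
    exact ⟨_, ha, rfl⟩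

theorem augmentX_eq_foldl (harc : ∀ e ∈ P, I.HasArc h S e) :
    I.augmentX S.X P =
      (P.filterMap Arc.pairX).foldl (fun X e => insert e.2 (X.erase e.1)) S.X := by
  ext w
  rw [mem_augmentX, mem_foldl_swap w]
  · simp only [mem_pairsX]
    constructor
    · rintro (⟨h1, h2⟩ | ⟨u, h1⟩)
      · exact Or.inl ⟨h1, fun e he hw => h2 ⟨e.2, hw ▸ he⟩⟩
      · exact Or.inr ⟨(u, w), h1, rfl⟩
    · rintro (⟨h1, h2⟩ | ⟨e, h1, rfl⟩)
      · exact Or.inl ⟨h1, fun ⟨v, hv⟩ => h2 (w, v) hv rfl⟩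
      · exact Or.inr ⟨_, h1⟩
  · intro e he
    have := harc _ (mem_pairsX.1 he)
    exact ⟨this.1, this.2.1⟩

/-- In `Y` the tail of an arc enters and the head leaves. A shortcut from an earlier to a later arc
thus pairs the earlier entering element with the later leaving one, so triangularity holds in the
reversed order of the path. -/
theorem augmentY_eq_foldl (harc : ∀ e ∈ P, I.HasArc h S e) :
    I.augmentY S.Y P =
      (P.filterMap Arc.pairY).reverse.foldl (fun X e => insert e.2 (X.erase e.1)) S.Y := by
  ext w
  rw [mem_augmentY, mem_foldl_swap w]
  · simp only [List.mem_reverse, mem_pairsY]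
    constructor
    · rintro (⟨h1, h2⟩ | ⟨u, h1⟩)
      · exact Or.inl ⟨h1, fun e he hw => h2 ⟨e.2, hw ▸ he⟩⟩
      · exact Or.inr ⟨(u, w), h1, rfl⟩
    · rintro (⟨h1, h2⟩ | ⟨e, h1, rfl⟩)
      · exact Or.inl ⟨h1, fun ⟨v, hv⟩ => h2 (w, v) hv rfl⟩
      · exact Or.inr ⟨_, h1⟩
  · intro e he
    have := harc _ (mem_pairsY.1 (List.mem_reverse.1 he))
    exact ⟨this.2.1, this.1⟩

end Augment

end BinaryVCSP

/-! ## Optimality certificates -/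

namespace BinaryVCSP

variable {I : BinaryVCSP} {h : I.U → I.U → WithTop ℝ} {S S' : State I}

/-- `fbarR` tilted by a potential. -/
noncomputable def tiltX (h : I.U → I.U → WithTop ℝ) (q : Vertex I → ℝ) : Finset I.U → WithTop ℝ :=
  tilt (I.fbarR h) fun u => q (.el u)

/-- The indicator function of the vectors of assignments tilted by a potential. -/
noncomputable def tiltY (q : Vertex I → ℝ) : Finset I.U → WithTop ℝ :=
  tilt I.deltaB fun u => -q (.el u)

/-- Reduced lengths are the increments of the tilted function; this translates between the auxiliary
graph and exchanges. -/
theorem tiltX_swap {q : Vertex I → ℝ} (hX : I.fbarR h S.X ≠ ⊤) {u v : I.U}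
    (hu : u ∈ S.X) (hv : v ∉ S.X) (hsw : I.fbarR h (insert v (S.X.erase u)) ≠ ⊤) :
    tiltX h q (insert v (S.X.erase u)) =
      tiltX h q S.X + ((potLength h S q (.exX u v) : ℝ) : WithTop ℝ) := by
  unfold tiltX tilt potLength arcLength
  rw [sum_swap hu hv]
  obtain ⟨a, ha⟩ := WithTop.ne_top_iff_exists.1 hX
  obtain ⟨b, hb⟩ := WithTop.ne_top_iff_exists.1 hsw
  simp only [← ha, ← hb, WithTop.untopD_coe, Arc.tail, Arc.head]
  rw [← WithTop.coe_add, ← WithTop.coe_add, ← WithTop.coe_add]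
  congr 1
  ring

theorem tiltY_swap {q : Vertex I → ℝ} (hY : I.IsFeasible S.Y) {u v : I.U}
    (hu : u ∉ S.Y) (hv : v ∈ S.Y) (hsw : I.IsFeasible (insert u (S.Y.erase v))) :
    tiltY q (insert u (S.Y.erase v)) =
      tiltY q S.Y + ((potLength h S q (.exY u v) : ℝ) : WithTop ℝ) := by
  unfold tiltY tilt potLength arcLength deltaB
  rw [sum_swap hv hu, if_pos hY, if_pos hsw]
  simp only [Arc.tail, Arc.head]
  rw [← WithTop.coe_zero, ← WithTop.coe_add, ← WithTop.coe_add, ← WithTop.coe_add]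
  congr 1
  ring

theorem le_add_coe_iff {a : WithTop ℝ} (ha : a ≠ ⊤) {x : ℝ} :
    a ≤ a + (x : WithTop ℝ) ↔ 0 ≤ x := by
  obtain ⟨b, rfl⟩ := WithTop.ne_top_iff_exists.1 ha
  rw [← WithTop.coe_add, WithTop.coe_le_coe]
  constructor <;> intro <;> linarith

theorem add_coe_le_iff {a : WithTop ℝ} (ha : a ≠ ⊤) {x : ℝ} :
    a + (x : WithTop ℝ) ≤ a ↔ x ≤ 0 := by
  obtain ⟨b, rfl⟩ := WithTop.ne_top_iff_exists.1 ha
  rw [← WithTop.coe_add, WithTop.coe_le_coe]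
  constructor <;> intro <;> linarith

/-- Nonnegative reduced lengths express local optimality, which is global optimality for functions
with the exchange property. -/
theorem isMinOf_tiltX (H : IsUltra h) {q : Vertex I → ℝ} (hX : I.fbarR h S.X ≠ ⊤)
    (hq : ∀ u v, I.HasArc h S (.exX u v) → 0 ≤ potLength h S q (.exX u v)) :
    IsMinOf (tiltX h q) S.X := by
  have hX' : tiltX h q S.X ≠ ⊤ := tilt_ne_top.2 hX
  refine ⟨hX', ((exchangeFun_fbarR H).tilt _).le_of_local hX' (fun Z hZ => ?_) ?_⟩
  · rw [fbarR_ne_top (tilt_ne_top.1 hZ), fbarR_ne_top hX]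
  · intro u hu v hv
    by_cases hsw : I.fbarR h (insert v (S.X.erase u)) = ⊤
    · simp [tilt, hsw]
    · have := (le_add_coe_iff hX').2 (hq u v ⟨hu, hv, hsw⟩)
      rwa [← tiltX_swap hX hu hv hsw] at this

theorem isMinOf_tiltY {q : Vertex I → ℝ} (hY : I.IsFeasible S.Y)
    (hq : ∀ u v, I.HasArc h S (.exY u v) → 0 ≤ potLength h S q (.exY u v)) :
    IsMinOf (tiltY q) S.Y := by
  have hY' : tiltY q S.Y ≠ ⊤ := tilt_ne_top.2 (deltaB_ne_top.2 hY)
  refine ⟨hY', (exchangeFun_deltaB.tilt _).le_of_local hY' (fun Z hZ => ?_) ?_⟩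
  · rw [(deltaB_ne_top.1 (tilt_ne_top.1 hZ)).card, hY.card]
  · intro v hv u hu
    by_cases hsw : I.IsFeasible (insert u (S.Y.erase v))
    · have := (le_add_coe_iff hY').2 (hq u v ⟨hu, hv, hsw⟩)
      rwa [← tiltY_swap hY hu hv hsw] at this
    · simp [tilt, deltaB, hsw]

theorem potLength_exX_nonneg {q : Vertex I → ℝ} (hX : IsMinOf (tiltX h q) S.X) {u v : I.U}
    (he : I.HasArc h S (.exX u v)) : 0 ≤ potLength h S q (.exX u v) := by
  rw [← le_add_coe_iff hX.1, ← tiltX_swap (tilt_ne_top.1 hX.1) he.1 he.2.1 he.2.2]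
  exact hX.2 _

theorem potLength_exY_nonneg {q : Vertex I → ℝ} (hY : IsMinOf (tiltY q) S.Y) {u v : I.U}
    (he : I.HasArc h S (.exY u v)) : 0 ≤ potLength h S q (.exY u v) := by
  rw [← le_add_coe_iff hY.1,
    ← tiltY_swap (deltaB_ne_top.1 (tilt_ne_top.1 hY.1)) he.1 he.2.1 he.2.2]
  exact hY.2 _

/-- Tight arcs are exactly the exchanges inside the family of minimizers. The absence of tight
shortcuts thereby becomes the negative condition of `ExchangeFamily.foldl`. -/
theorem isMinOf_swapX {q : Vertex I → ℝ} (hX : IsMinOf (tiltX h q) S.X) {u v : I.U}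
    (hu : u ∈ S.X) (hv : v ∉ S.X) : IsMinOf (tiltX h q) (insert v (S.X.erase u)) ↔
      I.HasArc h S (.exX u v) ∧ potLength h S q (.exX u v) = 0 := by
  have hfin := tilt_ne_top.1 hX.1
  constructor
  · intro hm
    have hsw := tilt_ne_top.1 hm.1
    have he : I.HasArc h S (.exX u v) := ⟨hu, hv, hsw⟩
    refine ⟨he, le_antisymm ?_ (potLength_exX_nonneg hX he)⟩
    rw [← add_coe_le_iff hX.1, ← tiltX_swap hfin hu hv hsw]
    exact hm.2 _
  · rintro ⟨he, h0⟩
    have := tiltX_swap (q := q) hfin hu hv he.2.2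
    rw [h0, WithTop.coe_zero, add_zero] at this
    unfold IsMinOf
    rw [this]
    exact hX

theorem isMinOf_swapY {q : Vertex I → ℝ} (hY : IsMinOf (tiltY q) S.Y) {u v : I.U}
    (hu : u ∉ S.Y) (hv : v ∈ S.Y) : IsMinOf (tiltY q) (insert u (S.Y.erase v)) ↔
      I.HasArc h S (.exY u v) ∧ potLength h S q (.exY u v) = 0 := by
  have hfin := deltaB_ne_top.1 (tilt_ne_top.1 hY.1)
  constructor
  · intro hm
    have hsw := deltaB_ne_top.1 (tilt_ne_top.1 hm.1)
    have he : I.HasArc h S (.exY u v) := ⟨hu, hv, hsw⟩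
    refine ⟨he, le_antisymm ?_ (potLength_exY_nonneg hY he)⟩
    rw [← add_coe_le_iff hY.1, ← tiltY_swap hfin hu hv hsw]
    exact hm.2 _
  · rintro ⟨he, h0⟩
    have := tiltY_swap (h := h) (q := q) hfin hu hv he.2.2
    rw [h0, WithTop.coe_zero, add_zero] at this
    unfold IsMinOf
    rw [this]
    exact hY

/-- The invariant of Step 3. The potential `q` extends `p` from the reachable vertices. -/
structure Certified (h : I.U → I.U → WithTop ℝ) (S : State I) (q : Vertex I → ℝ) : Prop where
  fin : I.fbarR h S.X ≠ ⊤
  feas : I.IsFeasible S.Y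
  eq_p : ∀ v, Reach h S v → q v = S.p v
  nonneg : ∀ e, I.HasArc h S e → 0 ≤ potLength h S q e

variable {q : Vertex I → ℝ}

theorem Certified.modLength_eq (C : Certified h S q) {e : Arc I} (he : I.HasArc h S e)
    (hr : Reach h S e.tail) : I.modLength h S e = potLength h S q e := by
  unfold potLength modLength
  rw [C.eq_p _ hr, C.eq_p _ (hr.head he)]

theorem Certified.modLength_nonneg (C : Certified h S q) {e : Arc I} (he : I.HasArc h S e)
    (hr : Reach h S e.tail) : 0 ≤ I.modLength h S e := by
  rw [C.modLength_eq he hr]; exact C.nonneg e he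

/-- Every walk from the source can be shortened to a path. -/
theorem Certified.exists_path (C : Certified h S q) {v : Vertex I} {Q : List (Arc I)}
    (hQ : I.IsWalk h S .s v Q) : ∃ Q', I.IsPath h S .s v Q' ∧
      I.pathLength h S Q' ≤ I.pathLength h S Q ∧ Q'.length ≤ Q.length := by
  obtain ⟨Q', hQ', hs⟩ := hQ.exists_path
  refine ⟨Q', hQ', (hs.map _).sum_le_sum fun x hx => ?_, hs.length_le⟩
  obtain ⟨e, he, rfl⟩ := List.mem_map.1 hx
  exact C.modLength_nonneg (hQ.hasArc e he) (hQ.reach Reach.source e he)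

theorem Certified.shortest_le_walk (C : Certified h S q) {v : Vertex I} {P Q : List (Arc I)}
    (hP : I.IsShortestPath h S .s v P) (hQ : I.IsWalk h S .s v Q) :
    I.pathLength h S P ≤ I.pathLength h S Q := by
  obtain ⟨Q', hQ', hle, -⟩ := C.exists_path hQ
  exact (hP.2 _ hQ').trans hle

theorem pathLength_append (A B : List (Arc I)) :
    I.pathLength h S (A ++ B) = I.pathLength h S A + I.pathLength h S B := by
  simp [pathLength]

theorem IsWalk.telescope (dp : Vertex I → ℝ) {v w : Vertex I} {P : List (Arc I)}
    (hP : I.IsWalk h S v w P) :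
    (P.map fun e => I.modLength h S e + dp e.tail - dp e.head).sum =
      I.pathLength h S P + dp v - dp w := by
  induction P generalizing v with
  | nil => cases hP; simp [pathLength]
  | cons e P ih =>
    obtain ⟨-, rfl, h3⟩ := hP
    have := ih h3
    unfold pathLength at this ⊢
    rw [List.map_cons, List.map_cons, List.sum_cons, List.sum_cons, this]
    ring

/-! ### One augmentation with new potentials -/

section Step

variable {dp : Vertex I → ℝ} {P : List (Arc I)}

theorem Certified.dp_triangle (C : Certified h S q)
    (hdp : ∀ v Q, I.IsShortestPath h S .s v Q → dp v = I.pathLength h S Q) {e : Arc I}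
    (he : I.HasArc h S e) (hr : Reach h S e.tail) :
    dp e.head ≤ dp e.tail + I.modLength h S e := by
  obtain ⟨Q, hQ⟩ := exists_shortestPath hr
  obtain ⟨Q', hQ'⟩ := exists_shortestPath (hr.head he)
  rw [hdp _ _ hQ, hdp _ _ hQ']
  refine (C.shortest_le_walk hQ' (isWalk_append.2 ⟨_, hQ.1.1, isWalk_singleton he⟩)).trans ?_
  rw [pathLength_append]
  simp [pathLength]

theorem dp_source (hdp : ∀ v Q, I.IsShortestPath h S .s v Q → dp v = I.pathLength h S Q) :
    dp .s = 0 := by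
  have : I.IsShortestPath h S .s .s [] := by
    refine ⟨⟨rfl, by simp⟩, fun Q hQ => ?_⟩
    cases Q with
    | nil => exact le_rfl
    | cons e Q =>
      exfalso
      -- A nonempty walk back to the source has the source as its last head, which contradicts the
      -- distinctness of the vertices.
      have h1 := hQ.1.map_tail
      have h2 : Vertex.s ∈ (e :: Q).map Arc.head := by
        have h3 : (Vertex.s :: (e :: Q).map Arc.head).getLast? = some .s := by
          rw [← h1, List.getLast?_append]; simp
        rw [List.map_cons, List.getLast?_cons_cons] at h3
        exact List.mem_of_getLast? h3
      exact (List.nodup_cons.1 hQ.2).1 h2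
  rw [hdp _ _ this]
  simp [pathLength]

open Classical in
/-- The new potential, raised by `M` at the vertices that cannot be reached. -/
noncomputable def raise (h : I.U → I.U → WithTop ℝ) (S : State I) (q dp : Vertex I → ℝ) (M : ℝ)
    (v : Vertex I) : ℝ := if Reach h S v then q v + dp v else q v + M

/-- Between reachable vertices this is the triangle inequality for distances. No arc leaves the
reachable set; an arc that enters it gains `M - dp e.head`, which explains the bound on `M`. -/
theorem Certified.raise_nonneg (C : Certified h S q) {M : ℝ} (hM : ∀ v, dp v ≤ M)
    (htri : ∀ e, I.HasArc h S e → Reach h S e.tail →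
      dp e.head ≤ dp e.tail + I.modLength h S e) (e : Arc I) (he : I.HasArc h S e) :
    0 ≤ potLength h S (raise h S q dp M) e := by
  have h0 := C.nonneg e he
  by_cases hr : Reach h S e.tail
  · have h1 := htri e he hr
    rw [C.modLength_eq he hr] at h1
    unfold potLength at h0 h1 ⊢
    unfold raise
    rw [if_pos hr, if_pos (hr.head he)]
    linarith
  · unfold potLength at h0 ⊢
    unfold raise
    rw [if_neg hr]
    split_ifs
    · linarith [hM e.head]
    · linarith

theorem raise_reach {M : ℝ} {v : Vertex I} (hv : Reach h S v) :
    raise h S q dp M v = q v + dp v := if_pos hv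

theorem Certified.potLength_raise (C : Certified h S q) {M : ℝ} {e : Arc I}
    (he : I.HasArc h S e) (hr : Reach h S e.tail) :
    potLength h S (raise h S q dp M) e = I.modLength h S e + dp e.tail - dp e.head := by
  rw [C.modLength_eq he hr]
  unfold potLength
  rw [raise_reach hr, raise_reach (hr.head he)]
  ring

/-- The arcs of a shortest path are tight for the new potential. -/
theorem Certified.tight (C : Certified h S q)
    (hdp : ∀ v Q, I.IsShortestPath h S .s v Q → dp v = I.pathLength h S Q)
    (hP : I.IsShortestPath h S .s .t P) :
    ∀ e ∈ P, I.modLength h S e + dp e.tail - dp e.head = 0 := by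
  have hw := hP.1.1
  have hsum := hw.telescope dp
  rw [dp_source hdp, hdp _ _ hP, add_zero, sub_self] at hsum
  have h1 := List.eq_zero_of_sum_nonpos (l := P.map fun e => I.modLength h S e + dp e.tail -
    dp e.head) ?_ hsum.le
  · intro e he
    exact h1 _ (List.mem_map.2 ⟨e, he, rfl⟩)
  · intro x hx
    obtain ⟨e, he, rfl⟩ := List.mem_map.1 hx
    have := C.dp_triangle hdp (hw.hasArc e he) (hw.reach Reach.source e he)
    linarith

/-- A shortest path with the smallest number of arcs has no tight shortcut. -/
theorem Certified.no_shortcut (C : Certified h S q)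
    (hdp : ∀ v Q, I.IsShortestPath h S .s v Q → dp v = I.pathLength h S Q)
    (hP : I.IsShortestPath h S .s .t P)
    (hmin : ∀ Q, I.IsShortestPath h S .s .t Q → P.length ≤ Q.length) :
    P.Pairwise fun e e' => ∀ a, I.HasArc h S a → a.tail = e.tail → a.head = e'.head →
      I.modLength h S a + dp a.tail - dp a.head ≠ 0 := by
  refine List.pairwise_of_split ?_
  rintro A e B e' D rfl a ha hat hah h0
  have htight := C.tight hdp hP
  obtain ⟨z, hA, h1⟩ := isWalk_append.1 hP.1.1
  obtain ⟨he, rfl, h2⟩ := h1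
  obtain ⟨y, hB, h3⟩ := isWalk_append.1 h2
  obtain ⟨he', rfl, hD⟩ := h3
  -- The tight arc `a` replaces `e`, `B` and `e'`. All arcs of this walk are tight, so it has the
  -- length of `P` with fewer arcs.
  have hQ : I.IsWalk h S .s .t (A ++ a :: D) :=
    isWalk_append.2 ⟨_, hA, ha, hat, by rwa [hah]⟩
  have hsum := hQ.telescope dp
  have hz : ((A ++ a :: D).map fun e => I.modLength h S e + dp e.tail - dp e.head).sum = 0 := by
    refine List.sum_eq_zero fun x hx => ?_
    obtain ⟨b, hb, rfl⟩ := List.mem_map.1 hx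
    rcases List.mem_append.1 hb with hb | hb
    · exact htight b (List.mem_append_left _ hb)
    · rcases List.mem_cons.1 hb with rfl | hb
      · exact h0
      · refine htight b (List.mem_append_right _ ?_)
        simp [hb]
  rw [hz, dp_source hdp, hdp _ _ hP] at hsum
  obtain ⟨Q', hQ', hle, hlen⟩ := C.exists_path hQ
  have hshort : I.IsShortestPath h S .s .t Q' :=
    ⟨hQ', fun R hR => hle.trans (by linarith [hP.2 R hR])⟩
  have := hmin Q' hshort
  simp only [List.length_append, List.length_cons] at this hlen
  omega

/-- The old sets minimize the functions tilted by the new potential. Tightness of the arcs of `P`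
keeps each single exchange inside the minimizers, and the lack of tight shortcuts makes the
exchanges triangular. -/
theorem Certified.augment (C : Certified h S q) (H : IsUltra h) {M : ℝ} (hM : ∀ v, dp v ≤ M)
    (hdp : ∀ v Q, I.IsShortestPath h S .s v Q → dp v = I.pathLength h S Q)
    (hP : I.IsShortestPath h S .s .t P)
    (hmin : ∀ Q, I.IsShortestPath h S .s .t Q → P.length ≤ Q.length) :
    IsMinOf (tiltX h (raise h S q dp M)) (I.augmentX S.X P) ∧
    IsMinOf (tiltY (raise h S q dp M)) (I.augmentY S.Y P) := by
  have harc := hP.1.1.hasArc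
  have hreach := hP.1.1.reach Reach.source
  have hnn := C.raise_nonneg hM fun e he hr => C.dp_triangle hdp he hr
  have hX := isMinOf_tiltX H C.fin fun u v he => hnn _ he
  have hY := isMinOf_tiltY C.feas fun u v he => hnn _ he
  have htight : ∀ e ∈ P, potLength h S (raise h S q dp M) e = 0 := fun e he => by
    rw [C.potLength_raise (harc e he) (hreach e he)]
    exact C.tight hdp hP e he
  have hpw := (hP.1.pairwise_tail.and hP.1.pairwise_head).and (C.no_shortcut hdp hP hmin)
  constructor
  · rw [augmentX_eq_foldl harc]
    refine ((exchangeFun_fbarR H).tilt _).isMinOf.foldl _ _ hX (fun e he => ?_) ?_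
    · rw [mem_pairsX] at he
      have ha := harc _ he
      exact ⟨ha.1, ha.2.1, (isMinOf_swapX hX ha.1 ha.2.1).2 ⟨ha, htight _ he⟩⟩
    · rw [List.pairwise_filterMap]
      refine hpw.imp_of_mem fun {a b} ha hb hab => ?_
      rintro ⟨u, v⟩ hu ⟨u', v'⟩ hu'
      cases a <;> simp only [Arc.pairX, Option.some.injEq, Prod.mk.injEq, reduceCtorEq] at hu
      cases b <;> simp only [Arc.pairX, Option.some.injEq, Prod.mk.injEq, reduceCtorEq] at hu'
      obtain ⟨rfl, rfl⟩ := hu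
      obtain ⟨rfl, rfl⟩ := hu'
      refine ⟨fun e => hab.1.1 (congrArg Vertex.el e), fun e => hab.1.2 (congrArg Vertex.el e),
        fun hF => ?_⟩
      have h1 := (isMinOf_swapX hX (harc _ ha).1 (harc _ hb).2.1).1 hF
      refine hab.2 _ h1.1 rfl rfl ?_
      rw [← C.potLength_raise (M := M) h1.1 (show Reach h S (.el _) from hreach _ ha)]
      exact h1.2
  · rw [augmentY_eq_foldl harc]
    refine (exchangeFun_deltaB.tilt _).isMinOf.foldl _ _ hY (fun e he => ?_) ?_
    · rw [List.mem_reverse, mem_pairsY] at he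
      have ha := harc _ he
      exact ⟨ha.2.1, ha.1, (isMinOf_swapY hY ha.1 ha.2.1).2 ⟨ha, htight _ he⟩⟩
    -- Undoing the reversal puts the pairs back in path order, where `no_shortcut` applies.
    · rw [List.pairwise_reverse, List.pairwise_filterMap]
      refine hpw.imp_of_mem fun {a b} ha hb hab => ?_
      rintro ⟨v, u⟩ hu ⟨v', u'⟩ hu'
      cases a <;> simp only [Arc.pairY, Option.some.injEq, Prod.mk.injEq, reduceCtorEq] at hu
      cases b <;> simp only [Arc.pairY, Option.some.injEq, Prod.mk.injEq, reduceCtorEq] at hu'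
      obtain ⟨rfl, rfl⟩ := hu
      obtain ⟨rfl, rfl⟩ := hu'
      refine ⟨fun e => hab.1.2 (congrArg Vertex.el e.symm),
        fun e => hab.1.1 (congrArg Vertex.el e.symm), fun hF => ?_⟩
      have h1 := (isMinOf_swapY (h := h) hY (harc _ ha).1 (harc _ hb).2.1).1 hF
      refine hab.2 _ h1.1 rfl rfl ?_
      rw [← C.potLength_raise (M := M) h1.1 (show Reach h S (.el _) from hreach _ ha)]
      exact h1.2

end Step

/-- An iteration preserves the invariant. -/
theorem Certified.iteration (C : Certified h S q) (H : IsUltra h) (hI : I.Iteration h S S') :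
    ∃ q', Certified h S' q' := by
  obtain ⟨-, dp, P, hdp, -, hP, hmin, hX', hY', hp'⟩ := hI
  obtain ⟨M₀, hM₀⟩ := Finite.exists_le dp
  have haug : ∀ M, M₀ ≤ M → IsMinOf (tiltX h (raise h S q dp M)) S'.X ∧
      IsMinOf (tiltY (raise h S q dp M)) S'.Y := fun M hM => by
    rw [hX', hY']
    exact C.augment H (fun v => (hM₀ v).trans hM) hdp hP hmin
  have hsdX : S'.X \ S'.Y ⊆ S.X \ S.Y := by
    rw [hX', hY']; exact hP.1.augment_sdiff.subset
  have hsdY : S'.Y \ S'.X ⊆ S.Y \ S.X := by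
    rw [hX', hY']; exact hP.1.augment_sdiff'
  have hnn : ∀ M, M₀ ≤ M → ∀ e, I.HasArc h S' e →
      0 ≤ potLength h S' (raise h S q dp M) e := by
    intro M hM e he
    have hold := C.raise_nonneg (fun v => (hM₀ v).trans hM)
      fun e he hr => C.dp_triangle hdp he hr
    cases e with
    | src u => exact hold (.src u) (hsdX he)
    | snk v => exact hold (.snk v) (hsdY he)
    | exX u v => exact potLength_exX_nonneg (haug M hM).1 he
    | exY u v => exact potLength_exY_nonneg (haug M hM).2 he
  -- The new sets do not depend on `M`, while the reduced length of an arc that leaves the old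
  -- reachable set would decrease without bound as `M` grows. Nonnegativity for all large `M`
  -- excludes such arcs.
  have hclosed : ∀ e, I.HasArc h S' e → Reach h S e.tail → Reach h S e.head := by
    intro e he hr
    by_contra hn
    let M := max M₀ (I.arcLength h S' e + (q e.tail + dp e.tail) - q e.head + 1)
    have h1 := hnn M (le_max_left _ _) e he
    unfold potLength raise at h1
    rw [if_pos hr, if_neg hn] at h1
    have h2 := le_max_right M₀ (I.arcLength h S' e + (q e.tail + dp e.tail) - q e.head + 1)
    change _ ≤ M at h2
    linarith
  have hsub : ∀ (Q : List (Arc I)) (v w : Vertex I), I.IsWalk h S' v w Q → Reach h S v →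
      Reach h S w := by
    intro Q
    induction Q with
    | nil => intro v w hQ hv; cases hQ; exact hv
    | cons e Q ih =>
      intro v w hQ hv
      obtain ⟨h1, rfl, h3⟩ := hQ
      exact ih _ _ h3 (hclosed e h1 hv)
  -- Newly reachable vertices were reachable before, and there the raised potential is the updated
  -- `p`; the arbitrary amount `M₀` is never compared with `p`.
  refine ⟨raise h S q dp M₀, ⟨tilt_ne_top.1 (haug M₀ le_rfl).1.1,
    deltaB_ne_top.1 (tilt_ne_top.1 (haug M₀ le_rfl).2.1), ?_, hnn M₀ le_rfl⟩⟩
  rintro v ⟨Q, hQ⟩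
  have hv := hsub Q _ _ hQ Reach.source
  rw [raise_reach hv, C.eq_p v hv, hp']

/-- The certificate shows that `Y` is optimal if `X = Y`, and that the effective domain of
`fbarR` contains no vector of an assignment if the sink cannot be reached and `X ≠ Y`. -/
theorem Certified.le_feasible (C : Certified h S q) (H : IsUltra h) (hXY : S.X = S.Y)
    {Z : Finset I.U} (hZ : I.IsFeasible Z) : I.fbarR h S.X ≤ I.fbarR h Z := by
  -- The potential enters the two minimality statements with opposite signs and cancels in their sum
  -- because `X = Y`.
  have hX := (isMinOf_tiltX H C.fin fun u v he => C.nonneg _ he).2 Z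
  have hY := (isMinOf_tiltY C.feas fun u v he => C.nonneg _ he).2 Z
  unfold tiltX tilt at hX
  unfold tiltY tilt deltaB at hY
  rw [if_pos C.feas, if_pos hZ] at hY
  rw [← hXY] at hY
  obtain ⟨a, ha⟩ := WithTop.ne_top_iff_exists.1 C.fin
  rw [← ha] at hX ⊢
  induction hb : I.fbarR h Z using WithTop.recTopCoe with
  | top => exact le_top
  | coe b =>
    rw [hb] at hX
    rw [zero_add, zero_add, WithTop.coe_le_coe] at hY
    rw [← WithTop.coe_add, ← WithTop.coe_add, WithTop.coe_le_coe] at hX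
    rw [WithTop.coe_le_coe]
    simp only [Finset.sum_neg_distrib] at hX hY
    linarith

/-- The indicator of the unreachable vertices is an unbounded dual direction: adding any nonnegative
multiple to `q` preserves the certificate, while the lower bound for a common finite set grows
linearly. -/
theorem Certified.unreachable (C : Certified h S q) (H : IsUltra h) (ht : ¬ Reach h S .t)
    (hne : S.X ≠ S.Y) {Z : Finset I.U} (hZ : I.IsFeasible Z) : I.fbarR h Z = ⊤ := by
  classical
  by_contra hfin
  obtain ⟨a, ha⟩ := WithTop.ne_top_iff_exists.1 C.fin
  obtain ⟨b, hb⟩ := WithTop.ne_top_iff_exists.1 hfin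
  let ind : Vertex I → ℝ := fun v => if Reach h S v then 0 else 1
  have hnn : ∀ M : ℝ, 0 ≤ M → ∀ e, I.HasArc h S e →
      0 ≤ potLength h S (fun v => q v + M * ind v) e := by
    intro M hM e he
    have h0 := C.nonneg e he
    unfold potLength at h0 ⊢
    by_cases hr : Reach h S e.tail
    · have h1 : ind e.tail = 0 := if_pos hr
      have h2 : ind e.head = 0 := if_pos (hr.head he)
      simp only [h1, h2]; linarith
    · have h1 : ind e.tail = 1 := if_neg hr
      have h2 : ind e.head ≤ 1 := by
        simp only [ind]; split_ifs <;> norm_num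
      simp only [h1]; nlinarith
  have key : ∀ M : ℝ, 0 ≤ M → a - ∑ u ∈ S.X, q (.el u) + ∑ u ∈ S.Y, q (.el u) +
      M * (∑ u ∈ S.Y, ind (.el u) - ∑ u ∈ S.X, ind (.el u)) ≤ b := by
    intro M hM
    have hX := (isMinOf_tiltX H C.fin fun u v he => hnn M hM _ he).2 Z
    have hY := (isMinOf_tiltY C.feas fun u v he => hnn M hM _ he).2 Z
    unfold tiltX tilt at hX
    unfold tiltY tilt deltaB at hY
    rw [if_pos C.feas, if_pos hZ, zero_add, zero_add, WithTop.coe_le_coe] at hY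
    rw [← ha, ← hb, ← WithTop.coe_add, ← WithTop.coe_add, WithTop.coe_le_coe] at hX
    simp only [Finset.sum_neg_distrib, Finset.sum_add_distrib, ← Finset.mul_sum] at hX hY
    linarith
  -- Elements of `X \ Y` are reachable from the source; elements of `Y \ X` are not, since otherwise
  -- the sink would be.
  have hdiff : ∑ u ∈ S.Y, ind (.el u) - ∑ u ∈ S.X, ind (.el u) = (S.Y \ S.X).card := by
    rw [← Finset.sum_sdiff_sub_sum_sdiff]
    have h1 : ∑ u ∈ S.X \ S.Y, ind (.el u) = 0 := Finset.sum_eq_zero fun u hu =>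
      if_pos (Reach.head (e := .src u) hu Reach.source)
    have h2 : ∑ u ∈ S.Y \ S.X, ind (.el u) = ∑ u ∈ S.Y \ S.X, (1 : ℝ) :=
      Finset.sum_congr rfl fun u hu => if_neg fun hr => ht (hr.head (e := .snk u) hu)
    rw [h1, h2]; simp
  have hpos : 1 ≤ ((S.Y \ S.X).card : ℝ) := by
    have : 0 < (S.Y \ S.X).card := by
      rw [Finset.card_pos, Finset.nonempty_iff_ne_empty]
      intro h0
      rw [Finset.sdiff_eq_empty_iff_subset] at h0
      exact hne (Finset.eq_of_subset_of_card_le h0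
        (by rw [C.feas.card, fbarR_ne_top C.fin])).symm
    exact_mod_cast this
  rw [hdiff] at key
  have h1 := key (max 0 (b - (a - ∑ u ∈ S.X, q (.el u) + ∑ u ∈ S.Y, q (.el u)) + 1))
    (le_max_left _ _)
  have h2 := le_max_right 0 (b - (a - ∑ u ∈ S.X, q (.el u) + ∑ u ∈ S.Y, q (.el u)) + 1)
  have h3 := le_max_left 0 (b - (a - ∑ u ∈ S.X, q (.el u) + ∑ u ∈ S.Y, q (.el u)) + 1)
  nlinarith

/-- The invariant holds at the start. -/
theorem certified_init (hX : ∀ Z : Finset I.U, I.fbarR h S.X ≤ I.fbarR h Z)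
    (hfin : I.fbarR h S.X ≠ ⊤) (hY : I.IsFeasible S.Y) (hp : ∀ v, S.p v = 0) :
    Certified h S fun _ => 0 := by
  refine ⟨hfin, hY, fun v _ => (hp v).symm, fun e he => ?_⟩
  unfold potLength
  cases e with
  | exX u v =>
    obtain ⟨hu, hv, hsw⟩ := he
    have h1 := hX (insert v (S.X.erase u))
    simp only [arcLength]
    obtain ⟨a, ha⟩ := WithTop.ne_top_iff_exists.1 hfin
    obtain ⟨b, hb⟩ := WithTop.ne_top_iff_exists.1 hsw
    rw [← ha, ← hb, WithTop.coe_le_coe] at h1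
    rw [← ha, ← hb]
    simp only [WithTop.untopD_coe]
    linarith
  | _ => simp [arcLength]

theorem fbarR_vec (hb : ∀ u v : I.U, u.1 ≠ v.1 → h u v = I.bin u.1 v.1 u.2 v.2)
    (x : I.Assignment) : I.fbarR h (I.vec x) = I.f x := by
  unfold fbarR
  rw [if_pos (card_vec x), fbar_vec hb]

/-! ### Correctness of complete runs -/

namespace Run

theorem init_min (R : Run I) (Z : Finset I.U) : I.fbarR R.h (R.st 0).X ≤ I.fbarR R.h Z := by
  obtain ⟨hc, hm⟩ := IsGreedy.minimizer R.completion.isUltra R.greedy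
  rw [R.init_X]
  unfold fbarR
  rw [if_pos hc]
  split_ifs with hZ
  exacts [hm Z hZ, le_top]

theorem certified (R : Run I) (hfin : I.fbarR R.h (R.st 0).X ≠ ⊤) :
    ∀ k ≤ R.K, ∃ q, Certified R.h (R.st k) q := by
  intro k
  induction k with
  | zero => intro _; exact ⟨_, certified_init R.init_min hfin R.init_Y R.init_p⟩
  | succ k ih =>
    intro hk
    obtain ⟨q, C⟩ := ih (by omega)
    exact C.iteration R.completion.isUltra (R.iteration k (by omega))

/-- The potential function is the size of `X \ Y`, initially at most `r`. Only the combinatorics of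
paths is used, not the invariant. -/
theorem K_le (R : Run I) : R.K ≤ I.r := by
  have key : ∀ k ≤ R.K, k + ((R.st k).X \ (R.st k).Y).card ≤ I.r := by
    intro k
    induction k with
    | zero =>
      intro _
      obtain ⟨hc, -⟩ := IsGreedy.minimizer R.completion.isUltra R.greedy
      rw [zero_add, R.init_X]
      exact (Finset.card_le_card Finset.sdiff_subset).trans hc.le
    | succ k ih =>
      intro hk
      obtain ⟨-, dp, P, -, -, hP, -, hX', hY', -⟩ := R.iteration k (by omega)
      have := Finset.card_lt_card hP.1.augment_sdiff
      rw [hX', hY']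
      have := ih (by omega)
      omega
  have := key R.K le_rfl
  omega

/-- A finished run has found a minimizer. -/
theorem finished (R : Run I) (hR : R.Finished) : ∃ x : I.Assignment, I.IsMinimizer x ∧
    (R.st R.K).Y = I.vec x ∧ ((R.st R.K).X = I.vec x ∨ ∀ y, I.f y = ⊤) := by
  have hb := R.completion.2.1
  -- If even the greedy minimum is infinite, then `f` is identically infinite and no iteration took
  -- place, so every assignment is a minimizer.
  by_cases hfin : I.fbarR R.h (R.st 0).X = ⊤
  · have htop : ∀ y, I.f y = ⊤ := fun y => by
      rw [← fbarR_vec hb, ← top_le_iff, ← hfin]; exact R.init_min _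
    have hK : R.K = 0 := by
      by_contra hne
      exact (R.iteration 0 (by omega)).1 (Or.inr (Or.inl hfin))
    obtain ⟨x, hx⟩ := R.init_Y
    exact ⟨x, fun y => by rw [htop, htop], by rw [hK, hx], Or.inr htop⟩
  · obtain ⟨q, C⟩ := R.certified hfin R.K le_rfl
    obtain ⟨x, hx⟩ := C.feas
    by_cases hXY : (R.st R.K).X = (R.st R.K).Y
    · refine ⟨x, fun y => ?_, hx, Or.inl (hXY.trans hx)⟩
      rw [← fbarR_vec hb, ← fbarR_vec hb, ← hx, ← hXY]
      exact C.le_feasible R.completion.isUltra hXY ⟨y, rfl⟩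
    · rcases hR with h1 | h1 | h1
      · exact absurd h1 hXY
      · exact absurd h1 C.fin
      · have htop : ∀ y, I.f y = ⊤ := fun y => by
          rw [← fbarR_vec hb]
          exact C.unreachable R.completion.isUltra (fun hr => h1 (reach_iff_path.1 hr)) hXY ⟨y, rfl⟩
        exact ⟨x, fun y => by rw [htop, htop], hx, Or.inr htop⟩

end Run

end BinaryVCSP

/-! ## Reasoning about programs of the random access machine -/

namespace RAM

attribute [simp] NExp.eval DExp.eval BExp.eval

/-- The integer arrays that a program may change. -/
def Prog.wN : Prog → List ℕ
  | .skip => []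
  | .setN a _ _ => [a]
  | .setD _ _ _ => []
  | .seq P Q => P.wN ++ Q.wN
  | .ite _ P Q => P.wN ++ Q.wN
  | .loop _ P => P.wN

/-- The data arrays that a program may change. -/
def Prog.wD : Prog → List ℕ
  | .skip => []
  | .setN _ _ _ => []
  | .setD a _ _ => [a]
  | .seq P Q => P.wD ++ Q.wD
  | .ite _ P Q => P.wD ++ Q.wD
  | .loop _ P => P.wD

/-- The memories `m` and `m'` agree outside of the given arrays. -/
structure Frame (wN wD : List ℕ) (m m' : Mem) : Prop where
  N : ∀ a, a ∉ wN → m'.N a = m.N a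
  D : ∀ a, a ∉ wD → m'.D a = m.D a

theorem Frame.refl (wN wD : List ℕ) (m : Mem) : Frame wN wD m m := ⟨fun _ _ => rfl, fun _ _ => rfl⟩

theorem Frame.trans {wN wD : List ℕ} {m m' m'' : Mem} (h : Frame wN wD m m')
    (h' : Frame wN wD m' m'') : Frame wN wD m m'' :=
  ⟨fun a ha => (h'.N a ha).trans (h.N a ha), fun a ha => (h'.D a ha).trans (h.D a ha)⟩

theorem Frame.append {wN wD wN' wD' : List ℕ} {m m' m'' : Mem} (h : Frame wN wD m m')
    (h' : Frame wN' wD' m' m'') : Frame (wN ++ wN') (wD ++ wD') m m'' :=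
  ⟨fun a ha => by
    rw [List.mem_append, not_or] at ha; exact (h'.N a ha.2).trans (h.N a ha.1),
  fun a ha => by
    rw [List.mem_append, not_or] at ha; exact (h'.D a ha.2).trans (h.D a ha.1)⟩

theorem Frame.mono {wN wD wN' wD' : List ℕ} {m m' : Mem} (h : Frame wN wD m m')
    (hN : wN ⊆ wN') (hD : wD ⊆ wD') : Frame wN' wD' m m' :=
  ⟨fun a ha => h.N a fun h' => ha (hN h'), fun a ha => h.D a fun h' => ha (hD h')⟩

@[simp] theorem setN_N_of_ne {m : Mem} {a a' i k : ℕ} (h : a' ≠ a) :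
    (m.setN a i k).N a' = m.N a' := by
  simp [Mem.setN, h]

@[simp] theorem setN_N {m : Mem} {a i j k : ℕ} :
    (m.setN a i k).N a j = if j = i then k else m.N a j := by
  simp [Mem.setN, Function.update_apply]

@[simp] theorem setN_D {m : Mem} {a i k : ℕ} : (m.setN a i k).D = m.D := rfl

@[simp] theorem setD_D_of_ne {m : Mem} {a a' i : ℕ} {y : WithTop ℝ} (h : a' ≠ a) :
    (m.setD a i y).D a' = m.D a' := by
  simp [Mem.setD, h]

@[simp] theorem setD_D {m : Mem} {a i j : ℕ} {y : WithTop ℝ} :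
    (m.setD a i y).D a j = if j = i then y else m.D a j := by
  simp [Mem.setD, Function.update_apply]

@[simp] theorem setD_N {m : Mem} {a i : ℕ} {y : WithTop ℝ} : (m.setD a i y).N = m.N := rfl

/-- The written arrays are read off syntactically, so preservation of the other data reduces to
decidable statements about array names. -/
theorem Exec.frame {P : Prog} {m m' : Mem} {t : ℕ} (h : Exec P m t m') :
    Frame P.wN P.wD m m' := by
  induction h with
  | skip m => exact Frame.refl _ _ _
  | setN a i e m =>
    refine ⟨fun b hb => setN_N_of_ne ?_, fun b _ => rfl⟩
    simpa [Prog.wN] using hb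
  | setD a i e m =>
    refine ⟨fun b _ => rfl, fun b hb => setD_D_of_ne ?_⟩
    simpa [Prog.wD] using hb
  | seq _ _ ih1 ih2 =>
    exact (ih1.mono (List.subset_append_left _ _) (List.subset_append_left _ _)).trans
      (ih2.mono (List.subset_append_right _ _) (List.subset_append_right _ _))
  | ite_true _ _ ih => exact ih.mono (List.subset_append_left _ _) (List.subset_append_left _ _)
  | ite_false _ _ ih => exact ih.mono (List.subset_append_right _ _) (List.subset_append_right _ _)
  | loop_false _ => exact Frame.refl _ _ _
  | loop_true _ _ _ ih1 ih2 => exact Frame.trans ih1 ih2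

/-- Started with `m`, the program `P` halts after at most `c` steps, and `Q` holds then. -/
def Runs (P : Prog) (m : Mem) (c : ℕ) (Q : Mem → Prop) : Prop :=
  ∃ t m', Exec P m t m' ∧ t ≤ c ∧ Q m'

variable {P P' : Prog} {m : Mem} {c c' : ℕ} {Q R : Mem → Prop}

theorem Runs.mono (h : Runs P m c Q) (hc : c ≤ c')
    (hQ : ∀ m', Frame P.wN P.wD m m' → Q m' → R m') : Runs P m c' R := by
  obtain ⟨t, m', h1, h2, h3⟩ := h
  exact ⟨t, m', h1, h2.trans hc, hQ m' h1.frame h3⟩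

theorem Runs.cost_le (h : Runs P m c Q) (hc : c ≤ c') : Runs P m c' Q :=
  h.mono hc fun _ _ h => h

theorem Runs.seq (h : Runs P m c Q)
    (h' : ∀ m', Frame P.wN P.wD m m' → Q m' → Runs P' m' c' R) :
    Runs (.seq P P') m (c + c') R := by
  obtain ⟨t, m', h1, h2, h3⟩ := h
  obtain ⟨t', m'', h1', h2', h3'⟩ := h' m' h1.frame h3
  exact ⟨_, m'', .seq h1 h1', by omega, h3'⟩

/-- The bound adds the costs of both branches; this keeps it linear for later arithmetic and changes
only constants. -/
theorem Runs.ite {b : BExp} (h : b.eval m → Runs P m c Q) (h' : ¬ b.eval m → Runs P' m c' Q) :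
    Runs (.ite b P P') m (b.cost + 1 + (c + c')) Q := by
  by_cases hb : b.eval m
  · obtain ⟨t, m', h1, h2, h3⟩ := h hb
    exact ⟨_, m', .ite_true hb h1, by omega, h3⟩
  · obtain ⟨t, m', h1, h2, h3⟩ := h' hb
    exact ⟨_, m', .ite_false hb h1, by omega, h3⟩

/-- A bound for the number of steps of a program without loops. -/
def Prog.time : Prog → ℕ
  | .skip => 1
  | .setN _ i e => i.cost + e.cost + 1
  | .setD _ i e => i.cost + e.cost + 1
  | .seq P Q => P.time + Q.time
  | .ite b P Q => b.cost + 1 + (P.time + Q.time)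
  | .loop _ _ => 0

/-- The weakest precondition of a program without loops. -/
@[simp] def Prog.wp : Prog → (Mem → Prop) → Mem → Prop
  | .skip, Q, m => Q m
  | .setN a i e, Q, m => Q (m.setN a (i.eval m) (e.eval m))
  | .setD a i e, Q, m => Q (m.setD a (i.eval m) (e.eval m))
  | .seq P P', Q, m => P.wp (P'.wp Q) m
  | .ite b P P', Q, m => (b.eval m → P.wp Q m) ∧ (¬ b.eval m → P'.wp Q m)
  | .loop _ _, _, _ => False

/-- The value `0` that `Prog.time` assigns to a loop is harmless, because the precondition of a loop
is `False`. -/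
theorem Runs.of_wp (h : P.wp Q m) : Runs P m P.time Q := by
  induction P generalizing m Q with
  | skip => exact ⟨_, _, .skip m, le_rfl, h⟩
  | setN a i e => exact ⟨_, _, .setN a i e m, le_rfl, h⟩
  | setD a i e => exact ⟨_, _, .setD a i e m, le_rfl, h⟩
  | seq P P' ih ih' => exact (ih h).seq fun m' _ hm' => ih' hm'
  | ite b P P' ih ih' => exact Runs.ite (fun hb => ih (h.1 hb)) fun hb => ih' (h.2 hb)
  | loop b P ih => exact h.elim

/-- The scalar in cell `0` of an integer array. -/
abbrev NExp.var (a : ℕ) : NExp := .get a (.lit 0)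

/-- The scalar in cell `0` of a data array. -/
abbrev DExp.var (a : ℕ) : DExp := .get a (.lit 0)

/-- Assignment to the scalar in cell `0` of an integer array. -/
abbrev Prog.letN (a : ℕ) (e : NExp) : Prog := .setN a (.lit 0) e

/-- Assignment to the scalar in cell `0` of a data array. -/
abbrev Prog.letD (a : ℕ) (e : DExp) : Prog := .setD a (.lit 0) e

/-- Strict inequality of integers. -/
abbrev BExp.nlt (e e' : NExp) : BExp := .not (.nle e' e)

/-- Equality of integers. -/
abbrev BExp.neq (e e' : NExp) : BExp := .and (.nle e e') (.nle e' e)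

/-- Equality of data. -/
abbrev BExp.deq (e e' : DExp) : BExp := .and (.dle e e') (.dle e' e)

/-- `P` is executed with the values `0, 1, …` of the scalar `i`, while `i < b`. -/
def Prog.forN (i : ℕ) (b : NExp) (P : Prog) : Prog :=
  .seq (.letN i (.lit 0))
    (.loop (.nlt (.var i) b) (.seq P (.letN i (.add (.var i) (.lit 1)))))

/-- A successful test costs `b.cost + 5` and the increment costs `6`, hence `b.cost + 11` per round
besides the body; the last test and the initialization cost `b.cost + 8`. The invariant is required
after the increment of the counter, and the body must not write the counter array. -/
theorem Runs.forN {i N : ℕ} {b : NExp} (Inv : ℕ → Mem → Prop)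
    (hb : ∀ m', Frame (Prog.forN i b P).wN (Prog.forN i b P).wD m m' → b.eval m' = N)
    (h0 : Inv 0 (m.setN i 0 0))
    (hi : i ∉ P.wN)
    (hs : ∀ k m', k < N → Frame (Prog.forN i b P).wN (Prog.forN i b P).wD m m' →
      m'.N i 0 = k → Inv k m' → Runs P m' c fun m'' => Inv (k + 1) (m''.setN i 0 (k + 1)))
    (hQ : ∀ m', Frame (Prog.forN i b P).wN (Prog.forN i b P).wD m m' → m'.N i 0 = N →
      Inv N m' → Q m') :
    Runs (Prog.forN i b P) m (N * (c + b.cost + 11) + b.cost + 8) Q := by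
  have hsubN : P.wN ⊆ (Prog.forN i b P).wN := by
    intro a ha; simp [Prog.forN, Prog.wN, ha]
  have hsubD : P.wD ⊆ (Prog.forN i b P).wD := by
    intro a ha; simp [Prog.forN, Prog.wD, ha]
  have hset : ∀ m' x, Frame (Prog.forN i b P).wN (Prog.forN i b P).wD m' (m'.setN i 0 x) := by
    intro m' x
    refine ⟨fun a ha => setN_N_of_ne ?_, fun a _ => rfl⟩
    rintro rfl
    exact ha (by simp [Prog.forN, Prog.wN])
  have key : ∀ j k m', j + k = N → Frame (Prog.forN i b P).wN (Prog.forN i b P).wD m m' →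
      m'.N i 0 = k → Inv k m' →
      Runs (.loop (.nlt (.var i) b) (.seq P (.letN i (.add (.var i) (.lit 1))))) m'
        (j * (c + b.cost + 11) + b.cost + 5) Q := by
    intro j
    induction j with
    | zero =>
      intro k m' hk hF hik hI
      obtain rfl : k = N := by omega
      refine ⟨_, m', .loop_false ?_, ?_, hQ m' hF hik hI⟩
      · simp [BExp.eval, NExp.eval, hb m' hF, hik]
      · simp only [BExp.cost, NExp.cost]; omega
    | succ j ih =>
      intro k m' hk hF hik hI
      obtain ⟨t, m1, hE, ht, h1⟩ := hs k m' (by omega) hF hik hI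
      have hF1 := hE.frame
      have hi1 : m1.N i 0 = k := by rw [hF1.N i hi, hik]
      have hE2 : Exec (.letN i (.add (.var i) (.lit 1))) m1 6 (m1.setN i 0 (k + 1)) := by
        have := Exec.setN i (.lit 0) (.add (.var i) (.lit 1)) m1
        simpa [NExp.eval, NExp.cost, hi1] using this
      obtain ⟨t2, m2, hE3, ht2, h2⟩ := ih (k + 1) (m1.setN i 0 (k + 1)) (by omega)
        ((hF.trans (hF1.mono hsubN hsubD)).trans (hset _ _)) (by simp [setN_N]) h1
      refine ⟨_, m2, .loop_true ?_ (.seq hE hE2) hE3, ?_, h2⟩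
      · simp [BExp.eval, NExp.eval, hb m' hF, hik]; omega
      · simp only [BExp.cost, NExp.cost]
        have : (j + 1) * (c + b.cost + 11) = j * (c + b.cost + 11) + (c + b.cost + 11) := by ring
        omega
  obtain ⟨t, m', hE, ht, h1⟩ := key N 0 (m.setN i 0 0) (by omega) (hset _ _)
    (by simp [setN_N]) h0
  refine ⟨_, m', .seq (.setN i (.lit 0) (.lit 0) m) hE, ?_, h1⟩
  simp only [NExp.cost]
  omega

theorem Runs.forN_wp {i N : ℕ} {b : NExp} (Inv : ℕ → Mem → Prop)
    (hb : ∀ m', Frame (Prog.forN i b P).wN (Prog.forN i b P).wD m m' → b.eval m' = N)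
    (hc : N * (P.time + b.cost + 11) + b.cost + 8 ≤ c)
    (hi : i ∉ P.wN)
    (h0 : Inv 0 (m.setN i 0 0))
    (hs : ∀ k m', k < N → Frame (Prog.forN i b P).wN (Prog.forN i b P).wD m m' →
      m'.N i 0 = k → Inv k m' → P.wp (fun m'' => Inv (k + 1) (m''.setN i 0 (k + 1))) m')
    (hQ : ∀ m', Frame (Prog.forN i b P).wN (Prog.forN i b P).wD m m' → m'.N i 0 = N →
      Inv N m' → Q m') :
    Runs (Prog.forN i b P) m c Q :=
  (Runs.forN Inv hb h0 hi (fun k m' hk hF hik hI => Runs.of_wp (hs k m' hk hF hik hI))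
    hQ).cost_le hc

end RAM

/-! ## Numbering of the elements -/

namespace BinaryVCSP

open RAM

variable {I : BinaryVCSP}

theorem pos_inj {u v : I.U} (h : (I.pos u : ℕ) = I.pos v) : u = v :=
  I.pos.injective (Fin.ext h)

theorem exists_pos {k : ℕ} (hk : k < I.n) : ∃ u, (I.pos u : ℕ) = k :=
  ⟨I.pos.symm ⟨k, hk⟩, by simp⟩

theorem pos_lt (u : I.U) : (I.pos u : ℕ) < I.n := (I.pos u).2

theorem pos_ne {u v : I.U} (h : u ≠ v) : (I.pos u : ℕ) ≠ I.pos v := fun e => h (pos_inj e)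

/-- Every domain has at least two values. Together with `r ≥ 1` this absorbs additive constants and
multiples of `r` into multiples of `n`. -/
theorem two_mul_r_le (I : BinaryVCSP) : 2 * I.r ≤ I.n := by
  have : ∑ _i : Fin I.r, 2 ≤ ∑ i, I.d i := Finset.sum_le_sum fun i _ => I.two_le_d i
  unfold n
  simpa [mul_comm] using this

/-- The variable of the element with a given number. -/
theorem fst_eq_of_start {u : I.U} {i : ℕ} (h1 : I.start i ≤ I.pos u)
    (h2 : (I.pos u : ℕ) < I.start (i + 1)) : (u.1 : ℕ) = i := by
  have h3 := pos_val u
  have h4 := start_succ u.1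
  have h5 := u.2.2
  rcases lt_trichotomy (u.1 : ℕ) i with h | h | h
  · have := start_mono (I := I) (show (u.1 : ℕ) + 1 ≤ i by omega); omega
  · exact h
  · have := start_mono (I := I) (show i + 1 ≤ (u.1 : ℕ) by omega); omega

/-- Arrays that describe the instance: `N 10` holds `n`, `N 11` the beginnings of the blocks,
`N 12` the variable of each element, `N 13` the beginnings of the rows of the tables. -/
structure Setup (I : BinaryVCSP) (m : Mem) : Prop where
  r : m.N 0 0 = I.r
  n : m.N 10 0 = I.n
  start : ∀ i : Fin I.r, m.N 11 i = I.start i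
  cls : ∀ u : I.U, m.N 12 (I.pos u) = u.1
  off : ∀ u : I.U, m.N 13 (I.pos u) = I.pos u * I.n
  un : ∀ u : I.U, m.D 0 (I.pos u) = ((I.un u.1 u.2 : ℝ) : WithTop ℝ)
  bin : ∀ u v : I.U, u.1 ≠ v.1 → m.D 1 (I.pos u * I.n + I.pos v) = I.bin u.1 v.1 u.2 v.2

theorem Setup.frame {m m' : Mem} {wN wD : List ℕ} (h : Setup I m) (hF : Frame wN wD m m')
    (hN : ∀ a ∈ [0, 10, 11, 12, 13], a ∉ wN) (hD : ∀ a ∈ [0, 1], a ∉ wD) : Setup I m' := by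
  have e0 := hF.N 0 (hN 0 (by simp))
  have e10 := hF.N 10 (hN 10 (by simp))
  have e11 := hF.N 11 (hN 11 (by simp))
  have e12 := hF.N 12 (hN 12 (by simp))
  have e13 := hF.N 13 (hN 13 (by simp))
  have d0 := hF.D 0 (hD 0 (by simp))
  have d1 := hF.D 1 (hD 1 (by simp))
  constructor
  · rw [e0, h.r]
  · rw [e10, h.n]
  · rw [e11]; exact h.start
  · rw [e12]; exact h.cls
  · rw [e13]; exact h.off
  · rw [d0]; exact h.un
  · rw [d1]; exact h.bin

/-- In the absence of multiplication the row offset in `N 14` is accumulated by additions of `n`. `N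
15` is the current variable; one increment per element suffices because no block is empty. -/
def setupProg : Prog :=
  .seq (.letN 10 (.lit 0)) <|
  .seq (.forN 20 (.var 0) <|
    .seq (.setN 11 (.var 20) (.var 10)) <|
    .letN 10 (.add (.var 10) (.get 1 (.var 20)))) <|
  .seq (.letN 14 (.lit 0)) <|
  .seq (.letN 15 (.lit 0)) <|
  .forN 20 (.var 10) <|
    .seq (.ite (.nle (.add (.get 11 (.var 15)) (.get 1 (.var 15))) (.var 20))
      (.letN 15 (.add (.var 15) (.lit 1))) .skip) <|
    .seq (.setN 12 (.var 20) (.var 15)) <|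
    .seq (.setN 13 (.var 20) (.var 14)) <|
    .letN 14 (.add (.var 14) (.var 10))

theorem runs_setup {m : Mem} (hm : I.Encoded m) :
    Runs setupProg m (200 * I.n) (Setup I) := by
  obtain ⟨hr, hd, hun, hbin⟩ := hm
  have h2r := two_mul_r_le I
  have hr1 := I.r_pos
  unfold setupProg
  refine Runs.cost_le (Runs.seq (Runs.of_wp (Q := fun m' => m'.N 10 0 = 0) (by simp))
    fun m1 hF1 h1 => Runs.seq (c := 40 * I.r + 20) (R := Setup I)
      (Q := fun m' => m'.N 10 0 = I.n ∧ ∀ i : Fin I.r, m'.N 11 i = I.start i) ?_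
      fun m2 hF2 h2 => Runs.seq (Runs.of_wp (Q := fun m' => m'.N 14 0 = 0) (by simp))
      fun m3 hF3 h3 => Runs.seq (Runs.of_wp (Q := fun m' => m'.N 15 0 = 0 ∧ m'.N 14 0 = 0)
        (by simp [h3]))
      fun m4 hF4 h4 => (?_ : Runs _ _ (60 * I.n + 20) _)) ?_
  · refine Runs.forN_wp (N := I.r) (fun k m' => m'.N 10 0 = I.start k ∧
      ∀ i < k, m'.N 11 i = I.start i) (fun m' hF => ?_) ?_ (by decide) ?_ ?_ ?_
    · simp [hF.N 0 (by decide), hF1.N 0 (by decide), hr]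
    · simp only [Prog.time, NExp.cost]; omega
    · simp [h1, start_zero]
    · rintro k m' hk hF hik ⟨hI1, hI2⟩
      have hdk : m'.N 1 k = I.d ⟨k, hk⟩ := by
        rw [hF.N 1 (by decide), hF1.N 1 (by decide)]; exact hd ⟨k, hk⟩
      simp [hik, hdk, hI1]
      refine ⟨(start_succ ⟨k, hk⟩).symm, fun i hi => ?_⟩
      split_ifs with h
      · rw [h]
      · exact hI2 i (by omega)
    · rintro m' - - ⟨hI1, hI2⟩
      exact ⟨by rw [hI1, start_r], fun i => hI2 i i.2⟩
  · have hFF := ((hF1.append hF2).append hF3).append hF4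
    have hF34 := hF3.append hF4
    have hn : m4.N 10 0 = I.n := by rw [hF34.N 10 (by decide)]; exact h2.1
    have hst : ∀ i : Fin I.r, m4.N 11 i = I.start i := by
      rw [hF34.N 11 (by decide)]; exact h2.2
    have hd4 : ∀ i : Fin I.r, m4.N 1 i = I.d i := by rw [hFF.N 1 (by decide)]; exact hd
    -- The upper bound in the invariant is not strict: before element `k` is treated, `N 15` may
    -- still name the block that has just ended.
    refine Runs.forN_wp (N := I.n) (fun k m' => m'.N 14 0 = k * I.n ∧
      (m'.N 15 0 < I.r ∧ I.start (m'.N 15 0) ≤ k ∧ k ≤ I.start (m'.N 15 0 + 1)) ∧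
      ∀ u : I.U, (I.pos u : ℕ) < k → m'.N 12 (I.pos u) = u.1 ∧ m'.N 13 (I.pos u) = I.pos u * I.n)
      (fun m' hF => ?_) ?_ (by decide) ?_ ?_ ?_
    · simp [hF.N 10 (by decide), hn]
    · simp only [Prog.time, NExp.cost, BExp.cost]; omega
    · simp [h4, start_zero]
      exact I.r_pos
    · rintro k m' hk hF hik ⟨hI1, ⟨hc1, hc2, hc3⟩, hI3⟩
      have hst' : m'.N 11 (m'.N 15 0) = I.start (m'.N 15 0) := by
        rw [hF.N 11 (by decide)]; exact hst ⟨_, hc1⟩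
      have hd' : m'.N 1 (m'.N 15 0) = I.d ⟨m'.N 15 0, hc1⟩ := by
        rw [hF.N 1 (by decide)]; exact hd4 ⟨_, hc1⟩
      have hn' : m'.N 10 0 = I.n := by rw [hF.N 10 (by decide), hn]
      have hss := start_succ ⟨m'.N 15 0, hc1⟩
      simp only at hss
      have fin : ∀ cc : ℕ, I.start cc ≤ k → k < I.start (cc + 1) → ∀ u : I.U,
          (I.pos u : ℕ) ≤ k → (if (I.pos u : ℕ) = k then cc else m'.N 12 (I.pos u)) = u.1 ∧
          (if (I.pos u : ℕ) = k then k * I.n else m'.N 13 (I.pos u)) = I.pos u * I.n := by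
        intro cc h5 h6 u hu
        by_cases hk' : (I.pos u : ℕ) = k
        · rw [if_pos hk', if_pos hk', hk']
          exact ⟨(fst_eq_of_start (by omega) (by omega)).symm, rfl⟩
        · rw [if_neg hk', if_neg hk']
          exact hI3 u (by omega)
      have hmul : (k + 1) * I.n = k * I.n + I.n := by ring
      simp [hik, hst', hd', hI1, hn', hmul]
      refine ⟨fun h5 => ?_, fun h5 => ?_⟩
      -- The last block ends at `n > k`, so the variable is never advanced beyond it.
      · have hc : m'.N 15 0 + 1 < I.r := by
          by_contra hcon
          have : m'.N 15 0 + 1 = I.r := by omega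
          rw [this, start_r] at hc3 hss
          omega
        have hss2 := start_succ ⟨m'.N 15 0 + 1, hc⟩
        have hd2 := I.two_le_d ⟨m'.N 15 0 + 1, hc⟩
        simp only at hss2
        exact ⟨⟨hc, by omega, by omega⟩, fin _ (by omega) (by omega)⟩
      · exact ⟨⟨hc1, by omega, by omega⟩, fin _ (by omega) (by omega)⟩
    · rintro m' hF - ⟨-, -, hI3⟩
      have hFA := hFF.append hF
      exact ⟨by rw [hFA.N 0 (by decide), hr], by rw [hF.N 10 (by decide), hn],
        by rw [hF.N 11 (by decide)]; exact hst, fun u => (hI3 u (pos_lt u)).1,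
        fun u => (hI3 u (pos_lt u)).2, by rw [hFA.D 0 (by decide)]; exact hun,
        by rw [hFA.D 1 (by decide)]; exact hbin⟩
  · simp only [Prog.time, NExp.cost]; omega

end BinaryVCSP

/-! ## The smallest completion -/

namespace BinaryVCSP

variable {I : BinaryVCSP}

/-- The given weight of two elements that belong to different variables, otherwise zero. -/
noncomputable def given (I : BinaryVCSP) (u v : I.U) : WithTop ℝ :=
  if u.1 = v.1 then 0 else I.bin u.1 v.1 u.2 v.2

theorem given_symm (u v : I.U) : I.given u v = I.given v u := by
  unfold given
  by_cases h : u.1 = v.1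
  · rw [if_pos h, if_pos h.symm]
  · rw [if_neg h, if_neg (Ne.symm h), I.bin_symm _ _ h]

theorem given_nonneg (u v : I.U) : 0 ≤ I.given u v := by
  unfold given
  split_ifs with h
  exacts [le_rfl, I.bin_nonneg _ _ h _ _]

/-- `u` and `v` are joined by a given weight that is at least `c`. -/
def Joined (I : BinaryVCSP) (c : WithTop ℝ) (u v : I.U) : Prop :=
  u.1 ≠ v.1 ∧ c ≤ I.given u v

theorem Joined.symm {c : WithTop ℝ} {u v : I.U} (h : I.Joined c u v) : I.Joined c v u :=
  ⟨h.1.symm, given_symm u v ▸ h.2⟩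

/-- The joint winner property at threshold `c`: being joined is transitive except when the ends
belong to one variable. -/
theorem Joined.trans (hI : I.ZFree) {c : WithTop ℝ} {u w v : I.U} (h1 : I.Joined c u w)
    (h2 : I.Joined c w v) (huv : u.1 ≠ v.1) : I.Joined c u v := by
  refine ⟨huv, ?_⟩
  obtain ⟨n1, l1⟩ := h1
  obtain ⟨n2, l2⟩ := h2.symm
  unfold given at *
  rw [if_neg n1] at l1
  rw [if_neg n2] at l2
  rw [if_neg huv]
  exact (le_min l2 l1).trans (hI.1 u.1 v.1 w.1 huv n2 n1 u.2 v.2 w.2)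

/-- If only the fourth corner were below `c`, it would be the only minimum of the rectangle,
contrary to the second condition of Z-freeness. -/
theorem ZFree.rectangle (hI : I.ZFree) {c : WithTop ℝ} {i j : Fin I.r} (hij : i ≠ j)
    {a b : Fin (I.d i)} {x y : Fin (I.d j)} (h1 : c ≤ I.bin i j a x) (h2 : c ≤ I.bin i j b x)
    (h3 : c ≤ I.bin i j b y) : c ≤ I.bin i j a y := by
  by_cases hab : a = b
  · rwa [hab]
  by_cases hxy : x = y
  · rwa [← hxy]
  by_contra hlt
  rw [not_le] at hlt
  have hcard := hI.2 i j hij a b hab x y hxy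
  refine absurd hcard (not_le.2 (lt_of_le_of_lt (Finset.card_le_card
    (t := {(a, y)}) fun e he => ?_) (by simp)))
  rw [Finset.mem_filter] at he
  obtain ⟨he1, he2⟩ := he
  have he3 := lt_of_le_of_lt (he2 (a, y) (by simp)) hlt
  simp only [Finset.mem_product, Finset.mem_insert, Finset.mem_singleton] at he1
  obtain ⟨e1, e2⟩ := e
  simp only at he1 he3
  rw [Finset.mem_singleton]
  rcases he1 with ⟨rfl | rfl, rfl | rfl⟩
  · exact absurd he3 (not_lt.2 h1)
  · rfl
  · exact absurd he3 (not_lt.2 h2)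
  · exact absurd he3 (not_lt.2 h3)

/-- Chains of three given weights can be shortened. -/
theorem Joined.chain (hI : I.ZFree) {c : WithTop ℝ} {u w v x : I.U} (h1 : I.Joined c u w)
    (h2 : I.Joined c w v) (h3 : I.Joined c v x) (hux : u.1 ≠ x.1) : I.Joined c u x := by
  by_cases huv : u.1 = v.1
  · by_cases hwx : w.1 = x.1
    · refine ⟨hux, ?_⟩
      obtain ⟨n1, l1⟩ := h1
      obtain ⟨n2, l2⟩ := h2.symm
      obtain ⟨n3, l3⟩ := h3
      unfold given at *
      rw [if_neg n1] at l1
      rw [if_neg n2] at l2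
      rw [if_neg n3] at l3
      rw [if_neg hux]
      obtain ⟨i, a⟩ := u
      obtain ⟨i', b⟩ := v
      obtain ⟨j, y⟩ := w
      obtain ⟨j', z⟩ := x
      dsimp only at *
      subst huv hwx
      exact hI.rectangle hux l1 l2 l3
    · exact h1.trans hI (h2.trans hI h3 hwx) hux
  · exact (h1.trans hI h2 huv).trans hI h3 hux

/-- The smallest completion; two elements of the same variable get the best bottleneck over the
elements of the other variables. -/
noncomputable def hstar (I : BinaryVCSP) (u v : I.U) : WithTop ℝ :=
  if u.1 = v.1 then Finset.univ.fold max 0 fun w : I.U => min (I.given u w) (I.given v w)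
  else I.given u v

/-- For positive thresholds the conventional value `0` inside a variable plays no role, and
inequalities for `hstar` become statements about chains in the relation `Joined c`. -/
theorem le_hstar {c : WithTop ℝ} (hc : 0 < c) {u v : I.U} : c ≤ I.hstar u v ↔
    I.Joined c u v ∨ u.1 = v.1 ∧ ∃ w, I.Joined c u w ∧ I.Joined c v w := by
  unfold hstar
  split_ifs with h
  · rw [Finset.le_fold_max]
    constructor
    · rintro (h0 | ⟨w, -, hw⟩)
      · exact absurd h0 (not_le.2 hc)
      · rw [le_min_iff] at hw
        have hne : u.1 ≠ w.1 := fun e => by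
          have := hw.1
          unfold given at this
          rw [if_pos e] at this
          exact absurd this (not_le.2 hc)
        exact Or.inr ⟨h, w, ⟨hne, hw.1⟩, ⟨h ▸ hne, hw.2⟩⟩
    · rintro (h1 | ⟨-, w, h1, h2⟩)
      · exact absurd h h1.1
      · exact Or.inr ⟨w, Finset.mem_univ _, le_min h1.2 h2.2⟩
  · constructor
    · intro h1; exact Or.inl ⟨h, h1⟩
    · rintro (h1 | h1)
      exacts [h1.2, absurd h1.1 h]

theorem hstar_of_ne {u v : I.U} (h : u.1 ≠ v.1) : I.hstar u v = I.given u v := if_neg h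

theorem hstar_nonneg (u v : I.U) : 0 ≤ I.hstar u v := by
  unfold hstar
  split_ifs
  · rw [Finset.le_fold_max]; exact Or.inl le_rfl
  · exact given_nonneg u v

theorem given_le_hstar (u v : I.U) : I.given u v ≤ I.hstar u v := by
  by_cases h : u.1 = v.1
  · unfold given; rw [if_pos h]; exact hstar_nonneg u v
  · rw [hstar_of_ne h]

theorem hstar_symm (u v : I.U) : I.hstar u v = I.hstar v u := by
  unfold hstar
  by_cases h : u.1 = v.1
  · rw [if_pos h, if_pos h.symm]
    simp only [min_comm]
  · rw [if_neg h, if_neg (Ne.symm h), given_symm]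

/-- The ultrametric inequality for the smallest completion. -/
theorem hstar_tri (hI : I.ZFree) (u v w : I.U) :
    min (I.hstar u w) (I.hstar w v) ≤ I.hstar u v := by
  rcases le_or_gt (min (I.hstar u w) (I.hstar w v)) 0 with h0 | h0
  · exact h0.trans (hstar_nonneg u v)
  · generalize hc : min (I.hstar u w) (I.hstar w v) = c at *
    have h1 : c ≤ I.hstar u w := hc ▸ min_le_left _ _
    have h2 : c ≤ I.hstar w v := hc ▸ min_le_right _ _
    rw [le_hstar h0] at h1 h2 ⊢
    -- Each of the two inequalities comes from a direct weight or from a detour inside one variable.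
    -- A direct step followed by a detour, or conversely, is a chain of three weights with ends in
    -- different variables, which `Joined.chain` shortens.
    rcases h1 with h1 | ⟨e1, z, h1, h1'⟩ <;> rcases h2 with h2 | ⟨e2, z', h2, h2'⟩
    · by_cases huv : u.1 = v.1
      · exact Or.inr ⟨huv, w, h1, h2.symm⟩
      · exact Or.inl (h1.trans hI h2 huv)
    · exact Or.inl (h1.chain hI h2 h2'.symm (e2 ▸ h1.1))
    · exact Or.inl (h1.chain hI h1'.symm h2 (e1 ▸ h2.1))
    -- With two detours the first three weights of the chain shorten to a weight between `u` and
    -- `z'`, so `z'` joins `u` and `v`.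
    · refine Or.inr ⟨e1.trans e2, z', ?_, h2'⟩
      exact h1.chain hI h1'.symm h2 (e1 ▸ h2.1)

/-- The completion that the program computes; its values on the diagonal are immaterial. -/
noncomputable def compl (I : BinaryVCSP) (u v : I.U) : WithTop ℝ :=
  if u = v then ⊤ else I.hstar u v

theorem compl_symm (u v : I.U) : I.compl u v = I.compl v u := by
  unfold compl
  by_cases h : u = v
  · rw [if_pos h, if_pos h.symm]
  · rw [if_neg h, if_neg (Ne.symm h), hstar_symm]

theorem isUltra_compl (hI : I.ZFree) : IsUltra I.compl := by
  refine ⟨compl_symm, fun u v huv => ?_, fun u v w huv huw hvw => ?_⟩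
  · rw [compl, if_neg huv]; exact hstar_nonneg u v
  · rw [compl, compl, compl, if_neg huv, if_neg huw, if_neg (Ne.symm hvw)]
    exact hstar_tri hI u v w

theorem isCompletion_compl (hI : I.ZFree) : I.IsCompletion I.compl := by
  refine ⟨compl_symm, fun u v huv => ?_, mNatConvex_fbar (isUltra_compl hI)⟩
  have hne : u ≠ v := by rintro rfl; exact huv rfl
  rw [compl, if_neg hne, hstar_of_ne huv, given, if_neg huv]

/-- The step of Prim's algorithm: `w` is joined to the tree `T` by an edge of maximum weight, whose
end in `T` is `q`. -/
theorem compl_of_max (hI : I.ZFree) {T : Finset I.U} {w q : I.U} (hw : w ∉ T) (hq : q ∈ T)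
    (hmax : ∀ v, v ∉ T → ∀ z ∈ T, I.given v z ≤ I.given w q) {v : I.U} (hv : v ∈ T) :
    I.compl w v = min (I.given w q) (I.compl q v) := by
  -- A detour from `w` over `z` to `v` crosses the boundary of `T`, whether or not `z` lies in `T`;
  -- its bottleneck is thus at most the maximum crossing weight.
  have hle : ∀ v ∈ T, I.hstar w v ≤ I.given w q := by
    intro v hv
    by_contra hlt
    rw [not_le] at hlt
    have h0 : 0 < I.hstar w v := lt_of_le_of_lt (given_nonneg _ _) hlt
    rcases (le_hstar h0).1 le_rfl with h1 | ⟨-, z, h1, h2⟩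
    · exact absurd (h1.2.trans (hmax w hw v hv)) (not_le.2 hlt)
    · by_cases hz : z ∈ T
      · exact absurd (h1.2.trans (hmax w hw z hz)) (not_le.2 hlt)
      · exact absurd (h2.symm.2.trans (hmax z hz v hv)) (not_le.2 hlt)
  have hwq : I.hstar w q = I.given w q := le_antisymm (hle q hq) (given_le_hstar w q)
  have hwv : w ≠ v := fun e => hw (e ▸ hv)
  rw [compl, if_neg hwv, compl]
  split_ifs with hqv
  -- The diagonal value `⊤` makes the recurrence valid for `v = q` too, which spares the program a
  -- case distinction.
  · rw [← hqv, hwq, min_eq_left le_top]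
  · refine le_antisymm (le_min (hle v hv) ?_) ?_
    · refine le_trans ?_ (hstar_tri hI q v w)
      rw [hstar_symm q w, hwq]
      exact le_min (hle v hv) le_rfl
    · rw [← hwq]; exact hstar_tri hI w v q

end BinaryVCSP

/-! ## Implementation of the first step -/

namespace RAM

/-- The best index with entry zero in the array `excl` is stored in `N 18`. -/
def scanProg (excl : ℕ) (better : BExp) : Prog :=
  .seq (.letN 19 (.lit 0)) <|
  .forN 21 (.var 10) <|
    .ite (.neq (.get excl (.var 21)) (.lit 0))
      (.ite (.neq (.var 19) (.lit 0)) (.seq (.letN 18 (.var 21)) (.letN 19 (.lit 1)))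
        (.ite better (.letN 18 (.var 21)) .skip))
      .skip

/-- The order is left general so that one scan yields minima for the greedy step and, in the dual
order, maxima for Prim's algorithm. `N 19` is `0` until a first candidate has been met, when `N 18`
is not yet meaningful. -/
theorem runs_scan {β : Type} [LinearOrder β] (f : ℕ → β) {excl n : ℕ} {better : BExp} {m : Mem}
    (hn : m.N 10 0 = n) (hex : ∃ v < n, m.N excl v = 0)
    (hexcl : excl ∉ [18, 19, 21])
    (hbet : ∀ m', Frame [19, 21, 18] [] m m' →
      (better.eval m' ↔ f (m'.N 21 0) < f (m'.N 18 0))) :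
    Runs (scanProg excl better) m (n * (better.cost + 60) + 30) fun m' =>
      m'.N 18 0 < n ∧ m.N excl (m'.N 18 0) = 0 ∧
        ∀ v < n, m.N excl v = 0 → f (m'.N 18 0) ≤ f v := by
  simp only [List.mem_cons, not_or, List.not_mem_nil, not_false_eq_true, and_true] at hexcl
  obtain ⟨hx18, hx19, hx21⟩ := hexcl
  refine Runs.cost_le (c := 3 + (n * (better.cost + 59) + 10))
    (Runs.seq (Runs.of_wp (Q := fun m' => m'.N 19 0 = 0)
    (by simp)) fun m1 hF1 h1 => ?_) (by nlinarith)
  refine Runs.forN_wp (N := n) (fun k m' => (m'.N 19 0 = 0 ∧ ∀ v < k, m.N excl v ≠ 0) ∨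
      (m'.N 19 0 = 1 ∧ m'.N 18 0 < k ∧ m.N excl (m'.N 18 0) = 0 ∧
        ∀ v < k, m.N excl v = 0 → f (m'.N 18 0) ≤ f v))
      (fun m' hF => ?_) ?_ (by simp [Prog.wN]) ?_ ?_ ?_
  · simp [hF.N 10 (by simp [Prog.forN, Prog.wN]), hF1.N 10 (by simp [Prog.wN]), hn]
  · simp only [Prog.time, NExp.cost, BExp.cost]; nlinarith
  · simp [h1]
  · intro k m' hk hF hik hI
    have hFF : Frame [19, 21, 18] [] m m' := (hF1.append hF).mono (by simp [Prog.forN, Prog.wN])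
      (by simp [Prog.forN, Prog.wD])
    have hb := hbet m' hFF
    have he : m'.N excl = m.N excl := hFF.N excl (by simp [hx18, hx19, hx21])
    rw [hik] at hb
    have hle : ∀ {a b : ℕ}, a ≤ b ↔ a < b + 1 := Nat.lt_succ_iff.symm
    simp [hik, hb, he]
    refine ⟨fun hz => ⟨fun h19 => ?_, fun h19 => ⟨fun hlt => ?_, fun hlt => ?_⟩⟩, fun hz => ?_⟩
    · refine ⟨hz, fun v hv hv0 => ?_⟩
      rcases hI with hI | hI
      · rcases Nat.lt_or_ge v k with h2 | h2
        · exact absurd hv0 (hI.2 v h2)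
        · rw [show v = k by omega]
      · omega
    · rcases hI with hI | hI
      · omega
      · refine Or.inr ⟨hI.1, hz, fun v hv hv0 => ?_⟩
        rcases Nat.lt_or_ge v k with h2 | h2
        · exact hlt.le.trans (hI.2.2.2 v h2 hv0)
        · rw [show v = k by omega]
    · rcases hI with hI | hI
      · omega
      · refine Or.inr ⟨hI.1, by omega, hI.2.2.1, fun v hv hv0 => ?_⟩
        rcases Nat.lt_or_ge v k with h2 | h2
        · exact hI.2.2.2 v h2 hv0
        · rw [show v = k by omega]; exact hlt
    · rcases hI with hI | hI
      · refine Or.inl ⟨hI.1, fun v hv => ?_⟩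
        rcases Nat.lt_or_ge v k with h2 | h2
        · exact hI.2 v h2
        · rwa [show v = k by omega]
      · refine Or.inr ⟨hI.1, by omega, hI.2.2.1, fun v hv hv0 => ?_⟩
        rcases Nat.lt_or_ge v k with h2 | h2
        · exact hI.2.2.2 v h2 hv0
        · rw [show v = k by omega] at hv0; exact absurd hv0 hz
  · rintro m' hF - (hI | hI)
    · obtain ⟨v, hv, hv0⟩ := hex
      exact absurd hv0 (hI.2 v hv)
    · exact hI.2

end RAM

/-! ### Prim's algorithm for the completion -/

namespace BinaryVCSP

open RAM

variable {I : BinaryVCSP}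

@[simp] theorem pos_eq_iff {u v : I.U} : (I.pos u : ℕ) = I.pos v ↔ u = v :=
  ⟨pos_inj, fun h => by rw [h]⟩

/-- The index of a pair of elements in a table. -/
def idx (I : BinaryVCSP) (u v : I.U) : ℕ := I.pos u * I.n + I.pos v

theorem idx_inj {u v u' v' : I.U} : I.idx u v = I.idx u' v' ↔ u = u' ∧ v = v' := by
  constructor
  · intro h
    unfold idx at h
    have h1 := pos_lt v
    have h2 := pos_lt v'
    have h3 : 0 < I.n := by omega
    have h4 : (I.pos u : ℕ) = I.pos u' := by
      have := congrArg (· / I.n) h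
      simpa [add_comm, Nat.add_mul_div_right _ _ h3, Nat.div_eq_of_lt h1,
        Nat.div_eq_of_lt h2] using this
    rw [h4] at h
    exact ⟨pos_inj h4, pos_inj (by omega)⟩
  · rintro ⟨rfl, rfl⟩; rfl

/-- `D 11` becomes the given weight of the elements in `N 21` and `N 18`. -/
def weightProg : Prog :=
  .ite (.neq (.get 12 (.var 21)) (.get 12 (.var 18))) (.letD 11 .zero)
    (.letD 11 (.get 1 (.add (.get 13 (.var 21)) (.var 18))))

theorem wp_weight {m : Mem} (hS : Setup I m) {v w : I.U} (hv : m.N 21 0 = I.pos v)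
    (hw : m.N 18 0 = I.pos w) {Q : Mem → Prop} (hQ : Q (m.setD 11 0 (I.given v w))) :
    weightProg.wp Q m := by
  unfold weightProg
  simp only [Prog.wp, BExp.eval, NExp.eval, DExp.eval, hv, hw, hS.cls, hS.off]
  unfold given at hQ
  constructor
  · rintro ⟨h1, h2⟩
    rwa [if_pos (Fin.ext (le_antisymm h1 h2))] at hQ
  · intro h1
    have hne : v.1 ≠ w.1 := fun e => h1 ⟨by rw [e], by rw [e]⟩
    rw [hS.bin _ _ hne]
    rwa [if_neg hne] at hQ

/-- `N 16` marks the tree; `N 17` and `D 10` hold, for each outside element, its best tree neighbour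
and the weight to it. `N 18` is the newest tree vertex, here the root. -/
def primInit : Prog :=
  .forN 21 (.var 10) <|
    .seq (.setN 16 (.var 21) (.lit 0)) <|
    .seq weightProg <|
    .seq (.setD 10 (.var 21) (.var 11)) <|
    .setN 17 (.var 21) (.var 18)

/-- Implements `compl_of_max`: the row and the column of the new vertex come from the row of its
best tree neighbour, cut off at the weight of the joining edge. -/
def primRow : Prog :=
  .forN 21 (.var 10) <|
    .ite (.neq (.get 16 (.var 21)) (.lit 1))
      (.seq (.letD 11 (.get 2 (.add (.get 13 (.get 17 (.var 18))) (.var 21)))) <|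
      .seq (.ite (.dle (.var 11) (.get 10 (.var 18))) .skip (.letD 11 (.get 10 (.var 18)))) <|
      .seq (.setD 2 (.add (.get 13 (.var 18)) (.var 21)) (.var 11)) <|
      .setD 2 (.add (.get 13 (.var 21)) (.var 18)) (.var 11)) .skip

def primAdd : Prog :=
  .seq (.setD 2 (.add (.get 13 (.var 18)) (.var 18)) .top) (.setN 16 (.var 18) (.lit 1))

def primKey : Prog :=
  .forN 21 (.var 10) <|
    .ite (.neq (.get 16 (.var 21)) (.lit 0))
      (.seq weightProg <|
      .ite (.dle (.var 11) (.get 10 (.var 21))) .skip <|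
        .seq (.setD 10 (.var 21) (.var 11)) (.setN 17 (.var 21) (.var 18))) .skip

/-- The state of Prim's algorithm; `T` is the set of the vertices of the tree. -/
structure PrimInv (I : BinaryVCSP) (T : Finset I.U) (m : Mem) : Prop where
  mem : ∀ v, m.N 16 (I.pos v) = if v ∈ T then 1 else 0
  tab : ∀ u ∈ T, ∀ v ∈ T, m.D 2 (I.idx u v) = I.compl u v
  key : ∀ v, v ∉ T → ∃ q ∈ T, m.N 17 (I.pos v) = I.pos q ∧ m.D 10 (I.pos v) = I.given v q ∧
    ∀ z ∈ T, I.given v z ≤ I.given v q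

theorem runs_primInit {m : Mem} (hS : Setup I m) {w : I.U} (hw : m.N 18 0 = I.pos w) :
    Runs primInit m (100 * I.n + 20) fun m' => (∀ v : I.U, m'.N 16 (I.pos v) = 0) ∧
      ∀ v, m'.N 17 (I.pos v) = I.pos w ∧ m'.D 10 (I.pos v) = I.given v w := by
  unfold primInit
  refine Runs.forN_wp (N := I.n) (fun k m' => (∀ v : I.U, (I.pos v : ℕ) < k →
    m'.N 16 (I.pos v) = 0) ∧ ∀ v, (I.pos v : ℕ) < k → m'.N 17 (I.pos v) = I.pos w ∧
      m'.D 10 (I.pos v) = I.given v w) (fun m' hF => ?_) ?_ (by decide) ?_ ?_ ?_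
  · simp [hF.N 10 (by decide), hS.n]
  · simp only [weightProg, Prog.time, NExp.cost, BExp.cost, DExp.cost]; omega
  · simp
  · rintro k m' hk hF hik ⟨hI1, hI2⟩
    obtain ⟨u, rfl⟩ := exists_pos hk
    have hS' := hS.frame hF (by decide) (by decide)
    have hw' : m'.N 18 0 = I.pos w := by rw [hF.N 18 (by decide), hw]
    rw [Prog.wp, Prog.wp, Prog.wp]
    refine wp_weight (v := u) (w := w)
      (hS'.frame (Exec.frame (.setN 16 (.var 21) (.lit 0) m')) (by decide) (by decide))
      (by simp [hik]) (by simp [hw']) ?_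
    simp [hik, hw']
    refine ⟨fun v hv h1 => hI1 v (lt_of_le_of_ne hv (pos_ne h1)), fun v hv => ?_⟩
    by_cases h1 : v = u
    · simp [h1]
    · simp only [h1, if_false, not_false_eq_true, forall_const]
      exact hI2 v (lt_of_le_of_ne hv (pos_ne h1))
  · rintro m' - - ⟨hI1, hI2⟩
    exact ⟨fun v => hI1 v (pos_lt v), fun v => hI2 v (pos_lt v)⟩

theorem runs_primRow (hI : I.ZFree) {m : Mem} {T : Finset I.U} (hS : Setup I m)
    (hP : PrimInv I T m) {w : I.U} (hw : m.N 18 0 = I.pos w) (hwT : w ∉ T)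
    (hmax : ∀ v, v ∉ T → m.D 10 (I.pos v) ≤ m.D 10 (I.pos w)) :
    Runs primRow m (100 * I.n + 20) fun m' =>
      (∀ u ∈ T, ∀ v ∈ T, m'.D 2 (I.idx u v) = I.compl u v) ∧
      ∀ v ∈ T, m'.D 2 (I.idx w v) = I.compl w v ∧ m'.D 2 (I.idx v w) = I.compl w v := by
  obtain ⟨q, hq, hq1, hq2, hq3⟩ := hP.key w hwT
  have hstep : ∀ v ∈ T, I.compl w v = min (I.given w q) (I.compl q v) := by
    intro v hv
    refine compl_of_max hI hwT hq (fun v hv z hz => ?_) hv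
    obtain ⟨q', -, -, h2, h3⟩ := hP.key v hv
    rw [← hq2]
    exact ((h3 z hz).trans h2.ge).trans (hmax v hv)
  unfold primRow
  refine Runs.forN_wp (N := I.n) (fun k m' =>
    (∀ u ∈ T, ∀ v ∈ T, m'.D 2 (I.idx u v) = I.compl u v) ∧
      ∀ v ∈ T, (I.pos v : ℕ) < k →
        m'.D 2 (I.idx w v) = I.compl w v ∧ m'.D 2 (I.idx v w) = I.compl w v)
    (fun m' hF => ?_) ?_ (by decide) ?_ ?_ ?_
  · simp [hF.N 10 (by decide), hS.n]
  · simp only [Prog.time, NExp.cost, BExp.cost, DExp.cost]; omega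
  · simpa using hP.tab
  · rintro k m' hk hF hik ⟨hI1, hI2⟩
    obtain ⟨u, rfl⟩ := exists_pos hk
    have hS' := hS.frame hF (by decide) (by decide)
    have hw' : m'.N 18 0 = I.pos w := by rw [hF.N 18 (by decide), hw]
    have h16 : m'.N 16 (I.pos u) = if u ∈ T then 1 else 0 := by
      rw [hF.N 16 (by decide), hP.mem]
    have h17 : m'.N 17 (I.pos w) = I.pos q := by rw [hF.N 17 (by decide), hq1]
    have h10 : m'.D 10 (I.pos w) = I.given w q := by rw [hF.D 10 (by decide), hq2]
    have hidx : ∀ u v : I.U, (I.pos u : ℕ) * I.n + I.pos v = I.idx u v := fun _ _ => rfl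
    -- Each written entry has `w` as one index, and `w` is outside the tree, so the entries inside
    -- the tree, in particular those still to be read, survive.
    have fin : u ∈ T → ∀ y, y = I.compl w u →
        (∀ a ∈ T, ∀ b ∈ T, (if a = u ∧ b = w then y else if a = w ∧ b = u then y else
          m'.D 2 (I.idx a b)) = I.compl a b) ∧
        ∀ v ∈ T, I.pos v ≤ I.pos u →
          (if w = u ∧ v = w then y else if v = u then y else
            m'.D 2 (I.idx w v)) = I.compl w v ∧
          (if v = u then y else if v = w ∧ w = u then y else
            m'.D 2 (I.idx v w)) = I.compl w v := by
      intro hu y hy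
      have hwu : w ≠ u := fun e => hwT (e ▸ hu)
      refine ⟨fun a ha b hb => ?_, fun v hv hvu => ?_⟩
      · have haw : a ≠ w := fun e => hwT (e ▸ ha)
        have hbw : b ≠ w := fun e => hwT (e ▸ hb)
        rw [if_neg fun e => hbw e.2, if_neg fun e => haw e.1]
        exact hI1 a ha b hb
      · rw [if_neg fun e => hwu e.1]
        by_cases hv' : v = u
        · rw [if_pos hv', if_pos hv', hv', hy]; exact ⟨rfl, rfl⟩
        · rw [if_neg hv', if_neg hv', if_neg fun e => hwu e.2]
          exact hI2 v hv (lt_of_le_of_ne hvu (pos_ne hv'))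
    by_cases hu : u ∈ T
    · have htab : m'.D 2 (I.idx q u) = I.compl q u := hI1 q hq u hu
      have hc := hstep u hu
      simp [hik, hw', h16, hu, h17, h10, hS'.off, hidx, htab, idx_inj]
      refine ⟨fun hle => ?_, fun hlt => ?_⟩
      · exact fin hu _ (by rw [hc, min_eq_right hle])
      · exact fin hu _ (by rw [hc, min_eq_left hlt.le])
    · simp [hik, h16, hu]
      refine ⟨hI1, fun v hv hvu => hI2 v hv (lt_of_le_of_ne hvu (pos_ne fun e => hu (e ▸ hv)))⟩
  · rintro m' - - ⟨hI1, hI2⟩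
    exact ⟨hI1, fun v hv => hI2 v hv (pos_lt v)⟩

theorem runs_primKey {m : Mem} {T : Finset I.U} (hS : Setup I m) {w : I.U}
    (hw : m.N 18 0 = I.pos w) (hwT : w ∈ T)
    (hmem : ∀ v, m.N 16 (I.pos v) = if v ∈ T then 1 else 0)
    (hkey : ∀ v, v ∉ T → (∃ q ∈ T, m.N 17 (I.pos v) = I.pos q ∧
      m.D 10 (I.pos v) = I.given v q ∧ ∀ z ∈ T, z ≠ w → I.given v z ≤ I.given v q)) :
    Runs primKey m (100 * I.n + 20) fun m' =>
      ∀ v, v ∉ T → ∃ q ∈ T, m'.N 17 (I.pos v) = I.pos q ∧ m'.D 10 (I.pos v) = I.given v q ∧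
        ∀ z ∈ T, I.given v z ≤ I.given v q := by
  unfold primKey
  -- The tree already contains `w`. Until an element has been processed, its stored neighbour is
  -- known to be best only among the tree vertices other than `w`.
  refine Runs.forN_wp (N := I.n) (fun k m' =>
    ∀ v, v ∉ T → ∃ q ∈ T, m'.N 17 (I.pos v) = I.pos q ∧ m'.D 10 (I.pos v) = I.given v q ∧
        ∀ z ∈ T, z ≠ w ∨ (I.pos v : ℕ) < k → I.given v z ≤ I.given v q)
    (fun m' hF => ?_) ?_ (by decide) ?_ ?_ ?_
  · simp [hF.N 10 (by decide), hS.n]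
  · simp only [weightProg, Prog.time, NExp.cost, BExp.cost, DExp.cost]; omega
  · simpa using hkey
  · rintro k m' hk hF hik hI
    obtain ⟨u, rfl⟩ := exists_pos hk
    have hS' := hS.frame hF (by decide) (by decide)
    have hw' : m'.N 18 0 = I.pos w := by rw [hF.N 18 (by decide), hw]
    have h16 : m'.N 16 (I.pos u) = if u ∈ T then 1 else 0 := by
      rw [hF.N 16 (by decide), hmem]
    by_cases hu : u ∈ T
    · simp [hik, h16, hu, -Sigma.exists]
      intro v hv
      obtain ⟨q, hq, h1, h2, h3⟩ := hI v hv
      refine ⟨q, hq, h1, h2, fun z hz hz' => h3 z hz (hz'.imp_right fun h => ?_)⟩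
      exact lt_of_le_of_ne h (pos_ne fun e => hv (e ▸ hu))
    · have hold := hI u hu
      obtain ⟨q, hq, h1, h2, h3⟩ := hold
      refine ⟨fun _ => ?_, fun hne => absurd (by simp [hik, h16, hu]) hne⟩
      refine wp_weight (v := u) (w := w) hS' hik hw' ?_
      simp [hik, hw', h2, -Sigma.exists]
      refine ⟨fun hle v hv => ?_, fun hlt v hv => ?_⟩
      · obtain ⟨q', hq', h1', h2', h3'⟩ := hI v hv
        refine ⟨q', hq', h1', h2', fun z hz hz' => ?_⟩
        by_cases hvu : v = u
        · subst hvu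
          have hqq : I.given v q' = I.given v q := by rw [← h2', h2]
          by_cases hzw : z = w
          · rw [hzw, hqq]; exact hle
          · exact h3' z hz (Or.inl hzw)
        · exact h3' z hz (hz'.imp_right fun h => lt_of_le_of_ne h (pos_ne hvu))
      · by_cases hvu : v = u
        · subst hvu
          refine ⟨w, hwT, by simp, by simp, fun z hz _ => ?_⟩
          by_cases hzw : z = w
          · rw [hzw]
          · exact (h3 z hz (Or.inl hzw)).trans hlt.le
        · obtain ⟨q', hq', h1', h2', h3'⟩ := hI v hv
          refine ⟨q', hq', by simpa [hvu] using h1', by simpa [hvu] using h2', fun z hz hz' => ?_⟩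
          exact h3' z hz (hz'.imp_right fun h => lt_of_le_of_ne h (pos_ne hvu))
  · rintro m' - - hI v hv
    obtain ⟨q, hq, h1, h2, h3⟩ := hI v hv
    exact ⟨q, hq, h1, h2, fun z hz => h3 z hz (Or.inr (pos_lt v))⟩

theorem wp_primAdd {m : Mem} (hS : Setup I m) {w : I.U} (hw : m.N 18 0 = I.pos w)
    {Q : Mem → Prop} (hQ : Q ((m.setD 2 (I.idx w w) ⊤).setN 16 (I.pos w) 1)) :
    primAdd.wp Q m := by
  unfold primAdd
  simp [hw, hS.off]
  exact hQ

def primRound : Prog :=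
  .seq (scanProg 16 (.not (.dle (.get 10 (.var 21)) (.get 10 (.var 18))))) <|
  .seq primRow <|
  .seq primAdd primKey

theorem card_U (I : BinaryVCSP) : Fintype.card I.U = I.n := by
  rw [Fintype.card_congr I.pos, Fintype.card_fin]

theorem runs_primRound (hI : I.ZFree) {m : Mem} {T : Finset I.U} (hS : Setup I m)
    (hP : PrimInv I T m) (hT : T.card < I.n) :
    Runs primRound m (300 * I.n + 200) fun m' =>
      ∃ T' : Finset I.U, T'.card = T.card + 1 ∧ PrimInv I T' m' := by
  obtain ⟨v₀, hv₀⟩ : ∃ v, v ∉ T := by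
    by_contra hcon
    push Not at hcon
    rw [Finset.eq_univ_of_forall hcon, Finset.card_univ, card_U] at hT
    omega
  unfold primRound
  -- The dual order turns the minimum found by the scan into a maximum weight.
  refine Runs.cost_le (Runs.seq (runs_scan (β := (WithTop ℝ)ᵒᵈ)
    (fun i => OrderDual.toDual (m.D 10 i)) hS.n
    ⟨I.pos v₀, pos_lt v₀, by rw [hP.mem, if_neg hv₀]⟩ (by decide) (fun m' hF => ?_))
    fun m5 hF5 h5 => (?_ : Runs _ _ (205 * I.n + 70) _)) ?_
  · simp [hF.D 10 (by decide)]
  · obtain ⟨hlt, h5a, h5b⟩ := h5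
    obtain ⟨w, hw⟩ := exists_pos hlt
    rw [← hw] at h5a h5b
    have hS5 := hS.frame hF5 (by decide) (by decide)
    have hwT : w ∉ T := by
      intro hwT
      rw [hP.mem, if_pos hwT] at h5a
      exact one_ne_zero h5a
    have hP5 : PrimInv I T m5 := by
      constructor
      · rw [hF5.N 16 (by decide)]; exact hP.mem
      · rw [hF5.D 2 (by decide)]; exact hP.tab
      · rw [hF5.N 17 (by decide), hF5.D 10 (by decide)]; exact hP.key
    refine Runs.cost_le (Runs.seq (runs_primRow hI hS5 hP5 hw.symm hwT fun v hv => ?_)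
      fun m6 hF6 h6 => Runs.seq (Runs.of_wp (wp_primAdd (w := w)
        (Q := fun m7 => (∀ v, m7.N 16 (I.pos v) = if v ∈ insert w T then 1 else 0) ∧
          (∀ u ∈ insert w T, ∀ v ∈ insert w T, m7.D 2 (I.idx u v) = I.compl u v)) ?_ ?_ ?_))
        fun m7 hF7 h7 => (runs_primKey (T := insert w T) (w := w) ?_ ?_ (by simp) h7.1 ?_).mono
          le_rfl fun m8 hF8 h8 => ⟨insert w T, ?_, ?_⟩) ?_
    · have := h5b (I.pos v) (pos_lt v) (by rw [hP.mem, if_neg hv])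
      rw [hF5.D 10 (by decide)]
      exact this
    · exact hS5.frame hF6 (by decide) (by decide)
    · rw [hF6.N 18 (by decide), hw]
    · refine ⟨fun v => ?_, fun u hu v hv => ?_⟩
      · have : m6.N 16 (I.pos v) = if v ∈ T then 1 else 0 := by
          rw [hF6.N 16 (by decide)]; exact hP5.mem v
        by_cases hvw : v = w <;> simp [hvw, this]
      · simp only [setN_D, setD_D, idx_inj]
        rw [Finset.mem_insert] at hu hv
        rcases hu with rfl | hu <;> rcases hv with rfl | hv
        · simp [compl]
        · have : v ≠ u := fun e => hwT (e ▸ hv)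
          simp only [this, and_false, if_false]
          exact (h6.2 v hv).1
        · have : u ≠ v := fun e => hwT (e ▸ hu)
          simp only [this, false_and, if_false]
          rw [(h6.2 u hu).2, compl_symm]
        · have : u ≠ w := fun e => hwT (e ▸ hu)
          simp only [this, false_and, if_false]
          exact h6.1 u hu v hv
    · exact hS5.frame (hF6.append hF7) (by decide) (by decide)
    · rw [(hF6.append hF7).N 18 (by decide), hw]
    · intro v hv
      rw [Finset.mem_insert, not_or] at hv
      obtain ⟨q, hq, h1, h2, h3⟩ := hP5.key v hv.2
      refine ⟨q, Finset.mem_insert_of_mem hq, ?_, ?_, fun z hz hzw => ?_⟩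
      · rw [(hF6.append hF7).N 17 (by decide), h1]
      · rw [(hF6.append hF7).D 10 (by decide), h2]
      · exact h3 z (Finset.mem_of_mem_insert_of_ne hz hzw)
    · rw [Finset.card_insert_of_notMem hwT]
    · have h16 : m8.N 16 = m7.N 16 := hF8.N 16 (by decide)
      have h2' : m8.D 2 = m7.D 2 := hF8.D 2 (by decide)
      constructor
      · rw [h16]; exact h7.1
      · rw [h2']; exact h7.2
      · exact h8
    · simp only [primAdd, Prog.time, NExp.cost, DExp.cost]; omega
  · simp only [BExp.cost, NExp.cost, DExp.cost]; omega

/-- The completion is computed by Prim's algorithm for trees of maximum weight. -/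
def primProg : Prog :=
  .seq (.letN 18 (.lit 0)) <|
  .seq primInit <|
  .seq primAdd <|
  .forN 22 (.sub (.var 10) (.lit 1)) primRound

theorem runs_prim (hI : I.ZFree) {m : Mem} (hS : Setup I m) :
    Runs primProg m (1000 * I.n ^ 2) fun m' =>
      ∀ u v : I.U, m'.D 2 (I.idx u v) = I.compl u v := by
  have h2r := two_mul_r_le I
  have hr1 := I.r_pos
  obtain ⟨o, ho⟩ := exists_pos (I := I) (k := 0) (by omega)
  unfold primProg
  refine Runs.cost_le (Runs.seq (Runs.of_wp (Q := fun m' => m'.N 18 0 = I.pos o) (by simp [ho]))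
    fun m1 hF1 h1 => Runs.seq (runs_primInit (hS.frame hF1 (by decide) (by decide)) h1)
    fun m2 hF2 h2 => Runs.seq (Q := PrimInv I {o}) (Runs.of_wp (wp_primAdd (w := o) ?_ ?_ ?_))
    fun m3 hF3 h3 => Runs.forN (N := I.n - 1) (c := 300 * I.n + 200)
      (fun k m' => ∃ T : Finset I.U, T.card = k + 1 ∧ PrimInv I T m')
      (fun m' hF => ?_) ?_ (by decide) ?_ ?_) ?_
  · exact hS.frame (hF1.append hF2) (by decide) (by decide)
  · rw [hF2.N 18 (by decide), h1]
  · refine ⟨fun v => ?_, fun u hu v hv => ?_, fun v hv => ⟨o, by simp, ?_⟩⟩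
    · simp [h2.1]
    · rw [Finset.mem_singleton] at hu hv
      simp [hu, hv, compl]
    · have hv' : v ≠ o := by simpa using hv
      simpa [hv'] using h2.2 v
  · have hFF := ((hF1.append hF2).append hF3).append hF
    simp [hFF.N 10 (by decide), hS.n]
  · exact ⟨{o}, by simp, h3.mem, h3.tab, h3.key⟩
  · rintro k m4 hk hF4 hik ⟨T, hT, hP⟩
    have hS4 := hS.frame (((hF1.append hF2).append hF3).append hF4) (by decide) (by decide)
    refine (runs_primRound hI hS4 hP (by omega)).mono le_rfl ?_
    rintro m5 - ⟨T', hT', hP'⟩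
    exact ⟨T', by rw [hT', hT], hP'.mem, hP'.tab, hP'.key⟩
  · rintro m' - - ⟨T, hT, hP⟩ u v
    have : T = Finset.univ := by
      rw [← Finset.card_eq_iff_eq_univ, hT, card_U]; omega
    exact hP.tab u (by simp [this]) v (by simp [this])
  · simp only [primAdd, Prog.time, NExp.cost, DExp.cost]
    have hn : 2 ≤ I.n := by omega
    obtain ⟨n', hn'⟩ := Nat.exists_eq_add_of_le hn
    rw [hn', show 2 + n' - 1 = n' + 1 by omega]
    nlinarith

end BinaryVCSP

/-! ## Implementation of the second step -/

namespace BinaryVCSP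

open RAM

variable {I : BinaryVCSP}

/-- `N 25` marks the chosen set, `D 12` holds marginal costs with respect to it. Updating them after
each choice makes a round `O(n)`. -/
def greedyInit : Prog :=
  .forN 21 (.var 10) (.seq (.setD 12 (.var 21) (.get 0 (.var 21))) (.setN 25 (.var 21) (.lit 0)))

def greedyUpdate : Prog :=
  .forN 21 (.var 10) (.setD 12 (.var 21)
    (.add (.get 12 (.var 21)) (.get 2 (.add (.get 13 (.var 18)) (.var 21)))))

def greedyRound : Prog :=
  .seq (scanProg 25 (.not (.dle (.get 12 (.var 18)) (.get 12 (.var 21))))) <|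
  .seq (.seq (.setN 2 (.var 22) (.var 18)) <|
    .seq (.letD 13 (.add (.var 13) (.get 12 (.var 18)))) (.setN 25 (.var 18) (.lit 1)))
    greedyUpdate

def greedyProg : Prog :=
  .seq greedyInit <| .seq (.letD 13 .zero) <| .forN 22 (.var 0) greedyRound

/-- The completion is stored in the table `D 2`. -/
def Table (I : BinaryVCSP) (m : Mem) : Prop := ∀ u v : I.U, m.D 2 (I.idx u v) = I.compl u v

theorem Table.frame {m m' : Mem} {wN wD : List ℕ} (h : Table I m) (hF : Frame wN wD m m')
    (hD : 2 ∉ wD) : Table I m' := by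
  unfold Table
  rw [hF.D 2 hD]
  exact h

/-- The state of the greedy algorithm after the choice of `G 0, …, G (k - 1)`. -/
structure GreedyInv (I : BinaryVCSP) (k : ℕ) (G : ℕ → I.U) (m : Mem) : Prop where
  card : ((Finset.range k).image G).card = k
  out : ∀ j < k, m.N 2 j = I.pos (G j)
  mem : ∀ v, m.N 25 (I.pos v) = if v ∈ (Finset.range k).image G then 1 else 0
  cost : ∀ v, v ∉ (Finset.range k).image G →
    m.D 12 (I.pos v) = I.marginal I.compl v ((Finset.range k).image G)
  total : m.D 13 0 = I.fbar I.compl ((Finset.range k).image G)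
  greedy : ∀ j < k, G j ∉ (Finset.range j).image G ∧ ∀ v, v ∉ (Finset.range j).image G →
    I.fbar I.compl (insert (G j) ((Finset.range j).image G)) ≤
      I.fbar I.compl (insert v ((Finset.range j).image G))

theorem runs_greedyInit {m : Mem} (hS : Setup I m) :
    Runs greedyInit m (100 * I.n + 20) fun m' => (∀ v : I.U, m'.N 25 (I.pos v) = 0) ∧
      ∀ v : I.U, m'.D 12 (I.pos v) = ((I.un v.1 v.2 : ℝ) : WithTop ℝ) := by
  unfold greedyInit
  refine Runs.forN_wp (N := I.n) (fun k m' => ∀ v : I.U, (I.pos v : ℕ) < k →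
    m'.N 25 (I.pos v) = 0 ∧ m'.D 12 (I.pos v) = ((I.un v.1 v.2 : ℝ) : WithTop ℝ))
    (fun m' hF => ?_) ?_ (by decide) ?_ ?_ ?_
  · simp [hF.N 10 (by decide), hS.n]
  · simp only [Prog.time, NExp.cost, DExp.cost]; omega
  · simp
  · rintro k m' hk hF hik hI
    obtain ⟨u, rfl⟩ := exists_pos hk
    have hS' := hS.frame hF (by decide) (by decide)
    simp only [Prog.wp, NExp.eval, DExp.eval, hik, hS'.un]
    intro v hv
    by_cases h1 : v = u
    · subst h1; simp [hik]
    · have := hI v (lt_of_le_of_ne (Nat.lt_succ_iff.1 hv) (pos_ne h1))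
      simpa [h1, hik] using this
  · rintro m' - - hI
    exact ⟨fun v => (hI v (pos_lt v)).1, fun v => (hI v (pos_lt v)).2⟩

theorem runs_greedyUpdate {m : Mem} (hS : Setup I m) (hT : Table I m) {w : I.U}
    (hw : m.N 18 0 = I.pos w) : Runs greedyUpdate m (100 * I.n + 20) fun m' =>
      ∀ v, m'.D 12 (I.pos v) = m.D 12 (I.pos v) + I.compl w v := by
  unfold greedyUpdate
  refine Runs.forN_wp (N := I.n) (fun k m' => ∀ v : I.U,
    m'.D 12 (I.pos v) = if (I.pos v : ℕ) < k then m.D 12 (I.pos v) + I.compl w v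
      else m.D 12 (I.pos v)) (fun m' hF => ?_) ?_ (by decide) ?_ ?_ ?_
  · simp [hF.N 10 (by decide), hS.n]
  · simp only [Prog.time, NExp.cost, DExp.cost]; omega
  · simp
  · rintro k m' hk hF hik hI
    obtain ⟨u, rfl⟩ := exists_pos hk
    have hS' := hS.frame hF (by decide) (by decide)
    have hT' := hT.frame hF (by decide)
    have hw' : m'.N 18 0 = I.pos w := by rw [hF.N 18 (by decide), hw]
    have htab : m'.D 2 (I.pos w * I.n + I.pos u) = I.compl w u := hT' w u
    have hu := hI u
    rw [if_neg (lt_irrefl _)] at hu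
    simp only [Prog.wp, NExp.eval, DExp.eval, hik, hw', hS'.off, htab, hu]
    intro v
    by_cases h1 : v = u
    · simp [h1]
    · have h2 : (I.pos v : ℕ) < I.pos u + 1 ↔ (I.pos v : ℕ) < I.pos u := by
        have := pos_ne h1; omega
      simp only [setD_D, setN_D, pos_eq_iff, h1, if_false, h2]
      exact hI v
  · rintro m' - - hI v
    rw [hI v, if_pos (pos_lt v)]

theorem image_update {α : Type} [DecidableEq α] (G : ℕ → α) {j k : ℕ} (w : α) (h : j ≤ k) :
    (Finset.range j).image (Function.update G k w) = (Finset.range j).image G := by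
  refine Finset.image_congr fun i hi => Function.update_of_ne ?_ _ _
  rw [Finset.mem_coe, Finset.mem_range] at hi
  omega

theorem image_update_succ {α : Type} [DecidableEq α] (G : ℕ → α) {k : ℕ} (w : α) :
    (Finset.range (k + 1)).image (Function.update G k w) =
      insert w ((Finset.range k).image G) := by
  rw [Finset.range_add_one, Finset.image_insert, image_update G w le_rfl, Function.update_self]

/-- Adding an element raises `fbar` by its marginal cost, so a smallest marginal is an admissible
choice, even if the current value is infinite. Marginals of chosen elements are spoiled by the
diagonal of the table, but the scan excludes them. -/
theorem runs_greedyRound {m : Mem} {k : ℕ} {G : ℕ → I.U} (hS : Setup I m) (hT : Table I m)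
    (hk : k < I.r) (h22 : m.N 22 0 = k) (hG : GreedyInv I k G m) :
    Runs greedyRound m (200 * I.n + 200) fun m' => ∃ G', GreedyInv I (k + 1) G' m' := by
  have h2r := two_mul_r_le I
  obtain ⟨v₀, hv₀⟩ : ∃ v, v ∉ (Finset.range k).image G := by
    by_contra hcon
    push Not at hcon
    have := hG.card
    rw [Finset.eq_univ_of_forall hcon, Finset.card_univ, card_U] at this
    omega
  unfold greedyRound
  refine Runs.cost_le (Runs.seq (runs_scan (fun i => m.D 12 i) hS.n
    ⟨I.pos v₀, pos_lt v₀, by rw [hG.mem, if_neg hv₀]⟩ (by decide) (fun m' hF => ?_))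
    fun m5 hF5 h5 => (?_ : Runs _ _ (100 * I.n + 120) _)) ?_
  · simp [hF.D 12 (by decide)]
  · obtain ⟨hlt, h5a, h5b⟩ := h5
    obtain ⟨w, hw⟩ := exists_pos hlt
    rw [← hw] at h5a h5b
    have hwX : w ∉ (Finset.range k).image G := by
      intro hwX
      rw [hG.mem, if_pos hwX] at h5a
      exact one_ne_zero h5a
    have e22 : m5.N 22 0 = k := by rw [hF5.N 22 (by decide), h22]
    have e13 : m5.D 13 = m.D 13 := hF5.D 13 (by decide)
    have e12 : m5.D 12 = m.D 12 := hF5.D 12 (by decide)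
    have e25 : m5.N 25 = m.N 25 := hF5.N 25 (by decide)
    have e2 : m5.N 2 = m.N 2 := hF5.N 2 (by decide)
    refine Runs.cost_le (Runs.seq (Runs.of_wp
      (Q := fun m6 => m6.N 18 0 = I.pos w ∧
        (∀ j < k + 1, m6.N 2 j = I.pos (Function.update G k w j)) ∧
        m6.D 13 0 = I.fbar I.compl (insert w ((Finset.range k).image G)) ∧
        (∀ v, m6.N 25 (I.pos v) = if v ∈ insert w ((Finset.range k).image G) then 1 else 0)) ?_)
      fun m6 hF6 h6 => (runs_greedyUpdate (w := w)
        (hS.frame (hF5.append hF6) (by decide) (by decide))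
        (hT.frame (hF5.append hF6) (by decide)) ?_).mono le_rfl
          fun m7 hF7 h7 => ⟨Function.update G k w, ?_, ?_, ?_, ?_, ?_, ?_⟩) ?_
    · simp only [Prog.wp, NExp.eval, DExp.eval, hw.symm, e22]
      refine ⟨by simp [hw.symm], fun j hj => ?_, ?_, fun v => ?_⟩
      · by_cases hjk : j = k
        · simp [hjk]
        · simp [hjk, e2, hG.out j (by omega)]
      · simp [hw.symm, e13, e12, hG.total, hG.cost w hwX, fbar_insert compl_symm hwX]
      · by_cases hvw : v = w
        · simp [hvw, hw.symm]
        · simp only [setD_N, setN_N, setN_N_of_ne, ne_eq, Nat.reduceEqDiff, not_false_eq_true,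
            hw.symm, pos_eq_iff, hvw, if_false, e25, hG.mem, Finset.mem_insert, false_or]
    · exact h6.1
    · rw [image_update_succ, Finset.card_insert_of_notMem hwX, hG.card]
    · rw [hF7.N 2 (by decide)]; exact h6.2.1
    · rw [image_update_succ, hF7.N 25 (by decide)]; exact h6.2.2.2
    · intro v hv
      rw [image_update_succ] at hv ⊢
      rw [Finset.mem_insert, not_or] at hv
      rw [h7 v, hF6.D 12 (by decide), e12, hG.cost v hv.2, marginal, marginal,
        Finset.sum_insert hwX, compl_symm w v]
      abel
    · rw [image_update_succ, hF7.D 13 (by decide)]; exact h6.2.2.1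
    · intro j hj
      rw [image_update G w (Nat.lt_succ_iff.1 hj)]
      by_cases hjk : j = k
      · subst hjk
        rw [Function.update_self]
        refine ⟨hwX, fun v hv => ?_⟩
        rw [fbar_insert compl_symm hwX, fbar_insert compl_symm hv]
        refine add_le_add le_rfl ?_
        rw [← hG.cost w hwX, ← hG.cost v hv]
        exact h5b _ (pos_lt v) (by rw [hG.mem, if_neg hv])
      · rw [Function.update_of_ne hjk]
        exact hG.greedy j (by omega)
    · simp only [Prog.time, NExp.cost, DExp.cost]; omega
  · simp only [BExp.cost, NExp.cost, DExp.cost]; omega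

theorem runs_greedy {m : Mem} (hS : Setup I m) (hT : Table I m) :
    Runs greedyProg m (1000 * (I.n * I.r)) fun m' => ∃ g : Fin I.r → I.U, I.IsGreedy I.compl g ∧
      (∀ k : Fin I.r, m'.N 2 k = I.pos (g k)) ∧
      (∀ v, m'.N 25 (I.pos v) = if v ∈ Finset.univ.image g then 1 else 0) ∧
      m'.D 13 0 = I.fbar I.compl (Finset.univ.image g) := by
  have h2r := two_mul_r_le I
  have hr1 := I.r_pos
  obtain ⟨o, -⟩ := exists_pos (I := I) (k := 0) (by omega)
  unfold greedyProg
  refine Runs.cost_le (Runs.seq (runs_greedyInit hS) fun m1 hF1 h1 =>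
    Runs.seq (Runs.of_wp (Q := fun m' => m'.D 13 0 = 0) (by simp)) fun m2 hF2 h2 =>
    Runs.forN (N := I.r) (c := 200 * I.n + 200) (fun k m' => ∃ G, GreedyInv I k G m')
    (fun m' hF => ?_) ?_ (by decide) ?_ ?_) ?_
  · have hFF := (hF1.append hF2).append hF
    simp [hFF.N 0 (by decide), hS.r]
  · refine ⟨fun _ => o, by simp, by simp, fun v => ?_, fun v _ => ?_, ?_, by simp⟩
    · have : m2.N 25 = m1.N 25 := hF2.N 25 (by decide)
      simp [this, h1.1]
    · have : m2.D 12 = m1.D 12 := hF2.D 12 (by decide)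
      simp [this, h1.2, marginal]
    · simp [h2]
  · rintro k m3 hk hF3 hik ⟨G, hG⟩
    have hFF := (hF1.append hF2).append hF3
    refine (runs_greedyRound (hS.frame hFF (by decide) (by decide)) (hT.frame hFF (by decide)) hk
      hik hG).mono le_rfl ?_
    rintro m4 - ⟨G', h4⟩
    exact ⟨G', h4.card, h4.out, h4.mem, h4.cost, h4.total, h4.greedy⟩
  · rintro m3 - - ⟨G, hG⟩
    have himg : Finset.univ.image (fun k : Fin I.r => G k) = (Finset.range I.r).image G := by
      ext v
      simp only [Finset.mem_image, Finset.mem_univ, true_and, Finset.mem_range]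
      exact ⟨fun ⟨k, hk⟩ => ⟨k, k.2, hk⟩, fun ⟨k, hk, hv⟩ => ⟨⟨k, hk⟩, hv⟩⟩
    refine ⟨fun k => G k, fun k => ?_, fun k => hG.out k k.2, ?_, ?_⟩
    · have hpre : I.greedyPrefix (fun k : Fin I.r => G k) k = (Finset.range k).image G := by
        unfold greedyPrefix
        ext v
        simp only [Finset.mem_image, Finset.mem_Iio, Finset.mem_range, Fin.lt_def]
        exact ⟨fun ⟨i, hi, hv⟩ => ⟨i, hi, hv⟩, fun ⟨i, hi, hv⟩ => ⟨⟨i, hi.trans k.2⟩, hi, hv⟩⟩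
      rw [hpre]
      exact hG.greedy k k.2
    · rw [himg]; exact hG.mem
    · rw [himg]; exact hG.total
  · simp only [Prog.time, NExp.cost, DExp.cost]
    nlinarith [Nat.mul_le_mul hr1 h2r]

end BinaryVCSP

/-! ## Representation of the state of the third step -/

namespace BinaryVCSP

open RAM

variable {I : BinaryVCSP}

theorem Vertex.pos_lt (v : Vertex I) : v.pos < I.n + 2 := by
  cases v with
  | s => simp [Vertex.pos]
  | t => simp [Vertex.pos]
  | el u => have := BinaryVCSP.pos_lt u; simp only [Vertex.pos]; omega

@[simp] theorem Vertex.pos_eq_iff {v w : Vertex I} : v.pos = w.pos ↔ v = w := by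
  refine ⟨fun h => ?_, fun h => by rw [h]⟩
  cases v with
  | s =>
    cases w with
    | s => rfl
    | t => simp [Vertex.pos] at h
    | el u => have := BinaryVCSP.pos_lt u; simp only [Vertex.pos] at h; omega
  | t =>
    cases w with
    | s => simp [Vertex.pos] at h
    | t => rfl
    | el u => have := BinaryVCSP.pos_lt u; simp only [Vertex.pos] at h; omega
  | el u =>
    have := BinaryVCSP.pos_lt u
    cases w with
    | s => simp only [Vertex.pos] at h; omega
    | t => simp only [Vertex.pos] at h; omega
    | el u' => simp only [Vertex.pos] at h; rw [pos_inj h]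

theorem exists_vpos {k : ℕ} (hk : k < I.n + 2) : ∃ v : Vertex I, v.pos = k := by
  by_cases h1 : k < I.n
  · obtain ⟨u, hu⟩ := exists_pos h1
    exact ⟨.el u, hu⟩
  · by_cases h2 : k = I.n
    · exact ⟨.s, h2.symm⟩
    · exact ⟨.t, by simp only [Vertex.pos]; omega⟩

/-- The current state of Step 3 is stored in `N 25`, `N 26` and `D 16`. -/
structure StateMem (S : State I) (m : Mem) : Prop where
  X : ∀ v, m.N 25 (I.pos v) = if v ∈ S.X then 1 else 0
  Y : ∀ v, m.N 26 (I.pos v) = if v ∈ S.Y then 1 else 0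
  p : ∀ v : Vertex I, m.D 16 v.pos = ((S.p v : ℝ) : WithTop ℝ)

theorem StateMem.frame {S : State I} {m m' : Mem} {wN wD : List ℕ} (h : StateMem S m)
    (hF : Frame wN wD m m') (hN : ∀ a ∈ [25, 26], a ∉ wN) (hD : 16 ∉ wD) : StateMem S m' := by
  constructor
  · rw [hF.N 25 (hN 25 (by simp))]; exact h.X
  · rw [hF.N 26 (hN 26 (by simp))]; exact h.Y
  · rw [hF.D 16 hD]; exact h.p

/-- The assignment that gives the first value to every variable. -/
def firstValues (I : BinaryVCSP) : I.Assignment := fun i => ⟨0, by have := I.two_le_d i; omega⟩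

/-- `N 36` is the flag for termination, set at once if the greedy value in `D 13` is infinite. `N
37` and `N 38` are the beginnings of the current rows of the record, kept in cells because products
are not available. -/
def initProg : Prog :=
  .seq (.forN 21 (.var 10) (.setN 26 (.var 21) (.lit 0))) <|
  .seq (.forN 21 (.var 0) (.setN 26 (.get 11 (.var 21)) (.lit 1))) <|
  .seq (.forN 21 (.add (.var 10) (.lit 2)) (.setD 16 (.var 21) .zero)) <|
  .seq (.letN 3 (.lit 0)) <|
  .seq (.letN 37 (.lit 0)) <|
  .seq (.letN 38 (.lit 0)) <|
  .ite (.dle .top (.var 13)) (.letN 36 (.lit 1)) (.letN 36 (.lit 0))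

theorem runs_init {m : Mem} (hS : Setup I m) :
    Runs initProg m (200 * I.n) fun m' =>
      (∀ v, m'.N 26 (I.pos v) = if v ∈ I.vec I.firstValues then 1 else 0) ∧
      (∀ v : Vertex I, m'.D 16 v.pos = 0) ∧ m'.N 3 0 = 0 ∧ m'.N 37 0 = 0 ∧ m'.N 38 0 = 0 ∧
      (m.D 13 0 = ⊤ → m'.N 36 0 = 1) ∧ (m.D 13 0 ≠ ⊤ → m'.N 36 0 = 0) := by
  have h2r := two_mul_r_le I
  have hr1 := I.r_pos
  unfold initProg
  refine Runs.cost_le (Runs.seq (Runs.forN_wp (N := I.n) (c := 20 * I.n + 20)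
    (Q := fun m' => ∀ v : I.U, m'.N 26 (I.pos v) = 0)
    (fun k m' => ∀ v : I.U, (I.pos v : ℕ) < k → m'.N 26 (I.pos v) = 0)
    (fun m' hF => ?_) ?_ (by decide) ?_ ?_ ?_) fun m1 hF1 h1 =>
    Runs.seq (Runs.forN_wp (N := I.r) (c := 20 * I.n + 20)
    (Q := fun m' => ∀ v : I.U, m'.N 26 (I.pos v) = if (v.2 : ℕ) = 0 then 1 else 0)
    (fun k m' => ∀ v : I.U, m'.N 26 (I.pos v) = if (v.2 : ℕ) = 0 ∧ (v.1 : ℕ) < k then 1 else 0)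
    (fun m' hF => ?_) ?_ (by decide) ?_ ?_ ?_) fun m2 hF2 h2 =>
    Runs.seq (Runs.forN_wp (N := I.n + 2) (c := 20 * I.n + 80)
    (Q := fun m' => ∀ i < I.n + 2, m'.D 16 i = 0) (fun k m' => ∀ i < k, m'.D 16 i = 0)
    (fun m' hF => ?_) ?_ (by decide) ?_ ?_ ?_) fun m3 hF3 h3 =>
    Runs.of_wp ?_) ?_
  · simp [hF.N 10 (by decide), hS.n]
  · simp only [Prog.time, NExp.cost]; omega
  · simp
  · rintro k m' hk hF hik hI
    simp only [Prog.wp, NExp.eval, hik]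
    intro v hv
    simp only [ne_eq, Nat.reduceEqDiff, not_false_eq_true, setN_N_of_ne, setN_N]
    split_ifs with h1
    · rfl
    · exact hI v (by omega)
  · rintro m' - - hI v
    exact hI v (BinaryVCSP.pos_lt v)
  · simp [(hF1.append hF).N 0 (by decide), hS.r]
  · simp only [Prog.time, NExp.cost]; omega
  · simp [h1]
  · rintro k m' hk hF hik hI
    have hst : m'.N 11 k = I.pos ⟨⟨k, hk⟩, I.firstValues ⟨k, hk⟩⟩ := by
      rw [(hF1.append hF).N 11 (by decide), pos_val]
      exact hS.start ⟨k, hk⟩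
    simp only [Prog.wp, NExp.eval, hik, hst]
    intro v
    simp only [ne_eq, Nat.reduceEqDiff, not_false_eq_true, setN_N_of_ne, setN_N, pos_eq_iff]
    by_cases h4 : v = ⟨⟨k, hk⟩, I.firstValues ⟨k, hk⟩⟩
    · subst h4; simp [firstValues]
    · rw [if_neg h4, hI v]
      congr 1
      apply propext
      constructor
      · rintro ⟨h5, h6⟩; exact ⟨h5, by omega⟩
      · rintro ⟨h5, h6⟩
        refine ⟨h5, lt_of_le_of_ne (Nat.lt_succ_iff.1 h6) fun h7 => h4 ?_⟩
        obtain ⟨i, a⟩ := v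
        simp only at h5 h7
        obtain rfl : i = ⟨k, hk⟩ := Fin.ext h7
        congr 1
        exact Fin.ext h5
  · rintro m' - - hI v
    rw [hI v]
    simp [v.1.2]
  · simp [((hF1.append hF2).append hF).N 10 (by decide), hS.n]
  · simp only [Prog.time, NExp.cost, DExp.cost]; omega
  · simp
  · rintro k m' hk hF hik hI
    simp only [Prog.wp, NExp.eval, hik]
    intro i hi
    simp only [setN_D, setD_D, DExp.eval]
    split_ifs with h1
    · rfl
    · exact hI i (by omega)
  · rintro m' - - hI
    exact hI
  · have h26 : m3.N 26 = m2.N 26 := hF3.N 26 (by decide)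
    have h13 : m3.D 13 = m.D 13 := ((hF1.append hF2).append hF3).D 13 (by decide)
    have hY : ∀ v : I.U, m3.N 26 (I.pos v) = if v ∈ I.vec I.firstValues then 1 else 0 := by
      intro v
      rw [h26, h2 v]
      congr 1
      rw [mem_vec, Fin.ext_iff]
      simp [firstValues, eq_comm]
    have hp : ∀ v : Vertex I, m3.D 16 v.pos = 0 := fun v => h3 _ v.pos_lt
    constructor <;> intro h <;> simp [h13] at h <;> simp [h, hY, hp]
  · simp only [Prog.time, NExp.cost, BExp.cost, DExp.cost]; omega

/-- The current state is copied to the record. -/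
def recordProg : Prog :=
  .seq (.forN 21 (.var 10) <|
    .seq (.setN 4 (.add (.var 37) (.var 21)) (.get 25 (.var 21))) <|
    .setN 5 (.add (.var 37) (.var 21)) (.get 26 (.var 21))) <|
  .forN 21 (.add (.var 10) (.lit 2)) <|
    .setD 3 (.add (.var 38) (.var 21)) (.get 16 (.var 21))

/-- The statement includes that all cells before the current rows survive, which protects the record
of earlier iterations. -/
theorem runs_record {m : Mem} (hS : Setup I m) {a b : ℕ} (ha : m.N 37 0 = a)
    (hb : m.N 38 0 = b) : Runs recordProg m (200 * I.n) fun m' =>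
      (∀ i < a, m'.N 4 i = m.N 4 i) ∧ (∀ i < a, m'.N 5 i = m.N 5 i) ∧
      (∀ i < b, m'.D 3 i = m.D 3 i) ∧ (∀ j < I.n, m'.N 4 (a + j) = m.N 25 j) ∧
      (∀ j < I.n, m'.N 5 (a + j) = m.N 26 j) ∧ ∀ j < I.n + 2, m'.D 3 (b + j) = m.D 16 j := by
  have h2r := two_mul_r_le I
  have hr1 := I.r_pos
  unfold recordProg
  refine Runs.cost_le (Runs.seq (Runs.forN_wp (N := I.n) (c := 40 * I.n + 20)
    (Q := fun m' => (∀ i < a, m'.N 4 i = m.N 4 i) ∧ (∀ i < a, m'.N 5 i = m.N 5 i) ∧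
      (∀ j < I.n, m'.N 4 (a + j) = m.N 25 j) ∧ (∀ j < I.n, m'.N 5 (a + j) = m.N 26 j))
    (fun k m' => (∀ i < a, m'.N 4 i = m.N 4 i) ∧ (∀ i < a, m'.N 5 i = m.N 5 i) ∧
      (∀ j < k, m'.N 4 (a + j) = m.N 25 j) ∧ (∀ j < k, m'.N 5 (a + j) = m.N 26 j))
    (fun m' hF => ?_) ?_ (by decide) ?_ ?_ ?_) fun m1 hF1 h1 => Runs.forN_wp (N := I.n + 2)
    (c := 40 * I.n + 100) (fun k m' => (∀ i < b, m'.D 3 i = m.D 3 i) ∧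
      ∀ j < k, m'.D 3 (b + j) = m.D 16 j)
    (fun m' hF => ?_) ?_ (by decide) ?_ ?_ ?_) ?_
  · simp [hF.N 10 (by decide), hS.n]
  · simp only [Prog.time, NExp.cost]; omega
  · simp
  · rintro k m' hk hF hik ⟨hI1, hI2, hI3, hI4⟩
    have h37 : m'.N 37 0 = a := by rw [hF.N 37 (by decide), ha]
    have h25 : m'.N 25 = m.N 25 := hF.N 25 (by decide)
    have h26 : m'.N 26 = m.N 26 := hF.N 26 (by decide)
    simp [hik, h37, h25, h26]
    refine ⟨fun i hi => ?_, fun i hi => ?_, fun j hj => ?_, fun j hj => ?_⟩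
    · rw [if_neg (by omega)]; exact hI1 i hi
    · rw [if_neg (by omega)]; exact hI2 i hi
    · split_ifs with h
      · rw [h]
      · exact hI3 j (by omega)
    · split_ifs with h
      · rw [h]
      · exact hI4 j (by omega)
  · rintro m' - - hI
    exact hI
  · simp [(hF1.append hF).N 10 (by decide), hS.n]
  · simp only [Prog.time, NExp.cost, DExp.cost]; omega
  · simp [hF1.D 3 (by decide)]
  · rintro k m' hk hF hik ⟨hI1, hI2⟩
    have h38 : m'.N 38 0 = b := by rw [(hF1.append hF).N 38 (by decide), hb]
    have h16 : m'.D 16 = m.D 16 := (hF1.append hF).D 16 (by decide)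
    simp [hik, h38, h16]
    refine ⟨fun i hi => ?_, fun j hj => ?_⟩
    · rw [if_neg (by omega)]; exact hI1 i hi
    · split_ifs with h
      · rw [h]
      · exact hI2 j (by omega)
  · rintro m' hF - ⟨hI1, hI2⟩
    have h4 : m'.N 4 = m1.N 4 := hF.N 4 (by decide)
    have h5 : m'.N 5 = m1.N 5 := hF.N 5 (by decide)
    rw [h4, h5]
    exact ⟨h1.1, h1.2.1, hI1, h1.2.2.1, h1.2.2.2, hI2⟩
  · omega

/-- The elements of `X` are listed in `N 27`, the element of `Y` that belongs to each variable in
`N 28`, and `N 40` tells whether `X` and `Y` differ. -/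
def listProg : Prog :=
  .seq (.letN 39 (.lit 0)) <|
  .seq (.letN 40 (.lit 0)) <|
  .forN 21 (.var 10) <|
    .seq (.ite (.neq (.get 25 (.var 21)) (.lit 1))
      (.seq (.setN 27 (.var 39) (.var 21)) (.letN 39 (.add (.var 39) (.lit 1)))) .skip) <|
    .seq (.ite (.neq (.get 26 (.var 21)) (.lit 1))
      (.setN 28 (.get 12 (.var 21)) (.var 21)) .skip) <|
    .ite (.neq (.get 25 (.var 21)) (.get 26 (.var 21))) .skip (.letN 40 (.lit 1))

/-- The lists computed by `listProg`. -/
structure Lists (S : State I) (xl : ℕ → I.U) (m : Mem) : Prop where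
  list : ∀ j < I.r, m.N 27 j = I.pos (xl j)
  image : (Finset.range I.r).image xl = S.X
  yl : ∀ u ∈ S.Y, m.N 28 u.1 = I.pos u

theorem IsFeasible.eq_of_fst {Y : Finset I.U} (hY : I.IsFeasible Y) {u v : I.U} (hu : u ∈ Y)
    (hv : v ∈ Y) (h : u.1 = v.1) : u = v := by
  obtain ⟨x, rfl⟩ := hY
  rw [mem_vec] at hu hv
  obtain ⟨i, a⟩ := u
  obtain ⟨j, b⟩ := v
  dsimp only at *
  subst h
  rw [← hu, ← hv]

theorem runs_list {m : Mem} {S : State I} (hS : Setup I m) (hM : StateMem S m)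
    (hX : S.X.card = I.r) (hY : I.IsFeasible S.Y) :
    Runs listProg m (200 * I.n) fun m' =>
      (∃ xl, Lists S xl m') ∧ (m'.N 40 0 = 0 ↔ S.X = S.Y) := by
  have h2r := two_mul_r_le I
  have hr1 := I.r_pos
  obtain ⟨o, -⟩ := exists_pos (I := I) (k := 0) (by omega)
  unfold listProg
  refine Runs.cost_le (Runs.seq (Runs.of_wp (Q := fun m' => m'.N 39 0 = 0) (by simp))
    fun m1 hF1 h1 => Runs.seq (Runs.of_wp (Q := fun m' => m'.N 40 0 = 0 ∧ m'.N 39 0 = 0)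
    (by simp [h1])) fun m2 hF2 h2 => Runs.forN_wp (N := I.n) (c := 80 * I.n + 20)
    (fun k m' => (∃ xl : ℕ → I.U, (∀ j < m'.N 39 0, m'.N 27 j = I.pos (xl j)) ∧
        m'.N 39 0 = (S.X.filter fun u => (I.pos u : ℕ) < k).card ∧
        (Finset.range (m'.N 39 0)).image xl = S.X.filter fun u => (I.pos u : ℕ) < k) ∧
      (∀ u ∈ S.Y, (I.pos u : ℕ) < k → m'.N 28 u.1 = I.pos u) ∧
      (m'.N 40 0 = 0 ↔ ∀ u, (I.pos u : ℕ) < k → (u ∈ S.X ↔ u ∈ S.Y)))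
    (fun m' hF => ?_) ?_ (by decide) ?_ ?_ ?_) ?_
  · simp [((hF1.append hF2).append hF).N 10 (by decide), hS.n]
  · simp only [Prog.time, NExp.cost, BExp.cost]; omega
  · exact ⟨⟨fun _ => o, by simp [h2], by simp [h2], by simp [h2]⟩, by simp, by simp [h2]⟩
  · rintro k m' hk hF hik ⟨⟨xl, hx1, hx2, hx3⟩, hI2, hI3⟩
    obtain ⟨u, rfl⟩ := exists_pos hk
    have hFF := (hF1.append hF2).append hF
    have hS' := hS.frame hFF (by decide) (by decide)
    have hM' := hM.frame hFF (by decide) (by decide)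
    have hlt : ∀ {v : I.U}, (I.pos v : ℕ) < I.pos u + 1 ↔ v = u ∨ (I.pos v : ℕ) < I.pos u := by
      intro v
      rw [← pos_eq_iff]
      omega
    have hfil : (S.X.filter fun v => (I.pos v : ℕ) < I.pos u + 1) =
        if u ∈ S.X then insert u (S.X.filter fun v => (I.pos v : ℕ) < I.pos u)
        else S.X.filter fun v => (I.pos v : ℕ) < I.pos u := by
      ext v
      split_ifs with hu <;> simp only [Finset.mem_filter, Finset.mem_insert, hlt]
      · by_cases hv : v = u <;> simp [hv, hu]
      · by_cases hv : v = u <;> simp [hv, hu]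
    have hnot : u ∉ S.X.filter fun v => (I.pos v : ℕ) < I.pos u := by simp
    have hall : (∀ v, (I.pos v : ℕ) < I.pos u + 1 → (v ∈ S.X ↔ v ∈ S.Y)) ↔
        (u ∈ S.X ↔ u ∈ S.Y) ∧ ∀ v, (I.pos v : ℕ) < I.pos u → (v ∈ S.X ↔ v ∈ S.Y) := by
      simp only [hlt, forall_eq_or_imp]
    have hxl : u ∈ S.X → ∃ xl : ℕ → I.U, (∀ j < m'.N 39 0 + 1,
        (if j = m'.N 39 0 then (I.pos u : ℕ) else m'.N 27 j) = I.pos (xl j)) ∧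
        m'.N 39 0 + 1 = (S.X.filter fun v => (I.pos v : ℕ) < I.pos u + 1).card ∧
        (Finset.range (m'.N 39 0 + 1)).image xl =
          S.X.filter fun v => (I.pos v : ℕ) < I.pos u + 1 := by
      intro hu
      refine ⟨Function.update xl (m'.N 39 0) u, fun j hj => ?_, ?_, ?_⟩
      · split_ifs with hj'
        · rw [hj', Function.update_self]
        · rw [Function.update_of_ne hj']; exact hx1 j (by omega)
      · rw [hfil, if_pos hu, Finset.card_insert_of_notMem hnot, hx2]
      · rw [hfil, if_pos hu, image_update_succ, hx3]
    have hxl' : u ∉ S.X → ∃ xl : ℕ → I.U, (∀ j < m'.N 39 0, m'.N 27 j = I.pos (xl j)) ∧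
        m'.N 39 0 = (S.X.filter fun v => (I.pos v : ℕ) < I.pos u + 1).card ∧
        (Finset.range (m'.N 39 0)).image xl =
          S.X.filter fun v => (I.pos v : ℕ) < I.pos u + 1 := by
      intro hu
      rw [hfil, if_neg hu]
      exact ⟨xl, hx1, hx2, hx3⟩
    have hyl : u ∈ S.Y → ∀ v ∈ S.Y, (I.pos v : ℕ) < I.pos u + 1 →
        (if (v.1 : ℕ) = u.1 then (I.pos u : ℕ) else m'.N 28 v.1) = I.pos v := by
      intro hu v hv hvu
      split_ifs with h
      · rw [hY.eq_of_fst hv hu (Fin.ext h)]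
      · rcases hlt.1 hvu with h' | h'
        · exact absurd (by rw [h']) h
        · exact hI2 v hv h'
    have hyl' : u ∉ S.Y → ∀ v ∈ S.Y, (I.pos v : ℕ) < I.pos u + 1 →
        m'.N 28 v.1 = I.pos v := by
      intro hu v hv hvu
      rcases hlt.1 hvu with h' | h'
      · exact absurd (h' ▸ hv) hu
      · exact hI2 v hv h'
    have e25 := hM'.X u
    have e26 := hM'.Y u
    have e12 := hS'.cls u
    rw [hall]
    by_cases huX : u ∈ S.X <;> by_cases huY : u ∈ S.Y
    · rw [if_pos huX] at e25
      rw [if_pos huY] at e26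
      simp only [Prog.wp, BExp.eval, NExp.eval, hik, e25, e26, e12, setN_N_of_ne, setN_N, ne_eq,
        Nat.reduceEqDiff, not_false_eq_true, le_refl, and_self, forall_const, not_true_eq_false,
        false_implies, and_true, if_true, huX, huY, true_and]
      exact ⟨hxl huX, hyl huY, by simpa using hI3⟩
    · rw [if_pos huX] at e25
      rw [if_neg huY] at e26
      simp only [Prog.wp, BExp.eval, NExp.eval, hik, e25, e26, e12, setN_N_of_ne, setN_N, ne_eq,
        Nat.reduceEqDiff, not_false_eq_true, le_refl, and_self, forall_const, not_true_eq_false,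
        false_implies, and_true, if_true, huX, huY, true_and, nonpos_iff_eq_zero, one_ne_zero,
        zero_le, and_false]
      exact ⟨hxl huX, hyl' huY, by simp⟩
    · rw [if_neg huX] at e25
      rw [if_pos huY] at e26
      simp only [Prog.wp, BExp.eval, NExp.eval, hik, e25, e26, e12, setN_N_of_ne, setN_N, ne_eq,
        Nat.reduceEqDiff, not_false_eq_true, le_refl, and_self, forall_const, not_true_eq_false,
        false_implies, and_true, if_true, huX, huY, true_and, nonpos_iff_eq_zero, one_ne_zero,
        zero_le, and_false]
      exact ⟨hxl' huX, hyl huY, by simp⟩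
    · rw [if_neg huX] at e25
      rw [if_neg huY] at e26
      simp only [Prog.wp, BExp.eval, NExp.eval, hik, e25, e26, e12, setN_N_of_ne, setN_N, ne_eq,
        Nat.reduceEqDiff, not_false_eq_true, le_refl, and_self, forall_const, not_true_eq_false,
        false_implies, and_true, if_true, huX, huY, true_and, nonpos_iff_eq_zero, one_ne_zero,
        zero_le, and_false]
      exact ⟨hxl' huX, hyl' huY, by simpa using hI3⟩
  · rintro m' - - ⟨⟨xl, hx1, hx2, hx3⟩, hI2, hI3⟩
    have hfil : (S.X.filter fun v => (I.pos v : ℕ) < I.n) = S.X :=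
      Finset.filter_true_of_mem fun v _ => BinaryVCSP.pos_lt v
    rw [hfil, hX] at hx2
    rw [hfil, hx2] at hx3
    refine ⟨⟨xl, ?_, hx3, fun u hu => hI2 u hu (BinaryVCSP.pos_lt u)⟩, hI3.trans ?_⟩
    · rw [← hx2]; exact hx1
    · rw [Finset.ext_iff]
      exact ⟨fun h u => h u (BinaryVCSP.pos_lt u), fun h u _ => h u⟩
  · simp only [Prog.time, NExp.cost]; omega

end BinaryVCSP

/-! ## Construction of the auxiliary graph -/

namespace RAM

@[simp] theorem dsub_coe (x y : ℝ) :
    dsub (x : WithTop ℝ) (y : WithTop ℝ) = ((x - y : ℝ) : WithTop ℝ) := by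
  rw [sub_eq_add_neg]; rfl

theorem frame_setN {wN wD : List ℕ} {m : Mem} {a i k : ℕ} (ha : a ∈ wN) :
    Frame wN wD m (m.setN a i k) :=
  ⟨fun _ hb => setN_N_of_ne fun h => hb (h ▸ ha), fun _ _ => rfl⟩

theorem frame_setD {wN wD : List ℕ} {m : Mem} {a i : ℕ} {y : WithTop ℝ} (ha : a ∈ wD) :
    Frame wN wD m (m.setD a i y) :=
  ⟨fun _ _ => rfl, fun _ hb => setD_D_of_ne fun h => hb (h ▸ ha)⟩

end RAM

namespace BinaryVCSP

open RAM

variable {I : BinaryVCSP} {S : State I}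

/-- The code of the kind of an arc. -/
def Arc.kind : Arc I → ℕ
  | .src _ => 0
  | .snk _ => 0
  | .exX _ _ => 1
  | .exY _ _ => 2

/-- The element at which an arc is found when the elements are scanned. -/
def Arc.owner : Arc I → I.U
  | .src u => u
  | .snk v => v
  | .exX _ v => v
  | .exY u _ => u

/-- Entry `i` of the arrays `N 30`, `N 31`, `N 32`, `D 14` describes the arc `e`. -/
structure ArcCode (S : State I) (e : Arc I) (i : ℕ) (m : Mem) : Prop where
  tail : m.N 30 i = e.tail.pos
  head : m.N 31 i = e.head.pos
  kind : m.N 32 i = e.kind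
  len : m.D 14 i = ((I.modLength I.compl S e : ℝ) : WithTop ℝ)

/-- The list of arcs in memory consists of the arcs in `L`. -/
structure ArcList (S : State I) (L : List (Arc I)) (m : Mem) : Prop where
  length : m.N 29 0 = L.length
  code : ∀ i (hi : i < L.length), ArcCode S L[i] i m

theorem ArcList.frame {L : List (Arc I)} {m m' : Mem} {wN wD : List ℕ} (h : ArcList S L m)
    (hF : Frame wN wD m m') (hN : ∀ a ∈ [29, 30, 31, 32], a ∉ wN) (hD : 14 ∉ wD) :
    ArcList S L m' := by
  have e29 := hF.N 29 (hN 29 (by simp))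
  have e30 := hF.N 30 (hN 30 (by simp))
  have e31 := hF.N 31 (hN 31 (by simp))
  have e32 := hF.N 32 (hN 32 (by simp))
  have d14 := hF.D 14 hD
  refine ⟨by rw [e29, h.length], fun i hi => ?_⟩
  have := h.code i hi
  exact ⟨by rw [e30, this.tail], by rw [e31, this.head], by rw [e32, this.kind],
    by rw [d14, this.len]⟩

/-- The list of arcs in memory consists of at most `c` arcs, namely those that satisfy `T`. -/
def ArcMem (S : State I) (T : Arc I → Prop) (c : ℕ) (m : Mem) : Prop :=
  ∃ L : List (Arc I), L.length ≤ c ∧ (∀ e, e ∈ L ↔ I.HasArc I.compl S e ∧ T e) ∧ ArcList S L m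

theorem ArcMem.frame {T : Arc I → Prop} {c : ℕ} {m m' : Mem} {wN wD : List ℕ}
    (h : ArcMem S T c m) (hF : Frame wN wD m m') (hN : ∀ a ∈ [29, 30, 31, 32], a ∉ wN)
    (hD : 14 ∉ wD) : ArcMem S T c m' := by
  obtain ⟨L, h1, h2, h3⟩ := h
  exact ⟨L, h1, h2, h3.frame hF hN hD⟩

theorem ArcMem.congr {T T' : Arc I → Prop} {c c' : ℕ} {m : Mem} (h : ArcMem S T c m)
    (hT : ∀ e, I.HasArc I.compl S e → (T e ↔ T' e)) (hc : c ≤ c') : ArcMem S T' c' m := by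
  obtain ⟨L, h1, h2, h3⟩ := h
  refine ⟨L, h1.trans hc, fun e => (h2 e).trans ⟨?_, ?_⟩, h3⟩
  · rintro ⟨a, b⟩; exact ⟨a, (hT e a).1 b⟩
  · rintro ⟨a, b⟩; exact ⟨a, (hT e a).2 b⟩

def addArc (tail head : NExp) (kind : ℕ) (len : DExp) : Prog :=
  .seq (.setN 30 (.var 29) tail) <|
  .seq (.setN 31 (.var 29) head) <|
  .seq (.setN 32 (.var 29) (.lit kind)) <|
  .seq (.setD 14 (.var 29) len) <|
  .letN 29 (.add (.var 29) (.lit 1))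

/-- The expressions are evaluated after some of the writes; `hev` therefore demands their values in
every memory that differs from `m` only in the arrays `30`, `31`, `32`. -/
theorem wp_addArc {L : List (Arc I)} {e : Arc I} {tail head : NExp} {len : DExp} {m : Mem}
    (hA : ArcList S L m)
    (hev : ∀ m', Frame [30, 31, 32] [] m m' → tail.eval m' = e.tail.pos ∧
      head.eval m' = e.head.pos ∧ len.eval m' = ((I.modLength I.compl S e : ℝ) : WithTop ℝ))
    {Q : Mem → Prop}
    (hQ : ∀ m', Frame [29, 30, 31, 32] [14] m m' → ArcList S (L ++ [e]) m' → Q m') :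
    (addArc tail head e.kind len).wp Q m := by
  have h29 := hA.length
  unfold addArc
  simp only [Prog.wp, NExp.eval]
  have ev0 := hev m (Frame.refl _ _ _)
  rw [ev0.1, h29]
  have ev1 := hev (m.setN 30 L.length e.tail.pos) (frame_setN (by simp))
  simp only [ne_eq, Nat.reduceEqDiff, not_false_eq_true, setN_N_of_ne, h29,
    setD_N, ev1.2.1]
  have ev3 := hev (((m.setN 30 L.length e.tail.pos).setN 31 L.length e.head.pos).setN 32 L.length
    e.kind) (((frame_setN (by simp)).trans (frame_setN (by simp))).trans (frame_setN (by simp)))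
  rw [ev3.2.2]
  refine hQ _ ?_ ⟨by simp, fun i hi => ?_⟩
  · exact ((((frame_setN (by simp)).trans (frame_setN (by simp))).trans
      (frame_setN (by simp))).trans (frame_setD (by simp))).trans (frame_setN (by simp))
  · rw [List.length_append, List.length_singleton] at hi
    rcases Nat.lt_succ_iff_lt_or_eq.1 hi with h | rfl
    · rw [List.getElem_append_left h]
      have := hA.code i h
      have hne : i ≠ L.length := by omega
      constructor
      · simp [hne, this.tail]
      · simp [hne, this.head]
      · simp [hne, this.kind]
      · simp [hne, this.len]
    · rw [List.getElem_append_right le_rfl]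
      constructor <;> simp

/-- `ArcMem` keeps only those arcs of `T` that exist, so both outcomes of the test lead to the same
description with `e` added to `T`. -/
theorem wp_optArc {T : Arc I → Prop} {c : ℕ} {e : Arc I} {b : BExp} {tail head : NExp} {len : DExp}
    {kind : ℕ} {m : Mem} (hA : ArcMem S T c m) (hk : kind = e.kind)
    (hb : b.eval m ↔ I.HasArc I.compl S e)
    (hev : I.HasArc I.compl S e → ∀ m', Frame [30, 31, 32] [] m m' → tail.eval m' = e.tail.pos ∧
      head.eval m' = e.head.pos ∧ len.eval m' = ((I.modLength I.compl S e : ℝ) : WithTop ℝ))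
    {Q : Mem → Prop}
    (hQ : ∀ m', Frame [29, 30, 31, 32] [14] m m' →
      ArcMem S (fun e' => T e' ∨ e' = e) (c + 1) m' → Q m') :
    (Prog.ite b (addArc tail head kind len) .skip).wp Q m := by
  obtain ⟨L, h1, h2, h3⟩ := hA
  subst hk
  refine ⟨fun h => ?_, fun h => ?_⟩
  · have he := hb.1 h
    refine wp_addArc h3 (hev he) fun m' hF hL => hQ m' hF ⟨_, by simpa using h1, fun e' => ?_, hL⟩
    rw [List.mem_append, List.mem_singleton, h2]
    constructor
    · rintro (⟨a, b⟩ | rfl)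
      exacts [⟨a, Or.inl b⟩, ⟨he, Or.inr rfl⟩]
    · rintro ⟨a, b | b⟩
      exacts [Or.inl ⟨a, b⟩, Or.inr b]
  · refine hQ m (Frame.refl _ _ _) ⟨L, by omega, fun e' => (h2 e').trans ⟨?_, ?_⟩, h3⟩
    · rintro ⟨a, b⟩; exact ⟨a, Or.inl b⟩
    · rintro ⟨a, b | rfl⟩
      exacts [⟨a, b⟩, absurd (hb.2 a) h]

/-! ### Arcs for the exchanges in `X` -/

/-- Both values of `fbarR` contain the finite summand `fbar (X - u)`, so an arc length is a
difference of two marginals and costs `O(r)` instead of a full evaluation. -/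
theorem exchange_length {X : Finset I.U} (hX : I.fbarR I.compl X ≠ ⊤) {u v : I.U} (hu : u ∈ X)
    (hv : v ∉ X) :
    (I.fbarR I.compl (insert v (X.erase u)) ≠ ⊤ ↔ I.marginal I.compl v (X.erase u) ≠ ⊤) ∧
    (I.marginal I.compl v (X.erase u) ≠ ⊤ →
      dsub (I.marginal I.compl v (X.erase u)) (I.marginal I.compl u (X.erase u)) =
      (((I.fbarR I.compl (insert v (X.erase u))).untopD 0 - (I.fbarR I.compl X).untopD 0 : ℝ) :
        WithTop ℝ)) := by
  have hc := fbarR_ne_top hX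
  have hv' : v ∉ X.erase u := fun h => hv (Finset.mem_of_mem_erase h)
  have e1 : I.fbarR I.compl X = I.fbar I.compl (X.erase u) + I.marginal I.compl u (X.erase u) := by
    unfold fbarR
    rw [if_pos hc, fbar_erase_add compl_symm hu]
  have e2 : I.fbarR I.compl (insert v (X.erase u)) =
      I.fbar I.compl (X.erase u) + I.marginal I.compl v (X.erase u) := by
    unfold fbarR
    rw [if_pos (by rw [card_swap hu hv, hc]), fbar_insert compl_symm hv']
  rw [e1] at hX
  have hX' := WithTop.add_ne_top.1 hX
  rw [e1, e2]
  obtain ⟨a, ha⟩ := WithTop.ne_top_iff_exists.1 hX'.1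
  obtain ⟨b, hb⟩ := WithTop.ne_top_iff_exists.1 hX'.2
  rw [← ha, ← hb]
  refine ⟨by simp, fun h => ?_⟩
  obtain ⟨x, hx⟩ := WithTop.ne_top_iff_exists.1 h
  rw [← hx, dsub_coe, ← WithTop.coe_add, ← WithTop.coe_add, WithTop.untopD_coe, WithTop.untopD_coe]
  congr 1
  ring

def marginalProg : Prog :=
  .seq (.seq (.letN 42 (.get 27 (.var 22))) <|
    .seq (.letD 17 (.get 0 (.var 21))) (.letD 18 (.get 0 (.var 42)))) <|
  .forN 23 (.var 0) <| .ite (.neq (.var 23) (.var 22)) .skip <|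
    .seq (.letD 17 (.add (.var 17) (.get 2 (.add (.get 13 (.get 27 (.var 23))) (.var 21)))))
    (.letD 18 (.add (.var 18) (.get 2 (.add (.get 13 (.get 27 (.var 23))) (.var 42)))))

theorem runs_marginal {m : Mem} {xl : ℕ → I.U} {v : I.U} {k : ℕ} (hS : Setup I m) (hT : Table I m)
    (hx : ∀ j < I.r, m.N 27 j = I.pos (xl j)) (hinj : Set.InjOn xl (Set.Iio I.r))
    (hv : m.N 21 0 = I.pos v) (hk : k < I.r) (hk' : m.N 22 0 = k) :
    Runs marginalProg m (150 * I.r + 50) fun m' => m'.N 42 0 = I.pos (xl k) ∧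
      m'.D 17 0 = I.marginal I.compl v (((Finset.range I.r).image xl).erase (xl k)) ∧
      m'.D 18 0 = I.marginal I.compl (xl k) (((Finset.range I.r).image xl).erase (xl k)) := by
  have hr := I.r_pos
  unfold marginalProg
  refine Runs.cost_le (Runs.seq (Runs.of_wp (Q := fun m' => m'.N 42 0 = I.pos (xl k) ∧
      m'.D 17 0 = ((I.un v.1 v.2 : ℝ) : WithTop ℝ) ∧
      m'.D 18 0 = ((I.un (xl k).1 (xl k).2 : ℝ) : WithTop ℝ))
    (by simp [hv, hk', hx k hk, hS.un])) fun m1 hF1 h1 => Runs.forN_wp (N := I.r)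
      (c := 80 * I.r + 20) (fun j m' =>
      m'.D 17 0 = ((I.un v.1 v.2 : ℝ) : WithTop ℝ) +
        ∑ i ∈ (Finset.range j).erase k, I.compl v (xl i) ∧
      m'.D 18 0 = ((I.un (xl k).1 (xl k).2 : ℝ) : WithTop ℝ) +
        ∑ i ∈ (Finset.range j).erase k, I.compl (xl k) (xl i))
    (fun m' hF => ?_) ?_ (by decide) ?_ ?_ ?_) ?_
  · simp [(hF1.append hF).N 0 (by decide), hS.r]
  · simp only [Prog.time, NExp.cost, BExp.cost, DExp.cost]; omega
  · simp [h1]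
  · rintro j m' hj hF hjk ⟨hI1, hI2⟩
    have hFF := hF1.append hF
    have hS' := hS.frame hFF (by decide) (by decide)
    have hT' := hT.frame hFF (by decide)
    have e21 : m'.N 21 0 = I.pos v := by rw [hFF.N 21 (by decide), hv]
    have e22 : m'.N 22 0 = k := by rw [hFF.N 22 (by decide), hk']
    have e27 : m'.N 27 j = I.pos (xl j) := by rw [hFF.N 27 (by decide), hx j hj]
    have e42 : m'.N 42 0 = I.pos (xl k) := by rw [hF.N 42 (by decide), h1.1]
    have t1 : m'.D 2 (I.pos (xl j) * I.n + I.pos v) = I.compl v (xl j) := by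
      rw [compl_symm]; exact hT' _ _
    have t2 : m'.D 2 (I.pos (xl j) * I.n + I.pos (xl k)) = I.compl (xl k) (xl j) := by
      rw [compl_symm]; exact hT' _ _
    rw [Finset.range_add_one]
    by_cases hjk' : j = k
    · subst hjk'
      simpa [hjk, e22] using And.intro hI1 hI2
    · have hs : ∀ w, ∑ i ∈ (insert j (Finset.range j)).erase k, I.compl w (xl i) =
          ∑ i ∈ (Finset.range j).erase k, I.compl w (xl i) + I.compl w (xl j) := by
        intro w
        rw [Finset.erase_insert_of_ne hjk', Finset.sum_insert (by simp), add_comm]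
      have hne : ¬ (j ≤ k ∧ k ≤ j) := fun h => hjk' (le_antisymm h.1 h.2)
      simp only [hs]
      simp only [Prog.wp, BExp.eval, NExp.eval, DExp.eval, hjk, e22, e27, hne, e21, hS'.off, t1, t2,
        e42, hI1, hI2, setD_N, setN_D, setD_D, false_implies, not_false_eq_true,
        ne_eq, Nat.reduceEqDiff, setD_D_of_ne, if_true, add_assoc,
        and_self, implies_true]
  · rintro m' hF - ⟨hI1, hI2⟩
    have himg : ((Finset.range I.r).image xl).erase (xl k) =
        ((Finset.range I.r).erase k).image xl := by
      ext w
      simp only [Finset.mem_erase, Finset.mem_image, Finset.mem_range, ne_eq]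
      constructor
      · rintro ⟨hw, i, hi, rfl⟩
        exact ⟨i, ⟨fun e => hw (by rw [e]), hi⟩, rfl⟩
      · rintro ⟨i, ⟨hik, hi⟩, rfl⟩
        exact ⟨fun e => hik (hinj hi hk e), i, hi, rfl⟩
    have hsum : ∀ w, ∑ z ∈ ((Finset.range I.r).image xl).erase (xl k), I.compl w z =
        ∑ i ∈ (Finset.range I.r).erase k, I.compl w (xl i) := by
      intro w
      rw [himg, Finset.sum_image]
      intro i hi j hj h
      exact hinj (by simpa using (Finset.mem_erase.1 hi).2)
        (by simpa using (Finset.mem_erase.1 hj).2) h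
    unfold marginal
    rw [hsum, hsum]
    exact ⟨by rw [hF.N 42 (by decide), h1.1], hI1, hI2⟩
  · simp only [Prog.time, NExp.cost, DExp.cost]; omega

/-- `D 16` holds the potential of an element. -/
def exchangeProg : Prog :=
  .seq marginalProg <|
  .ite (.and (.neq (.get 25 (.var 21)) (.lit 0)) (.not (.dle .top (.var 17))))
    (addArc (.var 42) (.var 21) 1
      (.sub (.add (.sub (.var 17) (.var 18)) (.get 16 (.var 42))) (.get 16 (.var 21)))) .skip

theorem Lists.frame {xl : ℕ → I.U} {m m' : Mem} {wN wD : List ℕ} (h : Lists S xl m)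
    (hF : Frame wN wD m m') (hN : ∀ a ∈ [27, 28], a ∉ wN) : Lists S xl m' := by
  have e27 := hF.N 27 (hN 27 (by simp))
  have e28 := hF.N 28 (hN 28 (by simp))
  exact ⟨by rw [e27]; exact h.list, h.image, by rw [e28]; exact h.yl⟩

theorem Lists.injOn {xl : ℕ → I.U} {m : Mem} (h : Lists S xl m) (hX : S.X.card = I.r) :
    Set.InjOn xl (Set.Iio I.r) := by
  have : Set.InjOn xl (Finset.range I.r : Set ℕ) := by
    rw [← Finset.card_image_iff, h.image, hX, Finset.card_range]
  simpa using this

theorem Lists.mem {xl : ℕ → I.U} {m : Mem} (h : Lists S xl m) {k : ℕ} (hk : k < I.r) :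
    xl k ∈ S.X := by
  rw [← h.image]
  exact Finset.mem_image_of_mem _ (Finset.mem_range.2 hk)

theorem StateMem.notMem_X {m : Mem} (h : StateMem S m) {v : I.U} :
    m.N 25 (I.pos v) = 0 ↔ v ∉ S.X := by
  rw [h.X]; split_ifs <;> simp_all

theorem StateMem.mem_X {m : Mem} (h : StateMem S m) {v : I.U} :
    m.N 25 (I.pos v) = 1 ↔ v ∈ S.X := by
  rw [h.X]; split_ifs <;> simp_all

theorem StateMem.notMem_Y {m : Mem} (h : StateMem S m) {v : I.U} :
    m.N 26 (I.pos v) = 0 ↔ v ∉ S.Y := by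
  rw [h.Y]; split_ifs <;> simp_all

theorem StateMem.mem_Y {m : Mem} (h : StateMem S m) {v : I.U} :
    m.N 26 (I.pos v) = 1 ↔ v ∈ S.Y := by
  rw [h.Y]; split_ifs <;> simp_all

theorem runs_exchange {m : Mem} {xl : ℕ → I.U} {v : I.U} {k c : ℕ} {T : Arc I → Prop}
    (hS : Setup I m) (hT : Table I m) (hM : StateMem S m) (hL : Lists S xl m)
    (hX : I.fbarR I.compl S.X ≠ ⊤) (hA : ArcMem S T c m)
    (hv : m.N 21 0 = I.pos v) (hk : k < I.r) (hk' : m.N 22 0 = k) :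
    Runs exchangeProg m (150 * I.r + 150) fun m' =>
      ArcMem S (fun e => T e ∨ e = .exX (xl k) v) (c + 1) m' := by
  unfold exchangeProg
  refine Runs.cost_le (Runs.seq (runs_marginal hS hT hL.list (hL.injOn (fbarR_ne_top hX)) hv hk hk')
    fun m1 hF1 h1 => Runs.of_wp ?_) ?_
  · have hA1 := hA.frame hF1 (by decide) (by decide)
    have hM1 := hM.frame hF1 (by decide) (by decide)
    have e21 : m1.N 21 0 = I.pos v := by rw [hF1.N 21 (by decide), hv]
    obtain ⟨h42, h17, h18⟩ := h1
    rw [hL.image] at h17 h18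
    have hu := hL.mem hk
    have hneq : (BExp.neq (.get 25 (.var 21)) (.lit 0)).eval m1 ↔ v ∉ S.X := by
      simp [e21, hM1.notMem_X]
    have htop : (BExp.not (.dle .top (.var 17))).eval m1 ↔
        I.marginal I.compl v (S.X.erase (xl k)) ≠ ⊤ := by simp [h17]
    refine wp_optArc hA1 rfl ?_ (fun he m' hF => ?_) fun m' _ h => h
    · show _ ∧ _ ↔ _
      rw [hneq, htop]
      constructor
      · rintro ⟨a, b⟩; exact ⟨hu, a, (exchange_length hX hu a).1.2 b⟩
      · rintro ⟨_, a, b⟩; exact ⟨a, (exchange_length hX hu a).1.1 b⟩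
    · obtain ⟨_, hvX, hne⟩ := he
      obtain ⟨ex1, ex2⟩ := exchange_length hX hu hvX
      have ex3 := ex2 (ex1.1 hne)
      have pu := hM1.p (.el (xl k))
      have pv := hM1.p (.el v)
      simp only [Vertex.pos] at pu pv
      simp only [NExp.eval, DExp.eval, hF.N 42 (by decide), hF.N 21 (by decide), h42, e21,
        hF.D 17 (by decide), hF.D 18 (by decide), hF.D 16 (by decide), h17, h18, ex3, pu, pv]
      refine ⟨rfl, rfl, ?_⟩
      rw [← WithTop.coe_add, dsub_coe]
      rfl
  · simp only [Prog.time, addArc, NExp.cost, DExp.cost, BExp.cost]; omega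

/-! ### The other arcs -/

/-- An element outside `Y` has exactly one exchange arc for `Y`, namely to the element of `Y` with
the same variable, which `N 28` provides directly. -/
def terminalProg : Prog :=
  .seq (.ite (.and (.neq (.get 25 (.var 21)) (.lit 1)) (.neq (.get 26 (.var 21)) (.lit 0)))
    (addArc (.var 10) (.var 21) 0 (.sub (.get 16 (.var 10)) (.get 16 (.var 21)))) .skip) <|
  .seq (.ite (.and (.neq (.get 25 (.var 21)) (.lit 0)) (.neq (.get 26 (.var 21)) (.lit 1)))
    (addArc (.var 21) (.add (.var 10) (.lit 1)) 0
      (.sub (.get 16 (.var 21)) (.get 16 (.add (.var 10) (.lit 1))))) .skip) <|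
  .ite (.neq (.get 26 (.var 21)) (.lit 0))
    (addArc (.var 21) (.get 28 (.get 12 (.var 21))) 2
      (.sub (.get 16 (.var 21)) (.get 16 (.get 28 (.get 12 (.var 21)))))) .skip

theorem wp_terminal {m : Mem} {xl : ℕ → I.U} {v y : I.U} {c : ℕ} {T : Arc I → Prop}
    (hS : Setup I m) (hM : StateMem S m) (hL : Lists S xl m) (hA : ArcMem S T c m)
    (hv : m.N 21 0 = I.pos v) (hY : I.IsFeasible S.Y) (hy : y ∈ S.Y) (hyv : v.1 = y.1)
    {Q : Mem → Prop} (hQ : ∀ m', ArcMem S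
      (fun e => ((T e ∨ e = .src v) ∨ e = .snk v) ∨ e = .exY v y) (c + 1 + 1 + 1) m' → Q m') :
    terminalProg.wp Q m := by
  have pv := hM.p (.el v)
  have py := hM.p (.el y)
  have ps := hM.p .s
  have pt := hM.p .t
  simp only [Vertex.pos] at pv py ps pt
  have e28 := hL.yl y hy
  have hfeas : v ∉ S.Y → I.IsFeasible (insert v (S.Y.erase y)) := by
    obtain ⟨x, hx⟩ := hY
    rw [hx] at hy ⊢
    exact fun h => (isFeasible_swap h hy).2 hyv
  unfold terminalProg
  refine wp_optArc hA rfl ?_ (fun he m' hF => ?_) fun m1 hF1 hA1 =>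
    wp_optArc hA1 rfl ?_ (fun he m' hF => ?_) fun m2 hF2 hA2 =>
    wp_optArc hA2 rfl ?_ (fun he m' hF => ?_) fun m3 hF3 hA3 => hQ m3 hA3
  · have h1 := hM.mem_X (v := v)
    have h2 := hM.notMem_Y (v := v)
    simp [HasArc, hv, ← h1, ← h2]
    omega
  · simp [hF.N 10 (by decide), hF.N 21 (by decide), hF.D 16 (by decide), hv, hS.n, pv, ps,
      Arc.tail, Arc.head, Vertex.pos, modLength, arcLength]
  · have hM1 := hM.frame hF1 (by decide) (by decide)
    have h1 := hM1.notMem_X (v := v)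
    have h2 := hM1.mem_Y (v := v)
    simp [HasArc, hF1.N 21 (by decide), hv, ← h1, ← h2]
    omega
  · have hFF := hF1.append hF
    simp [hFF.N 10 (by decide), hFF.N 21 (by decide), hFF.D 16 (by decide), hv, hS.n, pv, pt,
      Arc.tail, Arc.head, Vertex.pos, modLength, arcLength]
  · have hFF := hF1.append hF2
    have hM1 := hM.frame hFF (by decide) (by decide)
    have h2 := hM1.notMem_Y (v := v)
    simp only [BExp.eval, NExp.eval, hFF.N 21 (by decide), hv, HasArc]
    constructor
    · rintro ⟨h3, h4⟩
      have h5 := h2.1 (le_antisymm h3 h4)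
      exact ⟨h5, hy, hfeas h5⟩
    · rintro ⟨h3, -⟩
      rw [h2.2 h3]; simp
  · have hFF := (hF1.append hF2).append hF
    simp [hFF.N 12 (by decide), hFF.N 21 (by decide), hFF.N 28 (by decide), hFF.D 16 (by decide),
      hv, hS.cls, pv, py, hyv, e28, Arc.tail, Arc.head, Vertex.pos, modLength, arcLength]

def arcsProg : Prog :=
  .seq (.letN 29 (.lit 0)) <|
  .forN 21 (.var 10) (.seq (.forN 22 (.var 0) exchangeProg) terminalProg)

theorem IsFeasible.exists_mem {Y : Finset I.U} (hY : I.IsFeasible Y) (v : I.U) :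
    ∃ y ∈ Y, v.1 = y.1 := by
  obtain ⟨x, rfl⟩ := hY
  exact ⟨⟨v.1, x v.1⟩, mem_vec.2 rfl, rfl⟩

theorem IsFeasible.partner {Y : Finset I.U} (hY : I.IsFeasible Y) {v y w : I.U} (hv : v ∉ Y)
    (hy : y ∈ Y) (hyv : v.1 = y.1) (hw : w ∈ Y) (h : I.IsFeasible (insert v (Y.erase w))) :
    w = y := by
  refine hY.eq_of_fst hw hy ?_
  obtain ⟨x, rfl⟩ := hY
  rw [← hyv, (isFeasible_swap hv hw).1 h]

/-- There are `n r` candidates for exchanges in `X`, and each takes `O(r)` steps for the two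
marginals. -/
theorem runs_arcs {m : Mem} {xl : ℕ → I.U} (hS : Setup I m) (hT : Table I m) (hM : StateMem S m)
    (hL : Lists S xl m) (hX : I.fbarR I.compl S.X ≠ ⊤) (hY : I.IsFeasible S.Y) :
    Runs arcsProg m (2000 * (I.n * (I.r * I.r))) fun m' =>
      ArcMem S (fun _ => True) (I.n * (I.r + 3)) m' := by
  have hr := I.r_pos
  unfold arcsProg
  refine Runs.cost_le (Runs.seq (Runs.of_wp (Q := fun m' => m'.N 29 0 = 0) (by simp))
    -- Arcs are grouped by owner. One element owns at most `r` exchange arcs for `X` and three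
    -- further arcs, whence the factor `r + 3`.
    fun m1 hF1 h1 => Runs.forN (N := I.n) (fun k m' =>
      ArcMem S (fun e => (I.pos e.owner : ℕ) < k) (k * (I.r + 3)) m')
    (fun m' hF => ?_) ?_ (by decide) (fun k m' hk hF hik hI =>
      (?_ : Runs _ _ (I.r * (150 * I.r + 150 + 2 + 11) + 310) _)) ?_) ?_
  · simp [(hF1.append hF).N 10 (by decide), hS.n]
  · exact ⟨[], by simp, by simp, by simp [h1], by simp⟩
  · obtain ⟨v, rfl⟩ := exists_pos hk
    have hFF := hF1.append hF
    have hS' := hS.frame hFF (by decide) (by decide)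
    have hM' := hM.frame hFF (by decide) (by decide)
    have hT' := hT.frame hFF (by decide)
    have hL' := hL.frame hFF (by decide)
    obtain ⟨y, hy, hyv⟩ := hY.exists_mem v
    refine Runs.cost_le (Runs.seq (Runs.forN (N := I.r) (fun j m'' =>
      ArcMem S (fun e => (I.pos e.owner : ℕ) < I.pos v ∨ ∃ i < j, e = .exX (xl i) v)
        (I.pos v * (I.r + 3) + j) m'')
      (fun m'' hF' => ?_) ?_ (by decide) (fun j m'' hj hF' hij hJ =>
        (?_ : Runs _ _ (150 * I.r + 150) _))
      (Q := fun m'' => ArcMem S (fun e => (I.pos e.owner : ℕ) < I.pos v ∨ ∃ u, e = .exX u v)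
        (I.pos v * (I.r + 3) + I.r) m'') ?_) fun m2 hF2 h2 => Runs.of_wp ?_) ?_
    · simp [hF'.N 0 (by decide), hS'.r]
    · refine (hI.congr (fun e _ => by simp) (by simp)).frame (wN := [22]) (wD := [])
        (frame_setN (by simp)) (by decide) (by decide)
    · refine (runs_exchange (hS'.frame hF' (by decide) (by decide)) (hT'.frame hF' (by decide))
        (hM'.frame hF' (by decide) (by decide)) (hL'.frame hF' (by decide)) hX hJ
        (by rw [hF'.N 21 (by decide), hik]) hj hij).mono le_rfl fun m3 _ h3 => ?_
      refine (h3.congr (fun e _ => ?_) le_rfl).frame (wN := [22]) (wD := [])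
        (frame_setN (by simp)) (by decide) (by decide)
      constructor
      · rintro ((h | ⟨i, hi, h⟩) | h)
        exacts [Or.inl h, Or.inr ⟨i, by omega, h⟩, Or.inr ⟨j, by omega, h⟩]
      · rintro (h | ⟨i, hi, h⟩)
        · exact Or.inl (Or.inl h)
        · rcases Nat.lt_succ_iff_lt_or_eq.1 hi with h' | rfl
          exacts [Or.inl (Or.inr ⟨i, h', h⟩), Or.inr h]
    · intro m3 _ _ h3
      refine h3.congr (fun e he => or_congr_right ⟨?_, ?_⟩) le_rfl
      · rintro ⟨i, _, h⟩; exact ⟨_, h⟩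
      · rintro ⟨u, rfl⟩
        have hu : u ∈ S.X := he.1
        rw [← hL.image, Finset.mem_image] at hu
        obtain ⟨i, hi, rfl⟩ := hu
        exact ⟨i, Finset.mem_range.1 hi, rfl⟩
    · refine wp_terminal (hS'.frame hF2 (by decide) (by decide))
        (hM'.frame hF2 (by decide) (by decide)) (hL'.frame hF2 (by decide)) h2
        (by rw [hF2.N 21 (by decide), hik]) hY hy hyv fun m3 h3 => ?_
      refine (h3.congr (fun e he => ?_) (by rw [add_mul]; omega)).frame (wN := [21]) (wD := [])
        (frame_setN (by simp)) (by decide) (by decide)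
      have hlt : (I.pos e.owner : ℕ) < I.pos v + 1 ↔
          (I.pos e.owner : ℕ) < I.pos v ∨ e.owner = v := by
        rw [← pos_eq_iff]; omega
      rw [hlt]
      constructor
      · rintro ((((h | ⟨u, rfl⟩) | rfl) | rfl) | rfl)
        exacts [Or.inl h, Or.inr rfl, Or.inr rfl, Or.inr rfl, Or.inr rfl]
      · rintro (h | rfl)
        · exact Or.inl (Or.inl (Or.inl (Or.inl h)))
        · cases e with
          | src u => exact Or.inl (Or.inl (Or.inr rfl))
          | snk u => exact Or.inl (Or.inr rfl)
          | exX u w => exact Or.inl (Or.inl (Or.inl (Or.inr ⟨u, rfl⟩)))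
          | exY u w =>
            obtain ⟨h3, h4, h5⟩ := he
            rw [show w = y from hY.partner h3 hy hyv h4 h5]
            exact Or.inr rfl
    · simp only [terminalProg, addArc, Prog.time, NExp.cost, DExp.cost, BExp.cost,
        Nat.reduceAdd]
      omega
  · intro m' _ _ h
    exact h.congr (fun e _ => by simp) le_rfl
  · have h2r := two_mul_r_le I
    simp only [Prog.time, NExp.cost, Nat.reduceAdd]
    have h3 : I.n * (I.r * (150 * I.r + 150 + 2 + 11) + 310 + 2 + 11) =
      150 * (I.n * (I.r * I.r)) + 163 * (I.n * I.r) + 323 * I.n := by ring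
    have h4 : I.n * I.r ≤ I.n * (I.r * I.r) := Nat.mul_le_mul_left _ (Nat.le_mul_of_pos_left _ hr)
    have h5 : I.n ≤ I.n * I.r := Nat.le_mul_of_pos_right _ hr
    omega

end BinaryVCSP

/-! ## Shortest paths with the smallest number of arcs -/

namespace BinaryVCSP

open RAM

variable {I : BinaryVCSP} {S : State I}

instance : DecidableEq (Vertex I) := fun v w =>
  decidable_of_iff (v.pos = w.pos) Vertex.pos_eq_iff

/-- Labels, compared lexicographically: a length and a number of arcs. -/
abbrev label (a : WithTop ℝ) (k : ℕ) : WithTop ℝ ×ₗ ℕ := toLex (a, k)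

theorem label_le {a b : WithTop ℝ} {k l : ℕ} : label a k ≤ label b l ↔ a < b ∨ a = b ∧ k ≤ l :=
  Prod.Lex.toLex_le_toLex

/-- The lexicographic comparison in the form in which the program tests it. -/
theorem label_le_iff {a b : WithTop ℝ} {k l : ℕ} :
    label a k ≤ label b l ↔ a ≤ b ∧ ¬ (b ≤ a ∧ l < k) := by
  rw [label_le]
  constructor
  · rintro (h | ⟨rfl, h⟩)
    · exact ⟨h.le, fun h' => absurd h'.1 (not_le.2 h)⟩
    · exact ⟨le_rfl, fun h' => absurd h'.2 (not_lt.2 h)⟩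
  · rintro ⟨h1, h2⟩
    rcases h1.lt_or_eq with h | h
    · exact Or.inl h
    · exact Or.inr ⟨h, not_lt.1 fun h' => h2 ⟨h.ge, h'⟩⟩

theorem label_add {a b : WithTop ℝ} {k l : ℕ} (x : ℝ) (h : label a k ≤ label b l) :
    label (a + (x : WithTop ℝ)) (k + 1) ≤ label (b + (x : WithTop ℝ)) (l + 1) := by
  rw [label_le] at h ⊢
  rcases h with h | ⟨rfl, h⟩
  · exact Or.inl (WithTop.add_lt_add_right WithTop.coe_ne_top h)
  · exact Or.inr ⟨rfl, by omega⟩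

/-- The label of a walk. -/
noncomputable def walkLabel (S : State I) (Q : List (Arc I)) : WithTop ℝ ×ₗ ℕ :=
  label ((I.pathLength I.compl S Q : ℝ) : WithTop ℝ) Q.length

theorem pathLength_singleton (e : Arc I) :
    I.pathLength I.compl S [e] = I.modLength I.compl S e := by simp [pathLength]

/-- The label of a vertex in memory. -/
noncomputable def memLabel (m : Mem) (v : Vertex I) : WithTop ℝ ×ₗ ℕ :=
  label (m.D 15 v.pos) (m.N 33 v.pos)

/-- The label of the head of `e` that is obtained from the label of its tail. -/
noncomputable def relaxed (S : State I) (m : Mem) (e : Arc I) : WithTop ℝ ×ₗ ℕ :=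
  label (m.D 15 e.tail.pos + ((I.modLength I.compl S e : ℝ) : WithTop ℝ)) (m.N 33 e.tail.pos + 1)

/-- Finite labels belong to walks. -/
def Sound (S : State I) (m : Mem) : Prop :=
  ∀ v, m.D 15 v.pos = ⊤ ∨ ∃ Q, I.IsWalk I.compl S .s v Q ∧ memLabel m v = walkLabel S Q

/-- The labels are at most those of the walks with at most `k` arcs. -/
def Upper (S : State I) (k : ℕ) (m : Mem) : Prop :=
  ∀ v Q, I.IsWalk I.compl S .s v Q → Q.length ≤ k → memLabel m v ≤ walkLabel S Q

/-- The labels are the best labels of walks. -/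
def Labels (S : State I) (m : Mem) : Prop :=
  Sound S m ∧ ∀ v Q, I.IsWalk I.compl S .s v Q → memLabel m v ≤ walkLabel S Q

theorem memLabel_frame {m m' : Mem} {wN wD : List ℕ} (hF : Frame wN wD m m') (hN : 33 ∉ wN)
    (hD : 15 ∉ wD) (v : Vertex I) : memLabel m' v = memLabel m v := by
  unfold memLabel
  rw [hF.N 33 hN, hF.D 15 hD]

theorem relaxed_frame {m m' : Mem} {wN wD : List ℕ} (hF : Frame wN wD m m') (hN : 33 ∉ wN)
    (hD : 15 ∉ wD) (e : Arc I) : relaxed S m' e = relaxed S m e := by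
  unfold relaxed
  rw [hF.N 33 hN, hF.D 15 hD]

theorem Sound.frame {m m' : Mem} {wN wD : List ℕ} (h : Sound S m) (hF : Frame wN wD m m')
    (hN : 33 ∉ wN) (hD : 15 ∉ wD) : Sound S m' := by
  intro v
  rw [memLabel_frame hF hN hD, hF.D 15 hD]
  exact h v

theorem Upper.frame {k : ℕ} {m m' : Mem} {wN wD : List ℕ} (h : Upper S k m)
    (hF : Frame wN wD m m') (hN : 33 ∉ wN) (hD : 15 ∉ wD) : Upper S k m' := by
  intro v
  rw [memLabel_frame hF hN hD]
  exact h v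

theorem Labels.frame {m m' : Mem} {wN wD : List ℕ} (h : Labels S m) (hF : Frame wN wD m m')
    (hN : 33 ∉ wN) (hD : 15 ∉ wD) : Labels S m' := by
  refine ⟨h.1.frame hF hN hD, fun v => ?_⟩
  rw [memLabel_frame hF hN hD]
  exact h.2 v

theorem isWalk_concat {v w : Vertex I} {Q : List (Arc I)} {e : Arc I} :
    I.IsWalk I.compl S v w (Q ++ [e]) ↔
      I.IsWalk I.compl S v e.tail Q ∧ I.HasArc I.compl S e ∧ e.head = w := by
  rw [isWalk_append]
  constructor
  · rintro ⟨z, h1, h2, rfl, h3⟩; exact ⟨h1, h2, h3⟩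
  · rintro ⟨h1, h2, h3⟩; exact ⟨_, h1, h2, rfl, h3⟩

theorem walkLabel_concat {m : Mem} {Q : List (Arc I)} {e : Arc I}
    (h : memLabel m e.tail = walkLabel S Q) : relaxed S m e = walkLabel S (Q ++ [e]) := by
  have h' := Prod.ext_iff.1 (toLex_inj.1 h)
  simp only at h'
  unfold relaxed walkLabel
  rw [h'.1, h'.2, pathLength_append, pathLength_singleton, List.length_append, WithTop.coe_add]
  rfl

theorem relaxed_le {m : Mem} {Q : List (Arc I)} {e : Arc I}
    (h : memLabel m e.tail ≤ walkLabel S Q) : relaxed S m e ≤ walkLabel S (Q ++ [e]) := by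
  have := label_add (I.modLength I.compl S e) h
  unfold relaxed walkLabel
  rwa [pathLength_append, pathLength_singleton, List.length_append, WithTop.coe_add]

theorem relaxed_mono {m m' : Mem} {e : Arc I} (h : memLabel m e.tail ≤ memLabel m' e.tail) :
    relaxed S m e ≤ relaxed S m' e := label_add _ h

theorem Sound.relaxed {m : Mem} (h : Sound S m) {e : Arc I} (he : I.HasArc I.compl S e) :
    m.D 15 e.tail.pos = ⊤ ∨
      ∃ Q, I.IsWalk I.compl S .s e.head Q ∧ relaxed S m e = walkLabel S Q :=
  (h e.tail).imp_right fun ⟨Q, hQ, h'⟩ => ⟨Q ++ [e], isWalk_concat.2 ⟨hQ, he, rfl⟩,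
    walkLabel_concat h'⟩

/-- A path has at most `2r + 2` arcs. -/
theorem IsPath.length_le {v w : Vertex I} {Q : List (Arc I)} (hQ : I.IsPath I.compl S v w Q)
    (hX : S.X.card = I.r) (hY : S.Y.card = I.r) : Q.length ≤ I.r + I.r + 2 := by
  classical
  -- An exchange arc for `X` is determined on the path by its tail, which lies in `X`, and one for
  -- `Y` by its head, which lies in `Y`. This gives at most `r` arcs of each kind and one arc at
  -- each terminal, independently of `n`.
  let code : Arc I → ℕ × Vertex I := fun e => match e with
    | .src _ => (0, .s)
    | .snk _ => (1, .t)
    | .exX u _ => (2, .el u)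
    | .exY _ v => (3, .el v)
  have hnd : Q.Nodup := hQ.nodup_head.of_map
  have hinj : Set.InjOn code (Q.toFinset : Set (Arc I)) := by
    intro e he e' he' h
    have he := List.mem_toFinset.1 he
    have he' := List.mem_toFinset.1 he'
    cases e <;> cases e' <;> simp only [code, Prod.mk.injEq, Vertex.el.injEq, reduceCtorEq,
      OfNat.zero_ne_ofNat, zero_ne_one, false_and, and_self, one_ne_zero, Nat.reduceEqDiff,
      OfNat.ofNat_ne_zero, OfNat.ofNat_ne_one, OfNat.one_ne_ofNat, true_and] at h
    · exact hQ.tail_inj he he' rfl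
    · exact hQ.head_inj he he' rfl
    · exact hQ.tail_inj he he' (by rw [h]; rfl)
    · exact hQ.head_inj he he' (by rw [h]; rfl)
  have hsub : Q.toFinset.image code ⊆ ({(0, .s), (1, .t)} : Finset (ℕ × Vertex I)) ∪
      (S.X.image fun u => (2, .el u)) ∪ S.Y.image fun v => (3, .el v) := by
    intro x hx
    obtain ⟨e, he, rfl⟩ := Finset.mem_image.1 hx
    have harc := hQ.1.hasArc e (List.mem_toFinset.1 he)
    simp only [Finset.mem_union, Finset.mem_image]
    cases e with
    | src u => left; left; simp [code]
    | snk u => left; left; simp [code]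
    | exX u v => left; right; exact ⟨u, harc.1, rfl⟩
    | exY u v => right; exact ⟨v, harc.2.1, rfl⟩
  have h1 := Finset.card_le_card hsub
  rw [Finset.card_image_of_injOn hinj, List.toFinset_card_of_nodup hnd] at h1
  have h2 := Finset.card_union_le (({(0, .s), (1, .t)} : Finset (ℕ × Vertex I)) ∪
      (S.X.image fun u => (2, .el u))) (S.Y.image fun v => (3, .el v))
  have h3 := Finset.card_union_le ({(0, .s), (1, .t)} : Finset (ℕ × Vertex I))
      (S.X.image fun u => (2, .el u))
  have h4 : ({(0, .s), (1, .t)} : Finset (ℕ × Vertex I)).card ≤ 2 := Finset.card_le_two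
  have h5 : (S.X.image fun u => ((2, .el u) : ℕ × Vertex I)).card ≤ _ := Finset.card_image_le
  have h6 : (S.Y.image fun u => ((3, .el u) : ℕ × Vertex I)).card ≤ _ := Finset.card_image_le
  omega

variable {q : Vertex I → ℝ}

/-- Under the certificate, reachable arcs have nonnegative modified length, so each walk from the
source is dominated by a path, whose number of arcs is at most `2r + 2`. -/
theorem Certified.labels (C : Certified I.compl S q) {m : Mem} (hs : Sound S m)
    (hu : Upper S (I.r + I.r + 2) m) : Labels S m := by
  refine ⟨hs, fun v Q hQ => ?_⟩
  obtain ⟨Q', hQ', h1, h2⟩ := C.exists_path hQ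
  refine (hu v Q' hQ'.1 (hQ'.length_le (fbarR_ne_top C.fin) C.feas.card)).trans ?_
  unfold walkLabel
  rw [label_le]
  rcases h1.lt_or_eq with h | h
  · exact Or.inl (WithTop.coe_lt_coe.2 h)
  · exact Or.inr ⟨by rw [h], h2⟩

/-! ### The labelling algorithm -/

def relaxProg : Prog :=
  .seq (.letN 43 (.get 30 (.var 21))) <|
  .seq (.letN 44 (.get 31 (.var 21))) <|
  .seq (.letD 19 (.add (.get 15 (.var 43)) (.get 14 (.var 21)))) <|
  .seq (.letN 45 (.add (.get 33 (.var 43)) (.lit 1))) <|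
  .ite (.and (.dle (.get 15 (.var 44)) (.var 19))
    (.not (.and (.dle (.var 19) (.get 15 (.var 44))) (.nlt (.var 45) (.get 33 (.var 44))))))
    .skip <|
    .seq (.setD 15 (.var 44) (.var 19)) (.setN 33 (.var 44) (.var 45))

theorem wp_relax {m : Mem} {L : List (Arc I)} {i : ℕ} (hA : ArcList S L m) (hi : i < L.length)
    (hi' : m.N 21 0 = i) {Q : Mem → Prop}
    (hQ : ∀ m', Frame [33, 43, 44, 45] [15, 19] m m' →
      (∀ v, memLabel m' v = if v = L[i].head then min (memLabel m v) (relaxed S m L[i])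
        else memLabel m v) → Q m') : relaxProg.wp Q m := by
  obtain ⟨c1, c2, -, c4⟩ := hA.code i hi
  have hle := label_le_iff (a := m.D 15 L[i].head.pos)
    (b := m.D 15 L[i].tail.pos + ((I.modLength I.compl S L[i] : ℝ) : WithTop ℝ))
    (k := m.N 33 L[i].head.pos) (l := m.N 33 L[i].tail.pos + 1)
  unfold relaxProg
  simp only [Prog.wp, BExp.eval, NExp.eval, DExp.eval, hi', c1, c2, c4, setN_D, setD_N, setD_D,
    if_true, setN_N, ne_eq, Nat.reduceEqDiff, not_false_eq_true, setN_N_of_ne, setD_D_of_ne, not_le]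
  rw [← hle]
  refine ⟨fun h => hQ _ ?_ fun v => ?_, fun h => hQ _ ?_ fun v => ?_⟩
  · exact (((frame_setN (by simp)).trans (frame_setN (by simp))).trans (frame_setD (by simp))).trans
      (frame_setN (by simp))
  · split_ifs with hv
    · subst hv
      rw [min_eq_left (show memLabel m L[i].head ≤ relaxed S m L[i] from h)]
      simp [memLabel]
    · simp [memLabel]
  · exact (((((frame_setN (by simp)).trans (frame_setN (by simp))).trans
      (frame_setD (by simp))).trans (frame_setN (by simp))).trans (frame_setD (by simp))).trans
      (frame_setN (by simp))
  · split_ifs with hv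
    · subst hv
      rw [min_eq_right (show relaxed S m L[i] ≤ memLabel m L[i].head from (not_le.1 h).le)]
      simp [memLabel, relaxed]
    · simp [memLabel, hv]

def relaxAll : Prog := .forN 21 (.var 29) relaxProg

/-- One Bellman–Ford round. Labels are overwritten in place; they only decrease, which can only
improve later relaxations of the same round. -/
theorem runs_relaxAll {m : Mem} {L : List (Arc I)} {k : ℕ} (hA : ArcList S L m)
    (hL : ∀ e, e ∈ L ↔ I.HasArc I.compl S e) (hs : Sound S m) (hu : Upper S k m) :
    Runs relaxAll m (100 * L.length + 10) fun m' => Sound S m' ∧ Upper S (k + 1) m' := by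
  unfold relaxAll
  refine Runs.forN_wp (N := L.length) (fun i m' => Sound S m' ∧
    (∀ v : Vertex I, memLabel m' v ≤ memLabel m v) ∧
    ∀ j (hj : j < L.length), j < i → memLabel m' L[j].head ≤ relaxed S m L[j])
    (fun m' hF => ?_) ?_ (by decide) ?_ ?_ ?_
  · simp [hF.N 29 (by decide), hA.length]
  · simp only [Prog.time, relaxProg, NExp.cost, DExp.cost, BExp.cost, Nat.reduceAdd]; omega
  · have hF : Frame [21] [] m (m.setN 21 0 0) := frame_setN (by simp)
    exact ⟨hs.frame hF (by decide) (by decide),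
      fun v => (memLabel_frame hF (by decide) (by decide) v).le, fun j _ h => absurd h (by omega)⟩
  · rintro i m' hi hF hii ⟨hI1, hI2, hI3⟩
    have hA' := hA.frame hF (by decide) (by decide)
    have he := (hL _).1 (List.getElem_mem hi)
    refine wp_relax hA' hi hii fun m'' hF' hlab => ?_
    have hF2 : Frame [21] [] m'' (m''.setN 21 0 (i + 1)) := frame_setN (by simp)
    have hle : ∀ v : Vertex I, memLabel m'' v ≤ memLabel m' v := by
      intro v; rw [hlab]; split_ifs
      exacts [min_le_left _ _, le_rfl]
    have hm : ∀ v : Vertex I, memLabel (m''.setN 21 0 (i + 1)) v = memLabel m'' v :=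
      memLabel_frame hF2 (by decide) (by decide)
    refine ⟨?_, fun v => ?_, fun j hj hji => ?_⟩
    · refine Sound.frame (fun v => ?_) hF2 (by decide) (by decide)
      have hkeep : memLabel m'' v = memLabel m' v → m''.D 15 v.pos = ⊤ ∨
          ∃ Q, I.IsWalk I.compl S .s v Q ∧ memLabel m'' v = walkLabel S Q := by
        intro h
        have h15 : m''.D 15 v.pos = m'.D 15 v.pos := (Prod.ext_iff.1 (toLex_inj.1 h)).1
        rw [h, h15]
        exact hI1 v
      have hv := hlab v
      split_ifs at hv with h1
      · rcases min_choice (memLabel m' v) (relaxed S m' L[i]) with h2 | h2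
        · exact hkeep (hv.trans h2)
        · rw [h2] at hv
          have h15 := (Prod.ext_iff.1 (toLex_inj.1 hv)).1
          simp only at h15
          rcases hI1.relaxed he with h3 | ⟨Q, hQ, h3⟩
          · left
            rw [h15, h3]; rfl
          · right
            exact ⟨Q, h1 ▸ hQ, hv.trans h3⟩
      · exact hkeep hv
    · rw [hm]
      exact (hle v).trans (hI2 v)
    · rw [hm]
      rcases Nat.lt_succ_iff_lt_or_eq.1 hji with h | rfl
      · exact (hle _).trans (hI3 j hj h)
      · rw [hlab, if_pos rfl]
        -- The relaxation uses a label of the tail that is at most its label at the beginning of the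
        -- round.
        exact (min_le_right _ _).trans (relaxed_mono (hI2 _))
  · rintro m' - - ⟨hI1, hI2, hI3⟩
    refine ⟨hI1, fun v Q hQ hk => ?_⟩
    rcases List.eq_nil_or_concat Q with rfl | ⟨Q', e, rfl⟩
    · exact (hI2 v).trans (hu v [] hQ (by simp))
    · rw [List.concat_eq_append] at hQ hk ⊢
      obtain ⟨hQ', he, rfl⟩ := isWalk_concat.1 hQ
      obtain ⟨j, hj, rfl⟩ := List.getElem_of_mem ((hL e).2 he)
      refine (hI3 j hj hj).trans (relaxed_le (hu _ _ hQ' ?_))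
      simpa using hk

def labelInit : Prog :=
  .seq (.forN 21 (.add (.var 10) (.lit 2))
    (.seq (.setD 15 (.var 21) .top) (.setN 33 (.var 21) (.lit 0)))) <|
  .setD 15 (.var 10) .zero

theorem runs_labelInit {m : Mem} (hS : Setup I m) :
    Runs labelInit m (100 * I.n + 100) fun m' => Sound S m' ∧ Upper S 0 m' := by
  unfold labelInit
  refine Runs.cost_le (Runs.seq (Runs.forN_wp (N := I.n + 2) (c := 50 * I.n + 90)
    (Q := fun m' => ∀ v : Vertex I, m'.D 15 v.pos = ⊤ ∧ m'.N 33 v.pos = 0)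
    (fun i m' => ∀ j < i, m'.D 15 j = ⊤ ∧ m'.N 33 j = 0)
    (fun m' hF => ?_) ?_ (by decide) ?_ ?_ ?_) fun m1 hF1 h1 => Runs.of_wp ?_) ?_
  · simp [hF.N 10 (by decide), hS.n]
  · simp only [Prog.time, NExp.cost, DExp.cost, Nat.reduceAdd]; omega
  · simp
  · rintro i m' hi hF hii hI
    simp only [Prog.wp, NExp.eval, DExp.eval, hii]
    intro j hj
    by_cases h : j = i
    · simp [h, hii]
    · have := hI j (by omega)
      simpa [h, hii] using this
  · rintro m' - - hI v
    exact hI _ v.pos_lt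
  · have hn : m1.N 10 0 = I.n := by rw [hF1.N 10 (by decide), hS.n]
    have hs : memLabel (I := I) (m1.setD 15 I.n 0) .s = label 0 0 := by
      have := (h1 .s).2
      simp only [Vertex.pos] at this
      simp [memLabel, Vertex.pos, this]
    simp only [Prog.wp, NExp.eval, DExp.eval, hn]
    have hw : walkLabel S [] = label 0 0 := by simp [walkLabel, pathLength]
    refine ⟨fun v => ?_, fun v Q hQ hk => ?_⟩
    · by_cases hv : v = .s
      · subst hv
        exact Or.inr ⟨[], rfl, hs.trans hw.symm⟩
      · left
        have : v.pos ≠ I.n := fun h => hv (Vertex.pos_eq_iff.1 (h.trans rfl))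
        simp [this, (h1 v).1]
    · obtain rfl : Q = [] := List.eq_nil_of_length_eq_zero (by omega)
      obtain rfl : Vertex.s = v := hQ
      rw [hs, hw]
  · simp only [Prog.time, NExp.cost, DExp.cost, Nat.reduceAdd]; omega

def labelProg : Prog :=
  .seq labelInit <| .forN 22 (.add (.add (.var 0) (.var 0)) (.lit 2)) relaxAll

theorem Certified.runs_label (C : Certified I.compl S q) {m : Mem} {L : List (Arc I)}
    (hS : Setup I m) (hA : ArcList S L m) (hL : ∀ e, e ∈ L ↔ I.HasArc I.compl S e)
    (hlen : L.length ≤ I.n * (I.r + 3)) :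
    Runs labelProg m (3000 * (I.n * (I.r * I.r))) fun m' => Labels S m' := by
  have hr := I.r_pos
  unfold labelProg
  refine Runs.cost_le (Runs.seq (runs_labelInit (S := S) hS) fun m1 hF1 h1 => Runs.forN
    (N := I.r + I.r + 2) (fun k m' => Sound S m' ∧ Upper S k m') (fun m' hF => ?_) ?_ (by decide)
    (fun k m' hk hF hik hI => (?_ : Runs _ _ (100 * L.length + 10) _)) ?_) ?_
  · simp [(hF1.append hF).N 0 (by decide), hS.r]
  · exact ⟨h1.1.frame (wN := [22]) (wD := []) (frame_setN (by simp)) (by decide) (by decide),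
      h1.2.frame (wN := [22]) (wD := []) (frame_setN (by simp)) (by decide) (by decide)⟩
  · refine (runs_relaxAll (hA.frame (hF1.append hF) (by decide) (by decide)) hL hI.1 hI.2).mono
      le_rfl fun m2 _ h2 => ?_
    exact ⟨h2.1.frame (wN := [22]) (wD := []) (frame_setN (by simp)) (by decide) (by decide),
      h2.2.frame (wN := [22]) (wD := []) (frame_setN (by simp)) (by decide) (by decide)⟩
  · rintro m' - - ⟨h2, h3⟩
    exact C.labels h2 h3
  · simp only [NExp.cost, Nat.reduceAdd]
    have h1 : I.n ≤ I.n * I.r := Nat.le_mul_of_pos_right _ hr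
    have h2 : I.n * I.r ≤ I.n * (I.r * I.r) := Nat.mul_le_mul_left _ (Nat.le_mul_of_pos_left _ hr)
    have h3 : (I.r + I.r + 2) * L.length ≤ (I.r + I.r + 2) * (I.n * (I.r + 3)) :=
      Nat.mul_le_mul_left _ hlen
    have h4 : (I.r + I.r + 2) * (I.n * (I.r + 3)) =
      2 * (I.n * (I.r * I.r)) + 8 * (I.n * I.r) + 6 * I.n := by ring
    have h5 : (I.r + I.r + 2) * (100 * L.length + 10 + 7 + 11) =
      100 * ((I.r + I.r + 2) * L.length) + 56 * I.r + 56 := by ring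
    have h6 := two_mul_r_le I
    omega

end BinaryVCSP

/-! ## Augmentation along a shortest path -/

namespace BinaryVCSP

open RAM

variable {I : BinaryVCSP} {S : State I} {q : Vertex I → ℝ}

theorem memLabel_eq_iff {m : Mem} {v : Vertex I} {a : WithTop ℝ} {k : ℕ} :
    label a k = memLabel m v ↔ a = m.D 15 v.pos ∧ k = m.N 33 v.pos := by
  unfold memLabel
  rw [toLex_inj, Prod.mk.injEq]

theorem Labels.le {m : Mem} (h : Labels S m) {v : Vertex I} {Q : List (Arc I)}
    (hQ : I.IsWalk I.compl S .s v Q) :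
    m.D 15 v.pos ≤ ((I.pathLength I.compl S Q : ℝ) : WithTop ℝ) :=
  (label_le_iff.1 (h.2 v Q hQ)).1

theorem Labels.exists_walk {m : Mem} (h : Labels S m) {v : Vertex I} (hv : m.D 15 v.pos ≠ ⊤) :
    ∃ Q, I.IsWalk I.compl S .s v Q ∧ m.D 15 v.pos = ((I.pathLength I.compl S Q : ℝ) : WithTop ℝ) ∧
      m.N 33 v.pos = Q.length := by
  obtain ⟨Q, hQ, h'⟩ := (h.1 v).resolve_left hv
  have := memLabel_eq_iff.1 h'.symm
  exact ⟨Q, hQ, this.1.symm, this.2.symm⟩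

/-- The last arc of a shortest path. -/
theorem Labels.exists_tight {m : Mem} (h : Labels S m) {v : Vertex I} (hv : m.D 15 v.pos ≠ ⊤)
    (hk : m.N 33 v.pos ≠ 0) :
    ∃ e, I.HasArc I.compl S e ∧ e.head = v ∧ relaxed S m e = memLabel m v := by
  obtain ⟨Q, hQ, h1⟩ := (h.1 v).resolve_left hv
  have h2 := (memLabel_eq_iff.1 h1.symm).2
  rcases List.eq_nil_or_concat Q with rfl | ⟨Q', e, rfl⟩
  · exact absurd h2.symm hk
  · rw [List.concat_eq_append] at hQ h1
    obtain ⟨hQ', he, rfl⟩ := isWalk_concat.1 hQ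
    refine ⟨e, he, rfl, le_antisymm ((relaxed_le (h.2 _ _ hQ')).trans h1.ge) ?_⟩
    rcases h.1.relaxed he with h3 | ⟨Q1, hQ1, h3⟩
    · have := h.le hQ'
      rw [h3, top_le_iff] at this
      exact absurd this WithTop.coe_ne_top
    · rw [h3]
      exact h.2 _ _ hQ1

/-! ### Last arcs of shortest paths -/

def predProg : Prog :=
  .forN 21 (.var 29) <|
    .ite (.and (.deq (.add (.get 15 (.get 30 (.var 21))) (.get 14 (.var 21)))
        (.get 15 (.get 31 (.var 21))))
      (.neq (.add (.get 33 (.get 30 (.var 21))) (.lit 1)) (.get 33 (.get 31 (.var 21)))))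
    (.setN 34 (.get 31 (.var 21)) (.var 21)) .skip

/-- The last arcs are found from the final labels in an extra pass. An accepted arc matches both
components of the labels, so the arc count drops by one along it, and tracing ends even when there
are arcs of length zero. -/
theorem runs_pred {m : Mem} {L : List (Arc I)} (hA : ArcList S L m)
    (hlab : Labels S m) (hL : ∀ e, e ∈ L ↔ I.HasArc I.compl S e) :
    Runs predProg m (100 * L.length + 10) fun m' => ∀ v : Vertex I, m.D 15 v.pos ≠ ⊤ →
      m.N 33 v.pos ≠ 0 → ∃ (j : ℕ) (hj : j < L.length), m'.N 34 v.pos = j ∧ L[j].head = v ∧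
        relaxed S m L[j] = memLabel m v := by
  unfold predProg
  refine Runs.forN_wp (N := L.length) (fun i m' => ∀ v : Vertex I,
    (∃ (j : ℕ) (hj : j < L.length), j < i ∧ L[j].head = v ∧ relaxed S m L[j] = memLabel m v) →
    ∃ (j : ℕ) (hj : j < L.length), m'.N 34 v.pos = j ∧ L[j].head = v ∧
      relaxed S m L[j] = memLabel m v) (fun m' hF => ?_) ?_ (by decide) ?_ ?_ ?_
  · simp [hF.N 29 (by decide), hA.length]
  · simp only [Prog.time, NExp.cost, DExp.cost, BExp.cost, Nat.reduceAdd]; omega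
  · rintro v ⟨j, -, h, -⟩; exact absurd h (by omega)
  · rintro i m' hi hF hii hI
    obtain ⟨c1, c2, -, c4⟩ := (hA.frame hF (by decide) (by decide)).code i hi
    have e15 : m'.D 15 = m.D 15 := hF.D 15 (by decide)
    have e33 : m'.N 33 = m.N 33 := hF.N 33 (by decide)
    have hb : (m.D 15 L[i].tail.pos + ((I.modLength I.compl S L[i] : ℝ) : WithTop ℝ) ≤
        m.D 15 L[i].head.pos ∧ m.D 15 L[i].head.pos ≤ m.D 15 L[i].tail.pos +
          ((I.modLength I.compl S L[i] : ℝ) : WithTop ℝ)) ∧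
        (m.N 33 L[i].tail.pos + 1 ≤ m.N 33 L[i].head.pos ∧
          m.N 33 L[i].head.pos ≤ m.N 33 L[i].tail.pos + 1) ↔
        relaxed S m L[i] = memLabel m L[i].head := by
      unfold relaxed
      rw [memLabel_eq_iff, ← le_antisymm_iff, ← le_antisymm_iff]
    simp only [Prog.wp, BExp.eval, NExp.eval, DExp.eval, hii, c1, c2, c4, e15, e33]
    rw [hb]
    refine ⟨fun ht v hv => ?_, fun ht v hv => ?_⟩
    · by_cases h : v = L[i].head
      · subst h
        exact ⟨i, hi, by simp, rfl, ht⟩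
      · obtain ⟨j, hj, h1, h2, h3⟩ := hv
        have hji : j < i := lt_of_le_of_ne (Nat.lt_succ_iff.1 h1) (by rintro rfl; exact h h2.symm)
        simpa [h] using hI v ⟨j, hj, hji, h2, h3⟩
    · obtain ⟨j, hj, h1, rfl, h3⟩ := hv
      have hji : j < i := lt_of_le_of_ne (Nat.lt_succ_iff.1 h1) (by rintro rfl; exact ht h3)
      simpa using hI _ ⟨j, hj, hji, rfl, h3⟩
  · rintro m' - - hI v hv hk
    obtain ⟨e, he, rfl, h1⟩ := hlab.exists_tight hv hk
    obtain ⟨j, hj, rfl⟩ := List.getElem_of_mem ((hL e).2 he)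
    exact hI _ ⟨j, hj, hj, rfl, h1⟩

/-! ### The potential -/

def potentialProg : Prog :=
  .forN 21 (.add (.var 10) (.lit 2)) <| .ite (.dle .top (.get 15 (.var 21))) .skip
    (.setD 16 (.var 21) (.add (.get 16 (.var 21)) (.get 15 (.var 21))))

/-- The default `0` of `untopD` encodes that the potential of unreachable vertices, whose label is
infinite, stays unchanged. -/
theorem runs_potential {m : Mem} (hS : Setup I m) (hp : ∀ v : Vertex I,
    m.D 16 v.pos = ((S.p v : ℝ) : WithTop ℝ)) :
    Runs potentialProg m (100 * I.n + 100) fun m' => ∀ v : Vertex I,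
      m'.D 16 v.pos = ((S.p v + (m.D 15 v.pos).untopD 0 : ℝ) : WithTop ℝ) := by
  unfold potentialProg
  refine Runs.forN_wp (N := I.n + 2) (fun i m' => ∀ v : Vertex I, m'.D 16 v.pos =
    if v.pos < i then ((S.p v + (m.D 15 v.pos).untopD 0 : ℝ) : WithTop ℝ)
    else ((S.p v : ℝ) : WithTop ℝ)) (fun m' hF => ?_) ?_ (by decide) ?_ ?_ ?_
  · simp [hF.N 10 (by decide), hS.n]
  · simp only [Prog.time, NExp.cost, DExp.cost, BExp.cost, Nat.reduceAdd]; omega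
  · simpa using hp
  · rintro i m' hi hF hii hI
    obtain ⟨w, rfl⟩ := exists_vpos hi
    have e15 : m'.D 15 = m.D 15 := hF.D 15 (by decide)
    have hlt : ∀ v : Vertex I, v ≠ w → (v.pos < w.pos + 1 ↔ v.pos < w.pos) := by
      intro v hv
      have : v.pos ≠ w.pos := fun h => hv (Vertex.pos_eq_iff.1 h)
      omega
    have hw := hI w
    rw [if_neg (lt_irrefl _)] at hw
    simp only [Prog.wp, BExp.eval, NExp.eval, DExp.eval, hii, e15, top_le_iff]
    refine ⟨fun h v => ?_, fun h v => ?_⟩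
    · by_cases hv : v = w
      · subst hv
        simpa [h] using hw
      · rw [setN_D, hI v]
        simp only [hlt v hv]
    · by_cases hv : v = w
      · subst hv
        obtain ⟨x, hx⟩ := WithTop.ne_top_iff_exists.1 h
        simp [hw, ← hx]
      · have := hI v
        simpa [hlt v hv, hv] using this
  · rintro m' - - hI v
    rw [hI v, if_pos v.pos_lt]

/-! ### The path -/

/-- The path is traced from the sink, so arcs are put in front one by one. The right-hand side
mirrors the two writes, first clearing `u` and then setting `v`; no arc of `P` can restore `u`,
because heads of exchange arcs lie outside `X`. -/
theorem mem_augmentX_cons {X : Finset I.U} {P : List (Arc I)} {u v w : I.U} (hu : u ∈ X)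
    (hP : ∀ x y, Arc.exX x y ∈ P → y ∉ X) :
    w ∈ I.augmentX X (.exX u v :: P) ↔ w = v ∨ w ≠ u ∧ w ∈ I.augmentX X P := by
  rw [mem_augmentX, mem_augmentX]
  simp only [List.mem_cons, Arc.exX.injEq]
  constructor
  · rintro (⟨h1, h2⟩ | ⟨x, ⟨rfl, rfl⟩ | h⟩)
    · refine Or.inr ⟨?_, Or.inl ⟨h1, fun ⟨y, hy⟩ => h2 ⟨y, Or.inr hy⟩⟩⟩
      rintro rfl
      exact h2 ⟨v, Or.inl ⟨rfl, rfl⟩⟩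
    · exact Or.inl rfl
    · refine Or.inr ⟨?_, Or.inr ⟨x, h⟩⟩
      rintro rfl
      exact hP _ _ h hu
  · rintro (rfl | ⟨h1, ⟨h2, h3⟩ | ⟨x, h⟩⟩)
    · exact Or.inr ⟨u, Or.inl ⟨rfl, rfl⟩⟩
    · refine Or.inl ⟨h2, ?_⟩
      rintro ⟨y, ⟨rfl, -⟩ | hy⟩
      exacts [h1 rfl, h3 ⟨y, hy⟩]
    · exact Or.inr ⟨x, Or.inr h⟩

theorem mem_augmentY_cons {Y : Finset I.U} {P : List (Arc I)} {u v w : I.U} (hv : v ∈ Y)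
    (hP : ∀ x y, Arc.exY x y ∈ P → x ∉ Y) :
    w ∈ I.augmentY Y (.exY u v :: P) ↔ w = u ∨ w ≠ v ∧ w ∈ I.augmentY Y P := by
  rw [mem_augmentY, mem_augmentY]
  simp only [List.mem_cons, Arc.exY.injEq]
  constructor
  · rintro (⟨h1, h2⟩ | ⟨x, ⟨rfl, rfl⟩ | h⟩)
    · refine Or.inr ⟨?_, Or.inl ⟨h1, fun ⟨y, hy⟩ => h2 ⟨y, Or.inr hy⟩⟩⟩
      rintro rfl
      exact h2 ⟨u, Or.inl ⟨rfl, rfl⟩⟩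
    · exact Or.inl rfl
    · refine Or.inr ⟨?_, Or.inr ⟨x, h⟩⟩
      rintro rfl
      exact hP _ _ h hv
  · rintro (rfl | ⟨h1, ⟨h2, h3⟩ | ⟨x, h⟩⟩)
    · exact Or.inr ⟨v, Or.inl ⟨rfl, rfl⟩⟩
    · refine Or.inl ⟨h2, ?_⟩
      rintro ⟨y, ⟨-, rfl⟩ | hy⟩
      exacts [h1 rfl, h3 ⟨y, hy⟩]
    · exact Or.inr ⟨x, Or.inr h⟩

theorem augmentX_cons_of_kind {X : Finset I.U} {P : List (Arc I)} {e : Arc I} (he : e.kind ≠ 1) :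
    I.augmentX X (e :: P) = I.augmentX X P := by
  ext w
  rw [mem_augmentX, mem_augmentX]
  cases e <;> simp_all [Arc.kind]

theorem augmentY_cons_of_kind {Y : Finset I.U} {P : List (Arc I)} {e : Arc I} (he : e.kind ≠ 2) :
    I.augmentY Y (e :: P) = I.augmentY Y P := by
  ext w
  rw [mem_augmentY, mem_augmentY]
  cases e <;> simp_all [Arc.kind]

def traceStep : Prog :=
  .seq (.letN 47 (.get 34 (.var 46))) <|
  .seq (.ite (.neq (.get 32 (.var 47)) (.lit 1))
    (.seq (.setN 25 (.get 30 (.var 47)) (.lit 0)) (.setN 25 (.get 31 (.var 47)) (.lit 1)))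
    (.ite (.neq (.get 32 (.var 47)) (.lit 2))
      (.seq (.setN 26 (.get 31 (.var 47)) (.lit 0)) (.setN 26 (.get 30 (.var 47)) (.lit 1)))
      .skip)) <|
  .letN 46 (.get 30 (.var 47))

/-- `X` and `Y` in memory are augmented along `P`. -/
structure Augmented (S : State I) (P : List (Arc I)) (m : Mem) : Prop where
  X : ∀ v, m.N 25 (I.pos v) = if v ∈ I.augmentX S.X P then 1 else 0
  Y : ∀ v, m.N 26 (I.pos v) = if v ∈ I.augmentY S.Y P then 1 else 0

theorem wp_traceStep {m : Mem} {P : List (Arc I)} {e : Arc I} {j : ℕ} {w : Vertex I}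
    (h46 : m.N 46 0 = w.pos) (h34 : m.N 34 w.pos = j) (hcode : ArcCode S e j m)
    (he : I.HasArc I.compl S e) (hP : ∀ e ∈ P, I.HasArc I.compl S e) (hA : Augmented S P m)
    {Q : Mem → Prop}
    (hQ : ∀ m', Augmented S (e :: P) m' → m'.N 46 0 = e.tail.pos → Q m') :
    traceStep.wp Q m := by
  obtain ⟨c1, c2, c3, -⟩ := hcode
  have hPX : ∀ x y, Arc.exX x y ∈ P → y ∉ S.X := fun x y h => (hP _ h).2.1
  have hPY : ∀ x y, Arc.exY x y ∈ P → x ∉ S.Y := fun x y h => (hP _ h).1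
  unfold traceStep
  simp only [Prog.wp, BExp.eval, NExp.eval, h46, h34, c1, c2, c3, setN_N, ne_eq, Nat.reduceEqDiff,
    not_false_eq_true, setN_N_of_ne, if_true, ← le_antisymm_iff]
  refine ⟨fun h1 => hQ _ ⟨fun v => ?_, fun v => ?_⟩ (by simp), fun h1 =>
    ⟨fun h2 => hQ _ ⟨fun v => ?_, fun v => ?_⟩ (by simp),
      fun h2 => hQ _ ⟨fun v => ?_, fun v => ?_⟩ (by simp)⟩⟩
  · cases e with
    | exX x y =>
      have hX := hA.X v
      have := mem_augmentX_cons (w := v) (v := y) he.1 hPX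
      simp only [Arc.tail, Arc.head, Vertex.pos, ne_eq, Nat.reduceEqDiff, not_false_eq_true,
        setN_N_of_ne, setN_N, pos_eq_iff, this, hX]
      by_cases h3 : v = y <;> by_cases h4 : v = x <;> simp [h3, h4]
    | _ => simp [Arc.kind] at h1
  · rw [augmentY_cons_of_kind (by omega)]
    simpa using hA.Y v
  · rw [augmentX_cons_of_kind (by omega)]
    simpa using hA.X v
  · cases e with
    | exY x y =>
      have hY := hA.Y v
      have := mem_augmentY_cons (w := v) (u := x) he.2.1 hPY
      simp only [Arc.tail, Arc.head, Vertex.pos, ne_eq, Nat.reduceEqDiff, not_false_eq_true,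
        setN_N_of_ne, setN_N, pos_eq_iff, this, hY]
      by_cases h3 : v = x <;> by_cases h4 : v = y <;> simp [h3, h4]
    | _ => simp [Arc.kind] at h2
  · rw [augmentX_cons_of_kind h1]
    simpa using hA.X v
  · rw [augmentY_cons_of_kind h2]
    simpa using hA.Y v

def traceProg : Prog :=
  .seq (.letN 46 (.add (.var 10) (.lit 1))) <|
  .forN 21 (.get 33 (.add (.var 10) (.lit 1))) traceStep

theorem runs_trace {m : Mem} {L : List (Arc I)} (hS : Setup I m)
    (hX : ∀ v, m.N 25 (I.pos v) = if v ∈ S.X then 1 else 0)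
    (hY : ∀ v, m.N 26 (I.pos v) = if v ∈ S.Y then 1 else 0)
    (hA : ArcList S L m) (hlab : Labels S m) (hL : ∀ e, e ∈ L ↔ I.HasArc I.compl S e)
    (hpred : ∀ v : Vertex I, m.D 15 v.pos ≠ ⊤ → m.N 33 v.pos ≠ 0 → ∃ (j : ℕ) (hj : j < L.length),
      m.N 34 v.pos = j ∧ L[j].head = v ∧ relaxed S m L[j] = memLabel m v)
    (ht : m.D 15 (Vertex.t : Vertex I).pos ≠ ⊤) :
    Runs traceProg m (100 * m.N 33 (Vertex.t : Vertex I).pos + 50) fun m' => ∃ P,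
      I.IsWalk I.compl S .s .t P ∧ walkLabel S P = memLabel m (Vertex.t : Vertex I) ∧
        Augmented S P m' := by
  have htp : (Vertex.t : Vertex I).pos = I.n + 1 := rfl
  unfold traceProg
  refine Runs.cost_le (Runs.seq (Runs.of_wp (Q := fun m' => m'.N 46 0 = (Vertex.t : Vertex I).pos)
    (by simp [Prog.wp, NExp.eval, hS.n, htp])) fun m1 hF1 h1 => Runs.forN_wp
    (N := m.N 33 (Vertex.t : Vertex I).pos)
    (c := 90 * m.N 33 (Vertex.t : Vertex I).pos + 40)
    -- After `k` steps the traced walk `P` leads from the current vertex to the sink, and together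
    -- with the label of that vertex it accounts for both components of the label of the sink.
    (fun k m' => ∃ (w : Vertex I) (P : List (Arc I)), m'.N 46 0 = w.pos ∧
      I.IsWalk I.compl S w .t P ∧ P.length = k ∧
      m.N 33 w.pos + k = m.N 33 (Vertex.t : Vertex I).pos ∧
      m.D 15 w.pos + ((I.pathLength I.compl S P : ℝ) : WithTop ℝ) =
        m.D 15 (Vertex.t : Vertex I).pos ∧ Augmented S P m')
    (fun m' hF => ?_) ?_ (by decide) ?_ ?_ ?_) ?_
  · have hFF := hF1.append hF
    simp [hFF.N 10 (by decide), hFF.N 33 (by decide), hS.n, htp]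
  · simp only [Prog.time, traceStep, NExp.cost, BExp.cost, Nat.reduceAdd]; omega
  · have h25 : m1.N 25 = m.N 25 := hF1.N 25 (by decide)
    have h26 : m1.N 26 = m.N 26 := hF1.N 26 (by decide)
    refine ⟨.t, [], by simp [h1], rfl, rfl, rfl, by simp [pathLength], fun v => ?_, fun v => ?_⟩
    · simp [mem_augmentX, h25, hX]
    · simp [mem_augmentY, h26, hY]
  · rintro k m' hk hF hii ⟨w, P, hw, hP, hlen, hhop, hdist, hAug⟩
    have hFF := hF1.append hF
    have hwt : m.D 15 w.pos ≠ ⊤ := by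
      intro h
      rw [h, WithTop.top_add] at hdist
      exact ht hdist.symm
    obtain ⟨j, hj, h34, hhead, htight⟩ := hpred w hwt (by omega)
    have he := (hL _).1 (List.getElem_mem hj)
    have ht' := memLabel_eq_iff.1 htight
    refine wp_traceStep hw (by rw [hFF.N 34 (by decide), h34])
      ((hA.frame hFF (by decide) (by decide)).code j hj) he hP.hasArc hAug fun m'' hAug' h46 => ?_
    refine ⟨L[j].tail, L[j] :: P, by simp [h46], ⟨he, rfl, hhead ▸ hP⟩, by simp [hlen], ?_, ?_, ?_⟩
    · omega
    · rw [← hdist, ← ht'.1, add_assoc, ← WithTop.coe_add]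
      simp [pathLength]
    · exact ⟨fun v => by simpa using hAug'.X v, fun v => by simpa using hAug'.Y v⟩
  · rintro m' - - ⟨w, P, hw, hP, hlen, hhop, hdist, hAug⟩
    have hwt : m.D 15 w.pos ≠ ⊤ := by
      intro h
      rw [h, WithTop.top_add] at hdist
      exact ht hdist.symm
    obtain ⟨Q, hQ, hd, hh⟩ := hlab.exists_walk hwt
    -- The remaining arc count is zero, and only the source is reached by a walk without arcs.
    obtain rfl : Q = [] := List.eq_nil_of_length_eq_zero (by omega)
    obtain rfl : Vertex.s = w := hQ
    refine ⟨P, hP, memLabel_eq_iff.2 ⟨?_, hlen⟩, hAug⟩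
    rw [← hdist, hd]
    simp [pathLength]
  · simp only [Prog.time, NExp.cost, Nat.reduceAdd]; omega

/-- A walk with the best label is a shortest path with the fewest arcs, as an iteration requires. -/
theorem Certified.iteration_of_labels (C : Certified I.compl S q) {m : Mem} (hlab : Labels S m)
    (hXY : S.X ≠ S.Y) {P : List (Arc I)} (hP : I.IsWalk I.compl S .s .t P)
    (hPl : walkLabel S P = memLabel m (Vertex.t : Vertex I)) :
    I.Iteration I.compl S ⟨I.augmentX S.X P, I.augmentY S.Y P,
      fun v => S.p v + (m.D 15 v.pos).untopD 0⟩ := by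
  have hmin : ∀ Q, I.IsWalk I.compl S .s .t Q → walkLabel S P ≤ walkLabel S Q := by
    intro Q hQ
    rw [hPl]
    exact hlab.2 _ _ hQ
  have hle : ∀ Q, I.IsWalk I.compl S .s .t Q →
      I.pathLength I.compl S P ≤ I.pathLength I.compl S Q ∧
      (I.pathLength I.compl S Q ≤ I.pathLength I.compl S P → P.length ≤ Q.length) := by
    intro Q hQ
    have h := label_le_iff.1 (hmin Q hQ)
    rw [WithTop.coe_le_coe, WithTop.coe_le_coe] at h
    exact ⟨h.1, fun h' => not_lt.1 fun h'' => h.2 ⟨h', h''⟩⟩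
  -- A path contained in `P` as a sublist is not longer. Minimality of the label forces it to have
  -- as many arcs as `P`, so it equals `P`.
  have hpath : I.IsPath I.compl S .s .t P := by
    obtain ⟨Q, hQ, hs⟩ := hP.exists_path
    have h1 : I.pathLength I.compl S Q ≤ I.pathLength I.compl S P :=
      (hs.map _).sum_le_sum fun x hx => by
        obtain ⟨e, he, rfl⟩ := List.mem_map.1 hx
        exact C.modLength_nonneg (hP.hasArc e he) (hP.reach Reach.source e he)
    rwa [hs.eq_of_length_le ((hle Q hQ.1).2 h1)] at hQ
  have hshort : I.IsShortestPath I.compl S .s .t P := ⟨hpath, fun Q hQ => (hle Q hQ.1).1⟩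
  refine ⟨?_, fun v => (m.D 15 v.pos).untopD 0, P, fun v Q hQ => ?_, fun v hv => ?_, hshort,
    fun Q hQ => (hle Q hQ.1.1).2 (hQ.2 P hpath), rfl, rfl, fun _ => rfl⟩
  · rintro (h | h | h)
    exacts [hXY h, C.fin h, h ⟨P, hpath⟩]
  · have h1 := hlab.le hQ.1.1
    obtain ⟨Q', hQ', h2, -⟩ := hlab.exists_walk (ne_top_of_le_ne_top WithTop.coe_ne_top h1)
    rw [h2] at h1
    have h3 := C.shortest_le_walk hQ hQ'
    simp only [h2, WithTop.untopD_coe]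
    exact le_antisymm (WithTop.coe_le_coe.1 h1) h3
  · have : m.D 15 v.pos = ⊤ := by
      by_contra h
      obtain ⟨Q, hQ, -, -⟩ := hlab.exists_walk h
      obtain ⟨Q', hQ', -⟩ := hQ.exists_path
      exact hv ⟨Q', hQ'⟩
    simp only [this, WithTop.untopD_top]

/-! ### One iteration of the third step -/

def augmentProg : Prog := .seq predProg <| .seq potentialProg traceProg

theorem Certified.runs_augment (C : Certified I.compl S q) {m : Mem} {L : List (Arc I)}
    (hS : Setup I m) (hM : StateMem S m) (hA : ArcList S L m) (hlab : Labels S m)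
    (hL : ∀ e, e ∈ L ↔ I.HasArc I.compl S e) (hlen : L.length ≤ I.n * (I.r + 3))
    (hXY : S.X ≠ S.Y) (ht : m.D 15 (Vertex.t : Vertex I).pos ≠ ⊤) :
    Runs augmentProg m (1500 * (I.n * (I.r * I.r))) fun m' =>
      ∃ S', I.Iteration I.compl S S' ∧ StateMem S' m' := by
  have hr := I.r_pos
  unfold augmentProg
  -- The tracing time is the number of arcs in the label of the sink; comparison with a path that is
  -- no longer than the labelled walk bounds it by `2r + 2`.
  have hhop : m.N 33 (Vertex.t : Vertex I).pos ≤ I.r + I.r + 2 := by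
    obtain ⟨Q, hQ, h1⟩ := (hlab.1 _).resolve_left ht
    obtain ⟨Q', hQ', h2, h3⟩ := C.exists_path hQ
    have h4 := label_le_iff.1 (h1 ▸ hlab.2 _ _ hQ'.1 : walkLabel S Q ≤ walkLabel S Q')
    have h5 := hQ'.length_le (fbarR_ne_top C.fin) C.feas.card
    have h6 := (memLabel_eq_iff.1 h1.symm).2
    by_contra h
    exact h4.2 ⟨WithTop.coe_le_coe.2 h2, by omega⟩
  refine Runs.cost_le (Runs.seq (runs_pred hA hlab hL) fun m1 hF1 h1 => Runs.seq
    (runs_potential (S := S) (hS.frame hF1 (by decide) (by decide))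
      (hM.frame hF1 (by decide) (by decide)).p)
    fun m2 hF2 h2 => (runs_trace (S := S) (m := m2) (L := L) ?_ ?_ ?_ ?_ ?_ hL (fun v hv hk => ?_)
      ?_).mono (?_ : _ ≤ 100 * (I.r + I.r + 2) + 50) fun m3 hF3 h3 => ?_) ?_
  · exact hS.frame (hF1.append hF2) (by decide) (by decide)
  · rw [(hF1.append hF2).N 25 (by decide)]; exact hM.X
  · rw [(hF1.append hF2).N 26 (by decide)]; exact hM.Y
  · exact hA.frame (hF1.append hF2) (by decide) (by decide)
  · exact hlab.frame (hF1.append hF2) (by decide) (by decide)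
  · rw [(hF1.append hF2).D 15 (by decide)] at hv
    rw [(hF1.append hF2).N 33 (by decide)] at hk
    obtain ⟨j, hj, h3, h4, h5⟩ := h1 v hv hk
    refine ⟨j, hj, by rw [hF2.N 34 (by decide), h3], h4, ?_⟩
    rw [relaxed_frame (hF1.append hF2) (by decide) (by decide),
      memLabel_frame (hF1.append hF2) (by decide) (by decide), h5]
  · rwa [(hF1.append hF2).D 15 (by decide)]
  · rw [(hF1.append hF2).N 33 (by decide)]
    omega
  · obtain ⟨P, hP, h4, h5⟩ := h3
    rw [memLabel_frame (hF1.append hF2) (by decide) (by decide)] at h4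
    refine ⟨_, C.iteration_of_labels hlab hXY hP h4, h5.X, h5.Y, fun v => ?_⟩
    rw [hF3.D 16 (by decide), h2 v, hF1.D 15 (by decide)]
  · have h1 : I.n ≤ I.n * I.r := Nat.le_mul_of_pos_right _ hr
    have h2 : I.n * I.r ≤ I.n * (I.r * I.r) := Nat.mul_le_mul_left _ (Nat.le_mul_of_pos_left _ hr)
    have h4 : I.n * (I.r + 3) = I.n * I.r + 3 * I.n := by ring
    have h6 := two_mul_r_le I
    omega

end BinaryVCSP

/-! ## The complete program -/

namespace BinaryVCSP

open RAM

variable {I : BinaryVCSP}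

theorem Run.Recorded.frame {R : Run I} {m m' : Mem} {wN wD : List ℕ} (h : R.Recorded m)
    (hF : Frame wN wD m m') (hN : ∀ a ∈ [2, 3, 4, 5], a ∉ wN) (hD : ∀ a ∈ [2, 3], a ∉ wD) :
    R.Recorded m' := by
  have e2 := hF.N 2 (hN 2 (by simp))
  have e3 := hF.N 3 (hN 3 (by simp))
  have e4 := hF.N 4 (hN 4 (by simp))
  have e5 := hF.N 5 (hN 5 (by simp))
  have d2 := hF.D 2 (hD 2 (by simp))
  have d3 := hF.D 3 (hD 3 (by simp))
  unfold Run.Recorded at h ⊢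
  rwa [e2, e3, e4, e5, d2, d3]

/-- The memory holds a run of the algorithm with the completion `compl`. -/
structure RunMem (R : Run I) (m : Mem) : Prop where
  setup : Setup I m
  table : Table I m
  h : R.h = I.compl
  recorded : R.Recorded m
  rowN : m.N 37 0 = R.K * I.n
  rowP : m.N 38 0 = R.K * (I.n + 2)

theorem RunMem.frame {R : Run I} {m m' : Mem} {wN wD : List ℕ} (h : RunMem R m)
    (hF : Frame wN wD m m') (hN : ∀ a ∈ [0, 10, 11, 12, 13, 2, 3, 4, 5, 37, 38], a ∉ wN)
    (hD : ∀ a ∈ [0, 1, 2, 3], a ∉ wD) : RunMem R m' where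
  setup := h.setup.frame hF (fun a ha => hN a (by simp only [List.mem_cons] at ha ⊢; tauto))
    fun a ha => hD a (by simp only [List.mem_cons] at ha ⊢; tauto)
  table := h.table.frame hF (hD 2 (by simp))
  h := h.h
  recorded := h.recorded.frame hF (fun a ha => hN a (by simp only [List.mem_cons] at ha ⊢; tauto))
    fun a ha => hD a (by simp only [List.mem_cons] at ha ⊢; tauto)
  rowN := by rw [hF.N 37 (hN 37 (by simp)), h.rowN]
  rowP := by rw [hF.N 38 (hN 38 (by simp)), h.rowP]

/-- A run followed by one more iteration. -/
def Run.extend (R : Run I) (S' : State I) (h : I.Iteration R.h (R.st R.K) S') : Run I where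
  h := R.h
  completion := R.completion
  g := R.g
  greedy := R.greedy
  K := R.K + 1
  st := Function.update R.st (R.K + 1) S'
  init_X := by rw [Function.update_of_ne (by omega)]; exact R.init_X
  init_Y := by rw [Function.update_of_ne (by omega)]; exact R.init_Y
  init_p := by rw [Function.update_of_ne (by omega)]; exact R.init_p
  iteration := by
    intro k hk
    rcases Nat.lt_succ_iff_lt_or_eq.1 hk with h' | rfl
    · rw [Function.update_of_ne (by omega), Function.update_of_ne (by omega)]
      exact R.iteration k h'
    · rw [Function.update_of_ne (by omega), Function.update_self]
      exact h

/-! ### One iteration of the third step -/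

def advanceProg : Prog :=
  .seq augmentProg <|
  .seq (.seq (.letN 3 (.add (.var 3) (.lit 1))) <|
    .seq (.letN 37 (.add (.var 37) (.var 10)))
    (.letN 38 (.add (.var 38) (.add (.var 10) (.lit 2)))))
  recordProg

theorem runs_advance {R : Run I} {q : Vertex I → ℝ} {m : Mem} {L : List (Arc I)}
    (hR : RunMem R m) (C : Certified I.compl (R.st R.K) q) (hM : StateMem (R.st R.K) m)
    (hA : ArcList (R.st R.K) L m) (hlab : Labels (R.st R.K) m)
    (hL : ∀ e, e ∈ L ↔ I.HasArc I.compl (R.st R.K) e) (hlen : L.length ≤ I.n * (I.r + 3))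
    (hXY : (R.st R.K).X ≠ (R.st R.K).Y) (ht : m.D 15 (Vertex.t : Vertex I).pos ≠ ⊤) :
    Runs advanceProg m (1500 * (I.n * (I.r * I.r)) + 50 + 200 * I.n) fun m' => ∃ R' : Run I,
      RunMem R' m' ∧ StateMem (R'.st R'.K) m' ∧ R'.K = R.K + 1 ∧ (R'.st 0).X = (R.st 0).X := by
  unfold advanceProg
  refine Runs.cost_le (Runs.seq (C.runs_augment hR.setup hM hA hlab hL hlen hXY ht)
    fun m1 hF1 h1 => Runs.seq (Runs.of_wp (Q := fun m' => m'.N 3 0 = R.K + 1 ∧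
      m'.N 37 0 = (R.K + 1) * I.n ∧ m'.N 38 0 = (R.K + 1) * (I.n + 2)) ?_) fun m2 hF2 h2 =>
    (runs_record (hR.setup.frame (hF1.append hF2) (by decide) (by decide)) h2.2.1 h2.2.2).mono
      le_rfl fun m3 hF3 h3 => ?_) ?_
  · have hR1 := hR.frame hF1 (by decide) (by decide)
    have h3 := hR1.recorded.2.2.1
    simp [h3, hR1.setup.n, hR1.rowN, hR1.rowP, add_mul]
  · obtain ⟨S', hit, hS'⟩ := h1
    have hFF := hF1.append hF2
    have hFFF := hFF.append hF3
    have hS2 := hS'.frame hF2 (by decide) (by decide)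
    obtain ⟨r1, r2, -, r4, r5, r6⟩ := hR.recorded
    obtain ⟨o1, o2, o3, n1, n2, n3⟩ := h3
    have e4 : m2.N 4 = m.N 4 := hFF.N 4 (by decide)
    have e5 : m2.N 5 = m.N 5 := hFF.N 5 (by decide)
    have e3 : m2.D 3 = m.D 3 := hFF.D 3 (by decide)
    have f2 : m3.N 2 = m.N 2 := hFFF.N 2 (by decide)
    have f2' : m3.D 2 = m.D 2 := hFFF.D 2 (by decide)
    rw [← hR.h] at hit
    -- Entries of earlier rows lie before the beginning of the new row and are therefore not
    -- overwritten.
    have hlt : ∀ {k a N : ℕ}, k < R.K + 1 → a < N → k * N + a < (R.K + 1) * N := by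
      intro k a N hk ha
      have := Nat.mul_le_mul_right N (show k + 1 ≤ R.K + 1 by omega)
      rw [add_mul] at this
      omega
    have hst : (R.extend S' hit).st (R.K + 1) = S' := Function.update_self ..
    have hst' : ∀ {k}, k < R.K + 1 → (R.extend S' hit).st k = R.st k :=
      fun h => Function.update_of_ne (by omega) ..
    refine ⟨R.extend S' hit, ⟨hR.setup.frame hFFF (by decide) (by decide),
      hR.table.frame hFFF (by decide), hR.h, ⟨?_, ?_, ?_, ?_, ?_, ?_⟩, ?_, ?_⟩, ?_, rfl, ?_⟩
    · rw [f2']; exact r1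
    · rw [f2]; exact r2
    · rw [hF3.N 3 (by decide)]; exact h2.1
    · intro k hk u
      rcases Nat.lt_succ_iff_lt_or_eq.1 (Nat.lt_succ_iff.2 hk) with h' | rfl
      · rw [o1 _ (hlt h' (pos_lt u)), e4, hst' h']
        exact r4 k (Nat.lt_succ_iff.1 h') u
      · rw [show (R.extend S' hit).K = R.K + 1 from rfl, n1 _ (pos_lt u), hst, hS2.X]
    · intro k hk u
      rcases Nat.lt_succ_iff_lt_or_eq.1 (Nat.lt_succ_iff.2 hk) with h' | rfl
      · rw [o2 _ (hlt h' (pos_lt u)), e5, hst' h']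
        exact r5 k (Nat.lt_succ_iff.1 h') u
      · rw [show (R.extend S' hit).K = R.K + 1 from rfl, n2 _ (pos_lt u), hst, hS2.Y]
    · intro k hk v
      rcases Nat.lt_succ_iff_lt_or_eq.1 (Nat.lt_succ_iff.2 hk) with h' | rfl
      · rw [o3 _ (hlt h' v.pos_lt), e3, hst' h']
        exact r6 k (Nat.lt_succ_iff.1 h') v
      · rw [show (R.extend S' hit).K = R.K + 1 from rfl, n3 _ v.pos_lt, hst, hS2.p]
    · rw [hF3.N 37 (by decide)]; exact h2.2.1
    · rw [hF3.N 38 (by decide)]; exact h2.2.2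
    · rw [show (R.extend S' hit).K = R.K + 1 from rfl, hst]
      exact hS2.frame hF3 (by decide) (by decide)
    · rw [hst' (by omega)]
  · simp only [Prog.time, NExp.cost, Nat.reduceAdd]; omega

/-- The two tests detect `X = Y` and an infinite label at the sink. The third stopping criterion is
tested only at the start, since the invariant keeps `fbarR` finite afterwards. -/
def iterProg : Prog :=
  .seq listProg <|
  .ite (.neq (.var 40) (.lit 0)) (.letN 36 (.lit 1)) <|
  .seq arcsProg <|
  .seq labelProg <|
  .ite (.dle .top (.get 15 (.add (.var 10) (.lit 1)))) (.letN 36 (.lit 1)) advanceProg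

/-- The invariant of the loop: either the run is finished, or `k` iterations were executed. -/
def LoopInv (I : BinaryVCSP) (k : ℕ) (m : Mem) : Prop :=
  ∃ R : Run I, RunMem R m ∧ StateMem (R.st R.K) m ∧
    (m.N 36 0 = 1 ∧ R.Finished ∨
      m.N 36 0 = 0 ∧ R.K = k ∧ I.fbarR I.compl (R.st 0).X ≠ ⊤)

theorem LoopInv.frame {k : ℕ} {m m' : Mem} {wN wD : List ℕ} (h : LoopInv I k m)
    (hF : Frame wN wD m m')
    (hN : ∀ a ∈ [0, 10, 11, 12, 13, 2, 3, 4, 5, 37, 38, 25, 26, 36], a ∉ wN)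
    (hD : ∀ a ∈ [0, 1, 2, 3, 16], a ∉ wD) : LoopInv I k m' := by
  obtain ⟨R, h1, h2, h3⟩ := h
  refine ⟨R, h1.frame hF (fun a ha => hN a (by simp only [List.mem_cons] at ha ⊢; tauto))
    (fun a ha => hD a (by simp only [List.mem_cons] at ha ⊢; tauto)),
    h2.frame hF (fun a ha => hN a (by simp only [List.mem_cons] at ha ⊢; tauto))
    (hD 16 (by simp)), ?_⟩
  rwa [hF.N 36 (hN 36 (by simp))]

theorem runs_iter {R : Run I} {m : Mem} (hR : RunMem R m)
    (hM : StateMem (R.st R.K) m) (hfin : I.fbarR I.compl (R.st 0).X ≠ ⊤) (hm : m.N 36 0 = 0) :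
    Runs iterProg m (9000 * (I.n * (I.r * I.r))) (LoopInv I (R.K + 1)) := by
  have hr := I.r_pos
  obtain ⟨q, C⟩ := R.certified (by rwa [hR.h]) R.K le_rfl
  rw [hR.h] at C
  have hX := C.fin
  have hY := C.feas
  have hfinish : ∀ {m' : Mem} {wN wD : List ℕ}, Frame wN wD m m' →
      (∀ a ∈ [0, 10, 11, 12, 13, 2, 3, 4, 5, 37, 38, 25, 26], a ∉ wN) →
      (∀ a ∈ [0, 1, 2, 3, 16], a ∉ wD) → R.Finished → LoopInv I (R.K + 1) (m'.setN 36 0 1) := by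
    intro m' wN wD hF hN hD hfi
    have hF' := hF.append (frame_setN (wN := [36]) (wD := []) (m := m') (i := 0) (k := 1)
      (by simp : 36 ∈ [36]))
    have hN' : ∀ a ∈ [0, 10, 11, 12, 13, 2, 3, 4, 5, 37, 38, 25, 26], a ∉ wN ++ [36] := by
      intro a ha h
      rcases List.mem_append.1 h with h | h
      · exact hN a ha h
      · rw [List.mem_singleton] at h; subst h; simp at ha
    have hD' : ∀ a ∈ [0, 1, 2, 3, 16], a ∉ wD ++ [] := by simpa using hD
    exact ⟨R, hR.frame hF' (fun a ha => hN' a (by simp only [List.mem_cons] at ha ⊢; tauto))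
      (fun a ha => hD' a (by simp only [List.mem_cons] at ha ⊢; tauto)),
      hM.frame hF' (fun a ha => hN' a (by simp only [List.mem_cons] at ha ⊢; tauto))
      (hD' 16 (by simp)), Or.inl ⟨by simp, hfi⟩⟩
  unfold iterProg
  refine Runs.cost_le (Runs.seq (runs_list hR.setup hM (fbarR_ne_top hX) hY) fun m1 hF1 h1 =>
    Runs.ite (fun hb => Runs.of_wp ?_) fun hb => (?_ : Runs _ _
      (6000 * (I.n * (I.r * I.r)) + 1500 * (I.n * (I.r * I.r)) + 300 * I.n) _)) ?_
  · have h40 : m1.N 40 0 = 0 := by simpa using hb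
    exact hfinish hF1 (by decide) (by decide) (Or.inl (h1.2.1 h40))
  · have h40 : m1.N 40 0 ≠ 0 := by simpa using hb
    obtain ⟨⟨xl, hL⟩, h4⟩ := h1
    have hXY : (R.st R.K).X ≠ (R.st R.K).Y := fun h => h40 (h4.2 h)
    have hR1 := hR.frame hF1 (by decide) (by decide)
    have hM1 := hM.frame hF1 (by decide) (by decide)
    refine Runs.cost_le (Runs.seq (runs_arcs hR1.setup hR1.table hM1 hL hX hY) fun m2 hF2 h2 =>
      (?_ : Runs _ _ (3000 * (I.n * (I.r * I.r)) + (100 + (1500 * (I.n * (I.r * I.r)) + 50 +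
        200 * I.n))) _)) ?_
    · obtain ⟨L, l1, l2, l3⟩ := h2
      have hL' : ∀ e, e ∈ L ↔ I.HasArc I.compl (R.st R.K) e := fun e => by rw [l2, and_true]
      have hR2 := hR1.frame hF2 (by decide) (by decide)
      have hM2 := hM1.frame hF2 (by decide) (by decide)
      refine Runs.seq (C.runs_label hR2.setup l3 hL' l1) fun m3 hF3 h3 => ?_
      have hR3 := hR2.frame hF3 (by decide) (by decide)
      have hM3 := hM2.frame hF3 (by decide) (by decide)
      have htp : (Vertex.t : Vertex I).pos = I.n + 1 := rfl
      have hb3 : (BExp.dle .top (.get 15 (.add (.var 10) (.lit 1)))).eval m3 ↔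
          m3.D 15 (Vertex.t : Vertex I).pos = ⊤ := by
        simp [hR3.setup.n, htp]
      refine Runs.cost_le (Runs.ite (fun hb => Runs.of_wp ?_) fun hb =>
        (runs_advance hR3 C hM3 (l3.frame hF3 (by decide) (by decide)) h3 hL' l1 hXY
          (fun h => hb (hb3.2 h))).mono le_rfl fun m4 hF4 h4' => ?_) ?_
      · refine hfinish ((hF1.append hF2).append hF3) (by decide) (by decide) (Or.inr (Or.inr ?_))
        rintro ⟨P, hP⟩
        rw [hR.h] at hP
        have := h3.le hP.1
        rw [hb3.1 hb, top_le_iff] at this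
        exact WithTop.coe_ne_top this
      · obtain ⟨R', a1, a2, a3, a4⟩ := h4'
        refine ⟨R', a1, a2, Or.inr ⟨?_, a3, by rwa [a4]⟩⟩
        rw [(((hF1.append hF2).append hF3).append hF4).N 36 (by decide), hm]
      · simp only [Prog.time, NExp.cost, BExp.cost, DExp.cost, Nat.reduceAdd]; omega
    · have h1 : I.n ≤ I.n * I.r := Nat.le_mul_of_pos_right _ hr
      have h6 := two_mul_r_le I
      omega
  · have h1 : I.n ≤ I.n * I.r := Nat.le_mul_of_pos_right _ hr
    have h2 : I.n * I.r ≤ I.n * (I.r * I.r) := Nat.mul_le_mul_left _ (Nat.le_mul_of_pos_left _ hr)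
    have h6 := two_mul_r_le I
    simp only [Prog.time, NExp.cost, BExp.cost, Nat.reduceAdd]
    omega

/-- At most `r` iterations are possible, so in `r + 1` rounds at least one round detects
termination; rounds after that do nothing. -/
def augmentLoop : Prog :=
  .forN 24 (.add (.var 0) (.lit 1)) <| .ite (.neq (.var 36) (.lit 0)) iterProg .skip

theorem runs_augmentLoop {m : Mem} (h : LoopInv I 0 m) (hS : Setup I m) :
    Runs augmentLoop m (20000 * (I.n * I.r ^ 3)) fun m' => ∃ R : Run I, RunMem R m' ∧
      StateMem (R.st R.K) m' ∧ R.Finished := by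
  have hr := I.r_pos
  unfold augmentLoop
  refine Runs.cost_le (Runs.forN (N := I.r + 1) (LoopInv I) (fun m' hF => ?_) ?_ (by decide)
    (fun k m' hk hF hik hI => (?_ : Runs _ _ (9000 * (I.n * (I.r * I.r)) + 11) _)) ?_) ?_
  · simp [hF.N 0 (by decide), hS.r]
  · exact h.frame (wN := [24]) (wD := []) (frame_setN (by simp)) (by decide) (by decide)
  · obtain ⟨R, h1, h2, h3⟩ := hI
    have hgo : ∀ {m'' : Mem}, LoopInv I (k + 1) m'' → LoopInv I (k + 1) (m''.setN 24 0 (k + 1)) :=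
      fun h => h.frame (wN := [24]) (wD := []) (frame_setN (by simp)) (by decide) (by decide)
    refine Runs.cost_le (Runs.ite (fun hb =>
      (?_ : Runs _ _ (9000 * (I.n * (I.r * I.r))) _)) fun hb =>
      Runs.of_wp (Q := fun m'' => LoopInv I (k + 1) (m''.setN 24 0 (k + 1))) ?_) ?_
    · have h36 : m'.N 36 0 = 0 := by simpa using hb
      rcases h3 with ⟨h3, -⟩ | ⟨-, rfl, h4⟩
      · omega
      · exact (runs_iter h1 h2 h4 h36).mono le_rfl fun _ _ h => hgo h
    · have h36 : m'.N 36 0 ≠ 0 := by simpa using hb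
      rcases h3 with h3 | ⟨h3, -⟩
      · exact hgo ⟨R, h1, h2, Or.inl h3⟩
      · exact absurd h3 h36
    · simp only [Prog.time, NExp.cost, BExp.cost, Nat.reduceAdd]; omega
  · rintro m' - - ⟨R, h1, h2, h3 | ⟨-, h3, -⟩⟩
    · exact ⟨R, h1, h2, h3.2⟩
    -- Without termination the recorded run would consist of `r + 1` iterations.
    · have := R.K_le
      omega
  · simp only [NExp.cost, Nat.reduceAdd]
    have h1 : I.n ≤ I.n * (I.r * I.r) := Nat.le_mul_of_pos_right _ (Nat.mul_pos hr hr)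
    have h2 : I.n * (I.r * I.r) ≤ I.n * I.r ^ 3 :=
      Nat.mul_le_mul_left _ (by rw [pow_succ, sq]; exact Nat.le_mul_of_pos_right _ hr)
    have h3 : (I.r + 1) * (9000 * (I.n * (I.r * I.r)) + 11 + 4 + 11) =
      9000 * (I.n * I.r ^ 3) + 9000 * (I.n * (I.r * I.r)) + 26 * I.r + 26 := by ring
    have h6 := two_mul_r_le I
    omega

/-! ### The beginning and the end of the program -/

/-- A run before the first iteration. -/
noncomputable def Run.initial (hI : I.ZFree) {g : Fin I.r → I.U} (hg : I.IsGreedy I.compl g) :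
    Run I where
  h := I.compl
  completion := isCompletion_compl hI
  g := g
  greedy := hg
  K := 0
  st := fun _ => ⟨Finset.univ.image g, I.vec I.firstValues, fun _ => 0⟩
  init_X := rfl
  init_Y := ⟨_, rfl⟩
  init_p := fun _ => rfl
  iteration := fun _ h => absurd h (Nat.not_lt_zero _)

def startProg : Prog :=
  .seq setupProg <| .seq primProg <| .seq greedyProg <| .seq initProg recordProg

theorem runs_start (hI : I.ZFree) {m : Mem} (hm : I.Encoded m) :
    Runs startProg m (600 * I.n + 1000 * I.n ^ 2 + 1000 * (I.n * I.r)) fun m' =>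
      Setup I m' ∧ LoopInv I 0 m' := by
  unfold startProg
  refine Runs.cost_le (Runs.seq (runs_setup hm) fun m1 hF1 hS1 => Runs.seq (runs_prim hI hS1)
    fun m2 hF2 hT2 => Runs.seq (runs_greedy (hS1.frame hF2 (by decide) (by decide)) hT2)
    fun m3 hF3 h3 => Runs.seq (runs_init (hS1.frame (hF2.append hF3) (by decide) (by decide)))
    fun m4 hF4 h4 => (runs_record (a := 0) (b := 0)
      (hS1.frame ((hF2.append hF3).append hF4) (by decide) (by decide)) ?_ ?_).mono le_rfl
      fun m5 hF5 h5 => ?_) ?_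
  · exact h4.2.2.2.1
  · exact h4.2.2.2.2.1
  · obtain ⟨g, hg, g2, g3, g4⟩ := h3
    obtain ⟨i1, i2, i3, i4, i5, i6, i7⟩ := h4
    obtain ⟨-, -, -, n1, n2, n3⟩ := h5
    have hS5 := hS1.frame (((hF2.append hF3).append hF4).append hF5) (by decide) (by decide)
    have hT5 : Table I m5 :=
      Table.frame hT2 ((hF3.append hF4).append hF5) (by decide)
    have f2 : m5.N 2 = m3.N 2 := (hF4.append hF5).N 2 (by decide)
    have f25 : m5.N 25 = m3.N 25 := (hF4.append hF5).N 25 (by decide)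
    have f25' : m4.N 25 = m3.N 25 := hF4.N 25 (by decide)
    refine ⟨hS5, Run.initial hI hg, ⟨hS5, hT5, rfl, ⟨fun u v => hT5 u v, ?_, ?_, ?_, ?_, ?_⟩,
      ?_, ?_⟩, ⟨?_, ?_, ?_⟩, ?_⟩
    · rw [f2]; exact g2
    · rw [hF5.N 3 (by decide)]; exact i3
    · intro k hk u
      obtain rfl : k = 0 := Nat.le_zero.1 hk
      have := n1 _ (pos_lt u)
      rw [f25', g3 u, zero_add] at this
      rw [zero_mul, zero_add, this]
      congr
    · intro k hk u
      obtain rfl : k = 0 := Nat.le_zero.1 hk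
      have := n2 _ (pos_lt u)
      rw [i1 u, zero_add] at this
      rw [zero_mul, zero_add, this]
      congr
    · intro k hk v
      obtain rfl : k = 0 := Nat.le_zero.1 hk
      have := n3 _ v.pos_lt
      rw [i2 v, zero_add] at this
      rw [zero_mul, zero_add, this]
      rfl
    · rw [hF5.N 37 (by decide), i4]; exact (zero_mul _).symm
    · rw [hF5.N 38 (by decide), i5]; exact (zero_mul _).symm
    · rw [f25]; exact g3
    · rw [hF5.N 26 (by decide)]; exact i1
    · rw [hF5.D 16 (by decide)]; exact i2
    · obtain ⟨hc, -⟩ := IsGreedy.minimizer (isCompletion_compl hI).isUltra hg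
      -- The greedy set has size `r`, so the accumulated value of `fbar` is that of `fbarR`, and the
      -- flag decides the stopping criterion of an infinite value.
      have hfb : I.fbarR I.compl (Finset.univ.image g) = m3.D 13 0 := by
        rw [g4]; exact if_pos hc
      rw [hF5.N 36 (by decide)]
      by_cases htop : m3.D 13 0 = ⊤
      · exact Or.inl ⟨i6 htop, Or.inr (Or.inl (hfb.trans htop))⟩
      · exact Or.inr ⟨i7 htop, rfl, fun h => htop (hfb.symm.trans h)⟩
  · omega

/-- Values are recovered as the position of the chosen element relative to the beginning of its
block. -/
def outputProg : Prog :=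
  .forN 21 (.var 10) <| .ite (.neq (.get 26 (.var 21)) (.lit 1))
    (.setN 6 (.get 12 (.var 21)) (.sub (.var 21) (.get 11 (.get 12 (.var 21))))) .skip

theorem runs_output {m : Mem} {x : I.Assignment} (hS : Setup I m)
    (hY : ∀ v, m.N 26 (I.pos v) = if v ∈ I.vec x then 1 else 0) :
    Runs outputProg m (100 * I.n + 10) fun m' => I.Output m' x := by
  unfold outputProg
  refine Runs.forN_wp (N := I.n) (fun k m' => ∀ i, (I.pos ⟨i, x i⟩ : ℕ) < k → m'.N 6 i = x i)
    (fun m' hF => ?_) ?_ (by decide) ?_ ?_ ?_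
  · simp [hF.N 10 (by decide), hS.n]
  · simp only [Prog.time, NExp.cost, BExp.cost, Nat.reduceAdd]; omega
  · simp
  · rintro k m' hk hF hik hI
    obtain ⟨u, rfl⟩ := exists_pos hk
    have hS' := hS.frame hF (by decide) (by decide)
    have hu : m'.N 26 (I.pos u) = 1 ↔ u ∈ I.vec x := by
      rw [hF.N 26 (by decide), hY]; split_ifs <;> simp_all
    have hst := hS'.start u.1
    simp only [Prog.wp, BExp.eval, NExp.eval, hik, ← le_antisymm_iff, hu, hS'.cls, hst]
    refine ⟨fun h i hi => ?_, fun h i hi => ?_⟩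
    · rw [mem_vec] at h
      by_cases hiu : i = u.1
      · subst hiu
        rw [setN_N_of_ne (by decide), setN_N, if_pos rfl, pos_val, h]
        omega
      · have hne : (⟨i, x i⟩ : I.U) ≠ u := fun e => hiu (by rw [← e])
        have hne' : (i : ℕ) ≠ u.1 := fun e => hiu (Fin.ext e)
        rw [setN_N_of_ne (by decide), setN_N, if_neg hne']
        exact hI i (lt_of_le_of_ne (Nat.lt_succ_iff.1 hi) (pos_ne hne))
    · have hne : (⟨i, x i⟩ : I.U) ≠ u := by
        rintro rfl
        exact h (mem_vec.2 rfl)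
      rw [setN_N_of_ne (by decide)]
      exact hI i (lt_of_le_of_ne (Nat.lt_succ_iff.1 hi) (pos_ne hne))
  · rintro m' - - hI i
    exact hI i (pos_lt _)

def mainProg : Prog := .seq startProg <| .seq augmentLoop outputProg

theorem runs_main (hI : I.ZFree) {m : Mem} (hm : I.Encoded m) :
    Runs mainProg m (30000 * (I.n * I.r ^ 3 + I.n ^ 2)) fun m' =>
      ∃ (R : Run I) (x : I.Assignment), R.Finished ∧ R.Recorded m' ∧
        (R.st R.K).Y = I.vec x ∧ I.IsMinimizer x ∧ I.Output m' x := by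
  have hr := I.r_pos
  unfold mainProg
  refine Runs.cost_le (Runs.seq (runs_start hI hm) fun m1 hF1 h1 =>
    Runs.seq (runs_augmentLoop h1.2 h1.1) fun m2 hF2 h2 =>
      (?_ : Runs _ _ (100 * I.n + 10) _)) ?_
  · obtain ⟨R, hR, hM, hfin⟩ := h2
    obtain ⟨x, hx, hY, -⟩ := R.finished hfin
    refine (runs_output (x := x) hR.setup (hY ▸ hM.Y)).mono le_rfl fun m3 hF3 h3 => ?_
    exact ⟨R, x, hfin, hR.recorded.frame hF3 (by decide) (by decide), hY, hx, h3⟩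
  · have h1 : I.n ≤ I.n ^ 2 := by rw [sq]; exact Nat.le_mul_self _
    have h2 : I.n * I.r ≤ I.n * I.r ^ 3 :=
      Nat.mul_le_mul_left _ (Nat.le_self_pow (by norm_num) _)
    have h3 := two_mul_r_le I
    omega

end BinaryVCSP

/-- Correctness of every run of the algorithm, and an implementation, by one program for all
instances, that executes a complete run within the stated time. -/
theorem mainTheorem4 :
    (∀ I : BinaryVCSP, I.ZFree → ∀ R : BinaryVCSP.Run I,
      R.K ≤ I.r ∧
      (¬ R.Finished → ∃ S', I.Iteration R.h (R.st R.K) S') ∧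
      (R.Finished → ∃ x : I.Assignment, I.IsMinimizer x ∧ (R.st R.K).Y = I.vec x ∧
        ((R.st R.K).X = I.vec x ∨ ∀ y, I.f y = ⊤))) ∧
    ∃ (P : RAM.Prog) (C : ℝ), ∀ I : BinaryVCSP, I.ZFree → ∀ m : RAM.Mem, I.Encoded m →
      ∃ (t : ℕ) (m' : RAM.Mem), RAM.Exec P m t m' ∧
        (t : ℝ) ≤ C * ((I.n : ℝ) * (I.r : ℝ) ^ 3 + (I.n : ℝ) * (I.r : ℝ) * Real.log (I.n : ℝ)
          + (I.n : ℝ) ^ 2) ∧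
        ∃ (R : BinaryVCSP.Run I) (x : I.Assignment), R.Finished ∧ R.Recorded m' ∧
          (R.st R.K).Y = I.vec x ∧ I.IsMinimizer x ∧ I.Output m' x := by
  refine ⟨fun I _ R => ⟨R.K_le, BinaryVCSP.exists_iteration, R.finished⟩,
    BinaryVCSP.mainProg, 30000, fun I hI m hm => ?_⟩
  obtain ⟨t, m', hE, ht, hR⟩ := BinaryVCSP.runs_main hI hm
  refine ⟨t, m', hE, ?_, hR⟩
  have h1 : (t : ℝ) ≤ 30000 * ((I.n : ℝ) * (I.r : ℝ) ^ 3 + (I.n : ℝ) ^ 2) := by exact_mod_cast ht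
  -- The program already satisfies the bound without the logarithmic term, which only has to be
  -- nonnegative.
  have h2 : 0 ≤ (I.n : ℝ) * (I.r : ℝ) * Real.log (I.n : ℝ) :=
    mul_nonneg (by positivity) (Real.log_natCast_nonneg _)
  linarith
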